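/- Let $L_1=\langle O,F,E,\mathrm{eval}\rangle$ and let $T_1$ be the theory stating that $O$ and $F$ are disjoint sorts whose union is the universe, $E$ is an equivalence relation on $O$, and $\mathrm{eval}\colon F\times O\to O$ satisfies, for all $f\in F$ and $b,b'\in O$, $E(\mathrm{eval}(f,b),b)$, and $E(b,b')\Rightarrow \mathrm{eval}(f,b)=\mathrm{eval}(f,b')$ (each $\mathrm{eval}(f,-)$ is a selector function for $E$). Let $T^*_1$ be the theory of the Fraïssé limit of the class of finite models of $T_1$. For a model $M$, a set $A\subseteq M$ and a tuple $b$ in $M$: a formula $\varphi(x;b)$ *divides* over $A$ if, in some elementary extension of $M$, there is an $A$-indiscernible sequence $(b_i)_{i<\omega}$ with $b_0=b$ such that $\{\varphi(x;b_i):i<\omega\}$ is inconsistent; it *forks* over $A$ if, in some elementary extension of $M$, it implies a finite disjunction $\bigvee_i\psi_i(x;c_i)$ with each $\psi_i(x;c_i)$ dividing over $A$. A complete type over $M$ forks over $A$ if it contains a formula that forks over $A$, and it is $A$-invariant if, whenever $b\equiv_A b'$ are tuples of $M$ and $\varphi(x;y)$ is a formula, it contains $\varphi(x;b)$ if and only if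 it contains $\varphi(x;b')$. **Corollary 9.18.** $T^*_1$ is a complete theory which is $\mathrm{NSOP}_1$ (and $\mathrm{NSOP}_3$) and for which: 1. forking does not equal dividing, even over models: there is a formula $\varphi(x;z)$ such that for every model $M\models T^*_1$ there is a tuple $b$ in some elementary extension of $M$ such that $\varphi(x;b)$ forks over $M$ but does not divide over $M$; 2. nevertheless every type has a global non-forking, indeed invariant, extension: for every model $\mathbb{M}\models T^*_1$ (in particular for a monster model), every set $A\subseteq\mathbb{M}$ and every complete type $p(x)$ over $A$ in finitely many variables, there is a complete type $q(x)$ over $\mathbb{M}$ that extends $p$, is $A$-invariant and does not fork over $A$. In particular, $T^*_1$ is an $\mathrm{NSOP}_3$ theory in which every type has a global non-forking extension but forking is not equal to dividing. -/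

import Mathlib

open FirstOrder FirstOrder.Language

universe u

/-! ### The language, the theory `T₁`, and its Fraïssé-generic completion `T*₁` -/

/-- The only function symbol is the binary symbol `eval`. -/
inductive SelFunc : ℕ → Type
  | eval : SelFunc 2

/-- Unary predicates for the two sorts (`obj` for `O`, `fn` for `F`), and the binary relation `E`. -/
inductive SelRel : ℕ → Type
  | obj : SelRel 1
  | fn : SelRel 1
  | equiv : SelRel 2

/-- The language `⟨O, F, E, eval⟩`. -/
def selLang : FirstOrder.Language.{0, 0} := ⟨SelFunc, SelRel⟩

section Structures

variable {M : Type*} [selLang.Structure M]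

/-- `x` belongs to the sort `O` of objects. -/
def IsObj (x : M) : Prop := Structure.RelMap (L := selLang) SelRel.obj ![x]

/-- `x` belongs to the sort `F` of functions. -/
def IsFn (x : M) : Prop := Structure.RelMap (L := selLang) SelRel.fn ![x]

/-- The relation `E`. -/
def EqRel (x y : M) : Prop := Structure.RelMap (L := selLang) SelRel.equiv ![x, y]

/-- The value `eval(x, y)`. -/
def evalAt (x y : M) : M := Structure.funMap (L := selLang) SelFunc.eval ![x, y]

end Structures

/-- Models of `T₁`. The two sorts are disjoint predicates covering the universe, `E` is an
equivalence relation on `O`, and each `f ∈ F` names a selector function `eval(f, -)` for `E`.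
Function symbols of Mathlib's one-sorted languages are total, so `eval(x, y)` is set to be `y`
outside `F × O`, where the two-sorted function is undefined. -/
structure IsSelectorModel (M : Type*) [selLang.Structure M] : Prop where
  sorts : ∀ x : M, IsFn x ↔ ¬ IsObj x
  rel_obj : ∀ x y : M, EqRel x y → IsObj x ∧ IsObj y
  refl : ∀ x : M, IsObj x → EqRel x x
  symm : ∀ x y : M, EqRel x y → EqRel y x
  trans : ∀ x y z : M, EqRel x y → EqRel y z → EqRel x z
  eval_rel : ∀ f b : M, IsFn f → IsObj b → EqRel (evalAt f b) b
  eval_congr : ∀ f b b' : M, IsFn f → EqRel b b' → evalAt f b = evalAt f b'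
  eval_off : ∀ x y : M, ¬ (IsFn x ∧ IsObj y) → evalAt x y = y

/-- The class `𝕂₁` of finite models of `T₁`. -/
def finiteSelectorModels : Set (CategoryTheory.Bundled.{0} selLang.Structure) :=
  {M | Finite M ∧ IsSelectorModel M}

instance : Countable (Σ l, selLang.Functions l) := by
  have : Function.Injective (fun _ : (Σ l, selLang.Functions l) => ()) := by
    rintro ⟨_, ⟨⟩⟩ ⟨_, ⟨⟩⟩ _
    rfl
  exact this.countable

/-- `T*₁`: the set of sentences true in the (countable) Fraïssé limit of the class `𝕂₁` of finite
models of `T₁`. -/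
def selectorTheory : selLang.Theory :=
  {φ | ∀ (M : Type) [selLang.Structure M] [Countable M],
    IsFraisseLimit finiteSelectorModels M → M ⊨ φ}

namespace ForkDiv

variable {L : FirstOrder.Language.{0, 0}}

/-! ### `SOP₁` and `SOP₃`

A set of formulas with parameters in a model is consistent iff each finite subset of it is satisfied
in that model. -/

/-- `φ(x; y)` has `SOP₁` in `M`, as witnessed by a tree of tuples indexed by `2^{<ω}`, that is, by
finite lists of booleans (`false` is `0` and `true` is `1`). -/
def HasSOP₁ (M : Type u) [L.Structure M] {m n : ℕ} (φ : L.Formula (Fin m ⊕ Fin n)) : Prop :=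
  ∃ a : List Bool → Fin n → M,
    (∀ (η : ℕ → Bool) (I : Finset ℕ), ∃ x : Fin m → M,
      ∀ α ∈ I, φ.Realize (Sum.elim x (a ((List.range α).map η)))) ∧
    (∀ η ν : List Bool, (η ++ [false]) <+: ν →
      ¬ ∃ x : Fin m → M,
        φ.Realize (Sum.elim x (a ν)) ∧ φ.Realize (Sum.elim x (a (η ++ [true]))))

/-- `T` is `NSOP₁`: no formula has `SOP₁` in a model of `T`. -/
def NSOP₁ (T : L.Theory) : Prop :=
  ∀ (M : Type u) [L.Structure M] [Nonempty M] [M ⊨ T] (m n : ℕ) (φ : L.Formula (Fin m ⊕ Fin n)),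
    ¬ HasSOP₁ M φ

/-- `φ(x; y)`, with `x` and `y` of the same length, has `SOP₃` in `M`: it defines a directed graph
with an infinite chain and without directed cycles of length three. -/
def HasSOP₃ (M : Type u) [L.Structure M] {n : ℕ} (φ : L.Formula (Fin n ⊕ Fin n)) : Prop :=
  (∃ a : ℕ → Fin n → M, ∀ i j, i < j → φ.Realize (Sum.elim (a i) (a j))) ∧
  ¬ ∃ x y z : Fin n → M, φ.Realize (Sum.elim x y) ∧ φ.Realize (Sum.elim y z) ∧
    φ.Realize (Sum.elim z x)

/-- `T` is `NSOP₃`: no formula has `SOP₃` in a model of `T`. -/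
def NSOP₃ (T : L.Theory) : Prop :=
  ∀ (M : Type u) [L.Structure M] [Nonempty M] [M ⊨ T] (n : ℕ) (φ : L.Formula (Fin n ⊕ Fin n)),
    ¬ HasSOP₃ M φ

/-! ### Dividing and forking of formulas

Instead of fixing a monster model, parameters are taken in an arbitrary model `M`, and the sequences
and formulas that witness dividing and forking are looked for in elementary extensions of `M`. -/

/-- The sequence of `k`-tuples `s` is indiscernible over `A`. -/
def IsIndiscernible {M : Type u} [L.Structure M] (A : Set M) {k : ℕ} (s : ℕ → Fin k → M) : Prop :=
  ∀ (r : ℕ) (ψ : L[[A]].Formula (Fin r × Fin k)) (i j : Fin r → ℕ), StrictMono i → StrictMono j →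
    (ψ.Realize (fun p => s (i p.1) p.2) ↔ ψ.Realize (fun p => s (j p.1) p.2))

/-- `φ(x; b)` divides over `A`: in some elementary extension `N` there is an `A`-indiscernible
sequence `(sᵢ)` with `s₀ = b` such that `{φ(x; sᵢ) : i < ω}` is inconsistent. -/
def Divides {M : Type u} [L.Structure M] (A : Set M) {n k : ℕ} (φ : L.Formula (Fin n ⊕ Fin k))
    (b : Fin k → M) : Prop :=
  ∃ (N : Type u) (_ : L.Structure N) (e : M ↪ₑ[L] N) (s : ℕ → Fin k → N),
    s 0 = e ∘ b ∧ IsIndiscernible (L := L) (e '' A) s ∧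
    ∃ I : Finset ℕ, ¬ ∃ x : Fin n → N, ∀ i ∈ I, φ.Realize (Sum.elim x (s i))

/-- `φ(x; b)` forks over `A`: in some elementary extension `N` it implies a finite disjunction of
formulas `ψᵢ(x; cᵢ)`, each of which divides over `A`. -/
def Forks {M : Type u} [L.Structure M] (A : Set M) {n k : ℕ} (φ : L.Formula (Fin n ⊕ Fin k))
    (b : Fin k → M) : Prop :=
  ∃ (N : Type u) (_ : L.Structure N) (e : M ↪ₑ[L] N) (r : ℕ) (l : Fin r → ℕ)
    (ψ : ∀ i, L.Formula (Fin n ⊕ Fin (l i))) (c : ∀ i, Fin (l i) → N),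
    (∀ i, Divides (e '' A) (ψ i) (c i)) ∧
    ∀ x : Fin n → N, φ.Realize (Sum.elim x (e ∘ b)) → ∃ i, (ψ i).Realize (Sum.elim x (c i))

/-! ### Types over sets, global types -/

/-- `S_n(A)`: complete `n`-types over the set `A` of parameters in `M`. -/
abbrev TypeOver (L : FirstOrder.Language.{0, 0}) (M : Type u) [L.Structure M] (A : Set M) (n : ℕ) :=
  (L[[A]].completeTheory M).CompleteType (Fin n)

/-- `S_n(M)`: complete `n`-types over the whole model `M`. -/
abbrev GlobalType (L : FirstOrder.Language.{0, 0}) (M : Type u) [L.Structure M] (n : ℕ) :=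
  (L.elementaryDiagram M).CompleteType (Fin n)

variable {M : Type u} [L.Structure M] {n : ℕ}

/-- The global type `q` extends the type `p` over `A`. -/
def Extends {A : Set M} (q : GlobalType L M n) (p : TypeOver L M A n) : Prop :=
  ∀ φ : L[[A]].Formula (Fin n), Formula.equivSentence φ ∈ p →
    Formula.equivSentence ((L.lhomWithConstantsMap ((↑) : A → M)).onFormula φ) ∈ q

/-- The formula `φ(x; b)`, as a formula with parameters in `M`. -/
def instantiate {k : ℕ} (φ : L.Formula (Fin n ⊕ Fin k)) (b : Fin k → M) :
    L[[M]].Formula (Fin n) :=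
  ((L.lhomWithConstants M).onFormula φ).subst
    (Sum.elim (fun i => Term.var i) (fun j => (L.con (b j)).term))

/-- The formula `φ(x; b)` belongs to the global type `q`. -/
def GlobalType.Contains (q : GlobalType L M n) {k : ℕ} (φ : L.Formula (Fin n ⊕ Fin k))
    (b : Fin k → M) : Prop :=
  Formula.equivSentence (instantiate φ b) ∈ q

/-- `b ≡_A b'`. -/
def SameType (L : FirstOrder.Language.{0, 0}) {M : Type u} [L.Structure M] (A : Set M) {k : ℕ}
    (b b' : Fin k → M) : Prop :=
  ∀ ψ : L[[A]].Formula (Fin k), ψ.Realize b ↔ ψ.Realize b'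

/-- `q` is `A`-invariant: if `b ≡_A b'`, then `φ(x; b) ∈ q` iff `φ(x; b') ∈ q`. -/
def GlobalType.Invariant (q : GlobalType L M n) (A : Set M) : Prop :=
  ∀ (k : ℕ) (φ : L.Formula (Fin n ⊕ Fin k)) (b b' : Fin k → M),
    SameType L A b b' → (q.Contains φ b ↔ q.Contains φ b')

/-- `q` forks over `A`: it contains a formula that forks over `A` (for a complete type this is the
same as implying such a formula, by compactness). -/
def GlobalType.ForksOver (q : GlobalType L M n) (A : Set M) : Prop :=
  ∃ (k : ℕ) (φ : L.Formula (Fin n ⊕ Fin k)) (b : Fin k → M), q.Contains φ b ∧ Forks A φ b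

end ForkDiv

/-!
Two models `N` and `P` of `T₁` can be amalgamated over a partial isomorphism so that a function of
`P` acts on the classes which meet only `N` as any prescribed selector, and conversely. With finite
models this yields the Fraïssé limit, hence completeness and quantifier elimination, and each of the
remaining claims follows from a suitable choice of the selectors.

* `NSOP₁`: along a branch of a tree of tuples, the structures generated by the tuples before a node
  form a chain, and a finite tuple `d` generates only finitely many elements. So two nodes can be
  found for which `d` and the second node meet the earlier structures only in a common base, also
  modulo `E`, and then a realization of the type of `d` can be moved over the base to one that
  satisfies the formula at the sibling of the first node and at the second node.
* `NSOP₁` implies `NSOP₃`: a chain indexed by `ℚ` gives a tree of nested intervals, and for elements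
  between the endpoints of two separated intervals there would be a cycle of length three.
* The formula `(x ∈ F ∧ eval(x, z) = z) ∨ E(x, z)` forks, since its disjuncts divide along a row
  and along a column of a grid whose rows are `E`-classes. It does not divide, since an
  indiscernible sequence is either contained in one class, or meets each class at most once and is
  then fixed by a single selector.
* A type over `A` extends to the type of its realization in an amalgam over `A` in which its
  functions take new values and all other functions act on it as one fixed selector. No parameters
  outside of `A` enter this recipe, so it gives an invariant type over every elementary extension,
  and such a type does not fork.
-/

universe v

namespace IsSelectorModel

variable {M : Type*} [selLang.Structure M] {x y z : M}

theorem isObj_iff_eqRel_self (h : IsSelectorModel M) : IsObj x ↔ EqRel x x :=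
  ⟨h.refl x, fun hx => (h.rel_obj x x hx).1⟩

theorem eqRel_comm (h : IsSelectorModel M) : EqRel x y ↔ EqRel y x :=
  ⟨h.symm x y, h.symm y x⟩

theorem eqRel_congr_left (h : IsSelectorModel M) (hxy : EqRel x y) : EqRel x z ↔ EqRel y z :=
  ⟨h.trans y x z (h.symm x y hxy), h.trans x y z hxy⟩

theorem eqRel_congr_right (h : IsSelectorModel M) (hxy : EqRel x y) : EqRel z x ↔ EqRel z y :=
  ⟨fun hz => h.trans z x y hz hxy, fun hz => h.trans z y x hz (h.symm x y hxy)⟩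

theorem evalAt_of_isObj (h : IsSelectorModel M) (hx : IsObj x) : evalAt x y = y :=
  h.eval_off x y fun hxy => (h.sorts x).1 hxy.1 hx

theorem evalAt_of_not_isObj (h : IsSelectorModel M) (hy : ¬ IsObj y) : evalAt x y = y :=
  h.eval_off x y fun hxy => hy hxy.2

theorem evalAt_congr (h : IsSelectorModel M) (hx : ¬ IsObj x) (hyz : EqRel y z) :
    evalAt x y = evalAt x z :=
  h.eval_congr x y z ((h.sorts x).2 hx) hyz

theorem eqRel_evalAt_self (h : IsSelectorModel M) (hy : IsObj y) : EqRel (evalAt x y) y := by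
  by_cases hx : IsObj x
  · rw [h.evalAt_of_isObj hx]
    exact h.refl y hy
  · exact h.eval_rel x y ((h.sorts x).2 hx) hy

theorem isObj_evalAt (h : IsSelectorModel M) : IsObj (evalAt x y) ↔ IsObj y := by
  by_cases hy : IsObj y
  · exact iff_of_true (h.rel_obj _ _ (h.eqRel_evalAt_self hy)).1 hy
  · rw [h.evalAt_of_not_isObj hy]

theorem eqRel_evalAt_left (h : IsSelectorModel M) : EqRel (evalAt x y) z ↔ EqRel y z := by
  by_cases hy : IsObj y
  · exact h.eqRel_congr_left (h.eqRel_evalAt_self hy)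
  · rw [h.evalAt_of_not_isObj hy]

theorem eqRel_evalAt_right (h : IsSelectorModel M) : EqRel z (evalAt x y) ↔ EqRel z y := by
  rw [h.eqRel_comm, h.eqRel_evalAt_left, h.eqRel_comm]

theorem evalAt_evalAt (h : IsSelectorModel M) (hx : ¬ IsObj x) :
    evalAt x (evalAt y z) = evalAt x z := by
  by_cases hz : IsObj z
  · exact h.evalAt_congr hx (h.eqRel_evalAt_self hz)
  · rw [h.evalAt_of_not_isObj (y := z) hz]

end IsSelectorModel

namespace Selector

section Constructions

variable {M : Type*} [selLang.Structure M]

/-- The structure whose objects are the elements of the field of `rel`, whose functions are all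
other elements, and whose evaluation is `ev`. -/
abbrev structureOf {X : Type*} (rel : X → X → Prop) (ev : X → X → X) : selLang.Structure X where
  funMap := fun {_} f => match f with
    | SelFunc.eval => fun v => ev (v 0) (v 1)
  RelMap := fun {_} r => match r with
    | SelRel.obj => fun v => rel (v 0) (v 0)
    | SelRel.fn => fun v => ¬ rel (v 0) (v 0)
    | SelRel.equiv => fun v => rel (v 0) (v 1)

theorem isSelectorModel_structureOf {X : Type*} {rel : X → X → Prop} {ev : X → X → X}
    (symm : ∀ x y, rel x y → rel y x) (trans : ∀ x y z, rel x y → rel y z → rel x z)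
    (ev_rel : ∀ f b, ¬ rel f f → rel b b → rel (ev f b) b)
    (ev_congr : ∀ f b b', ¬ rel f f → rel b b' → ev f b = ev f b')
    (ev_off : ∀ x y, ¬ (¬ rel x x ∧ rel y y) → ev x y = y) :
    @IsSelectorModel X (structureOf rel ev) :=
  let _ := structureOf rel ev
  { sorts := fun _ => Iff.rfl
    rel_obj := fun x y hxy => ⟨trans x y x hxy (symm x y hxy), trans y x y (symm x y hxy) hxy⟩
    refl := fun _ hx => hx
    symm := symm
    trans := trans
    eval_rel := ev_rel
    eval_congr := ev_congr
    eval_off := ev_off }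

open Classical in
theorem exists_structure_extending {X : Type*} {rel : X → X → Prop} {S : X → X → X → Prop}
    (symm : ∀ x y, rel x y → rel y x) (trans : ∀ x y z, rel x y → rel y z → rel x z)
    (spec_rel : ∀ f b c, ¬ rel f f → S f b c → rel c b)
    (spec_unique : ∀ f b c b' c', ¬ rel f f → S f b c → S f b' c' → rel b b' → c = c') :
    ∃ _ : selLang.Structure X, IsSelectorModel X ∧ (∀ x y : X, EqRel x y ↔ rel x y) ∧
      ∀ f b c : X, ¬ rel f f → S f b c → evalAt f b = c := by
  let cand (f b c : X) : Prop := rel c b ∧ ∀ b' c', rel b b' → S f b' c' → c = c'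
  have exists_cand (f b : X) (hf : ¬ rel f f) (hb : rel b b) : ∃ c, cand f b c := by
    by_cases hS : ∃ b' c', rel b b' ∧ S f b' c'
    · obtain ⟨b', c', hbb', hc'⟩ := hS
      refine ⟨c', trans _ _ _ (spec_rel _ _ _ hf hc') (symm _ _ hbb'), fun b'' c'' hb'' hc'' => ?_⟩
      exact spec_unique _ _ _ _ _ hf hc' hc'' (trans _ _ _ (symm _ _ hbb') hb'')
    · exact ⟨b, hb, fun b' c' hb' hc' => (hS ⟨b', c', hb', hc'⟩).elim⟩
  have cand_congr (f b b' : X) (hb : rel b b') : cand f b = cand f b' := by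
    funext c
    refine propext (and_congr ⟨fun h => trans _ _ _ h hb, fun h => trans _ _ _ h (symm _ _ hb)⟩
      (forall₂_congr fun b'' c'' => imp_congr_left ?_))
    exact ⟨trans _ _ _ (symm _ _ hb), trans _ _ _ hb⟩
  let ev (f b : X) : X :=
    if ¬ rel f f ∧ rel b b then @Classical.epsilon X ⟨b⟩ (cand f b) else b
  have cand_ev (f b : X) (hf : ¬ rel f f) (hb : rel b b) : cand f b (ev f b) := by
    simp only [ev, if_pos (And.intro hf hb)]
    exact Classical.epsilon_spec (exists_cand f b hf hb)
  refine ⟨structureOf rel ev, isSelectorModel_structureOf symm trans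
    (fun f b hf hb => (cand_ev f b hf hb).1) (fun f b b' hf hb => ?_) (fun x y hxy => if_neg hxy),
    fun _ _ => Iff.rfl, fun f b c hf hc => ?_⟩
  · have hbb : rel b b := trans _ _ _ hb (symm _ _ hb)
    have hbb' : rel b' b' := trans _ _ _ (symm _ _ hb) hb
    simp only [ev, if_pos (And.intro hf hbb), if_pos (And.intro hf hbb'), cand_congr f b b' hb]
  · have hb : rel b b := trans _ _ _ (symm _ _ (spec_rel f b c hf hc)) (spec_rel f b c hf hc)
    exact (cand_ev f b hf hb).2 b c hb hc

/-- `σ` is a selector function for `E`, with unspecified values outside the sort of objects. -/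
structure IsSelector (σ : M → M) : Prop where
  eqRel : ∀ x, IsObj x → EqRel (σ x) x
  congr : ∀ x y, EqRel x y → σ x = σ y

theorem isSelector_evalAt (hM : IsSelectorModel M) {f : M} (hf : ¬ IsObj f) :
    IsSelector (evalAt f) :=
  ⟨fun _ hx => hM.eqRel_evalAt_self hx, fun _ _ hxy => hM.evalAt_congr hf hxy⟩

theorem exists_isSelector_fixing (hM : IsSelectorModel M) {D : Set M}
    (hD : ∀ x ∈ D, ∀ y ∈ D, EqRel x y → x = y) :
    ∃ σ : M → M, IsSelector σ ∧ ∀ x ∈ D, IsObj x → σ x = x := by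
  let IsValue (x y : M) : Prop := EqRel y x ∧ ((∃ d ∈ D, EqRel d x) → y ∈ D)
  have exists_isValue {x : M} (hx : IsObj x) : ∃ y, IsValue x y := by
    by_cases h : ∃ d ∈ D, EqRel d x
    · exact h.imp fun d hd => ⟨hd.2, fun _ => hd.1⟩
    · exact ⟨x, hM.refl x hx, fun h' => (h h').elim⟩
  let σ (x : M) : M := @Classical.epsilon M ⟨x⟩ (IsValue x)
  have isValue {x : M} (hx : IsObj x) : IsValue x (σ x) :=
    Classical.epsilon_spec (exists_isValue hx)
  refine ⟨σ, ⟨fun x hx => (isValue hx).1, fun x y hxy => ?_⟩, fun x hxD hx => ?_⟩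
  · simp only [σ, IsValue, hM.eqRel_congr_right hxy]
  · exact hD _ ((isValue hx).2 ⟨x, hxD, hM.refl x hx⟩) x hxD (isValue hx).1

theorem exists_isSelector (hM : IsSelectorModel M) : ∃ σ : M → M, IsSelector σ :=
  (exists_isSelector_fixing hM (D := ∅) fun _ hx => hx.elim).imp fun _ h => h.1

end Constructions

section Embeddings

variable {M : Type*} [selLang.Structure M] {N : Type*} [selLang.Structure N]

theorem comp_vec₁ {α β : Type*} (f : α → β) (x : α) : f ∘ ![x] = ![f x] := by
  ext i
  fin_cases i
  rfl

theorem comp_vec₂ {α β : Type*} (f : α → β) (x y : α) : f ∘ ![x, y] = ![f x, f y] := by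
  ext i
  fin_cases i <;> rfl

variable {F : Type*} [FunLike F M N]

theorem evalAt_map [selLang.HomClass F M N] (e : F) (x y : M) :
    evalAt (e x) (e y) = e (evalAt x y) := by
  rw [evalAt, ← comp_vec₂]
  exact (HomClass.map_fun e (SelFunc.eval : selLang.Functions 2) ![x, y]).symm

variable [selLang.StrongHomClass F M N]

theorem isObj_map (e : F) {x : M} : IsObj (e x) ↔ IsObj x := by
  rw [IsObj, ← comp_vec₁]
  exact StrongHomClass.map_rel e (SelRel.obj : selLang.Relations 1) ![x]

theorem isFn_map (e : F) {x : M} : IsFn (e x) ↔ IsFn x := by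
  rw [IsFn, ← comp_vec₁]
  exact StrongHomClass.map_rel e (SelRel.fn : selLang.Relations 1) ![x]

theorem eqRel_map (e : F) {x y : M} : EqRel (e x) (e y) ↔ EqRel x y := by
  rw [EqRel, ← comp_vec₂]
  exact StrongHomClass.map_rel e (SelRel.equiv : selLang.Relations 2) ![x, y]

/-- The axioms of `T₁`, at the three elements `x`, `y`, `z`. -/
def AxiomsAt (x y z : M) : Prop :=
  (IsFn x ↔ ¬ IsObj x) ∧ (EqRel x y → IsObj x ∧ IsObj y) ∧ (IsObj x → EqRel x x) ∧
    (EqRel x y → EqRel y x) ∧ (EqRel x y → EqRel y z → EqRel x z) ∧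
    (IsFn x → IsObj y → EqRel (evalAt x y) y) ∧ (IsFn x → EqRel y z → evalAt x y = evalAt x z) ∧
    (¬ (IsFn x ∧ IsObj y) → evalAt x y = y)

theorem isSelectorModel_iff : IsSelectorModel M ↔ ∀ x y z : M, AxiomsAt x y z where
  mp h x y z := ⟨h.sorts x, h.rel_obj x y, h.refl x, h.symm x y, h.trans x y z, h.eval_rel x y,
    h.eval_congr x y z, h.eval_off x y⟩
  mpr h := by
    choose sorts rel_obj refl symm trans eval_rel eval_congr eval_off using h
    exact ⟨fun x => sorts x x x, fun x y => rel_obj x y y, fun x => refl x x x,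
      fun x y => symm x y y, trans, fun x y => eval_rel x y y, eval_congr,
      fun x y => eval_off x y y⟩

theorem axiomsAt_map (e : M ↪[selLang] N) {x y z : M} :
    AxiomsAt (e x) (e y) (e z) ↔ AxiomsAt x y z := by
  simp only [AxiomsAt, isFn_map, isObj_map, eqRel_map, evalAt_map, e.injective.eq_iff]

theorem _root_.IsSelectorModel.of_embedding (hN : IsSelectorModel N) (e : M ↪[selLang] N) :
    IsSelectorModel M :=
  isSelectorModel_iff.2 fun _ _ _ => (axiomsAt_map e).1 (isSelectorModel_iff.1 hN _ _ _)

/-- The embedding of models of `T₁` given by an injective map that preserves `E` in both directions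
and the values of functions at objects. -/
def embeddingOf (hM : IsSelectorModel M) (hN : IsSelectorModel N) (e : M → N)
    (inj : Function.Injective e) (eqRel : ∀ x y, EqRel (e x) (e y) ↔ EqRel x y)
    (eval : ∀ f b, ¬ IsObj f → IsObj b → evalAt (e f) (e b) = e (evalAt f b)) :
    M ↪[selLang] N :=
  have isObj_iff (x : M) : IsObj (e x) ↔ IsObj x := by
    rw [hN.isObj_iff_eqRel_self, eqRel, hM.isObj_iff_eqRel_self]
  { toFun := e
    inj' := inj
    map_fun' := by
      rintro _ ⟨⟩ v
      obtain ⟨x, y, rfl⟩ : ∃ x y, v = ![x, y] := ⟨v 0, v 1, List.ofFn_inj.1 rfl⟩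
      rw [comp_vec₂]
      change e (evalAt x y) = evalAt (e x) (e y)
      by_cases hx : IsObj x
      · rw [hM.evalAt_of_isObj hx, hN.evalAt_of_isObj ((isObj_iff x).2 hx)]
      by_cases hy : IsObj y
      · exact (eval x y hx hy).symm
      · rw [hM.evalAt_of_not_isObj hy, hN.evalAt_of_not_isObj ((isObj_iff y).not.2 hy)]
    map_rel' := by
      rintro _ (_ | _ | _) v
      · obtain ⟨x, rfl⟩ : ∃ x, v = ![x] := ⟨v 0, List.ofFn_inj.1 rfl⟩
        rw [comp_vec₁]
        exact isObj_iff _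
      · obtain ⟨x, rfl⟩ : ∃ x, v = ![x] := ⟨v 0, List.ofFn_inj.1 rfl⟩
        rw [comp_vec₁]
        exact (hN.sorts _).trans ((isObj_iff _).not.trans (hM.sorts _).symm)
      · obtain ⟨x, y, rfl⟩ : ∃ x y, v = ![x, y] := ⟨v 0, v 1, List.ofFn_inj.1 rfl⟩
        rw [comp_vec₂]
        exact eqRel _ _ }

end Embeddings

/-- A partial isomorphism between two models of `T₁`, as a relation whose domain and range need not
be all of the models. -/
structure IsPartIso {M N : Type*} [selLang.Structure M] [selLang.Structure N]
    (R : M → N → Prop) : Prop where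
  eq_iff : ∀ {x x' y y'}, R x x' → R y y' → (x = y ↔ x' = y')
  eqRel_iff : ∀ {x x' y y'}, R x x' → R y y' → (EqRel x y ↔ EqRel x' y')
  eval : ∀ {x x' y y'}, R x x' → R y y' → R (evalAt x y) (evalAt x' y')

section PartIso

variable {M : Type*} [selLang.Structure M] {N : Type*} [selLang.Structure N]
  {P : Type*} [selLang.Structure P] {R : M → N → Prop}

theorem IsPartIso.isObj_iff (hM : IsSelectorModel M) (hN : IsSelectorModel N) (hR : IsPartIso R)
    {x : M} {x' : N} (hx : R x x') : IsObj x ↔ IsObj x' := by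
  rw [hM.isObj_iff_eqRel_self, hN.isObj_iff_eqRel_self, hR.eqRel_iff hx hx]

theorem IsPartIso.swap (hR : IsPartIso R) : IsPartIso (fun x y => R y x) :=
  ⟨fun hx hy => (hR.eq_iff hx hy).symm, fun hx hy => (hR.eqRel_iff hx hy).symm, hR.eval⟩

theorem IsPartIso.comp {S : N → P → Prop} (hR : IsPartIso R) (hS : IsPartIso S) :
    IsPartIso (fun x z => ∃ y, R x y ∧ S y z) where
  eq_iff := fun ⟨_, hx, hx'⟩ ⟨_, hy, hy'⟩ => (hR.eq_iff hx hy).trans (hS.eq_iff hx' hy')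
  eqRel_iff := fun ⟨_, hx, hx'⟩ ⟨_, hy, hy'⟩ => (hR.eqRel_iff hx hy).trans (hS.eqRel_iff hx' hy')
  eval := fun ⟨_, hx, hx'⟩ ⟨_, hy, hy'⟩ => ⟨_, hR.eval hx hy, hS.eval hx' hy'⟩

theorem isPartIso_of_embedding (e : M ↪[selLang] N) : IsPartIso fun x y => e x = y where
  eq_iff := by
    rintro x _ y _ rfl rfl
    exact e.injective.eq_iff.symm
  eqRel_iff := by
    rintro x _ y _ rfl rfl
    exact (eqRel_map e).symm
  eval := by
    rintro x _ y _ rfl rfl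
    exact (evalAt_map e x y).symm

theorem isPartIso_false : IsPartIso (fun (_ : M) (_ : N) => False) :=
  ⟨False.elim, False.elim, False.elim⟩

theorem IsPartIso.union (hM : IsSelectorModel M) (hN : IsSelectorModel N) {S : M → N → Prop}
    (hR : IsPartIso R) (hS : IsPartIso S)
    (eq_iff : ∀ {x x' y y'}, R x x' → S y y' → (x = y ↔ x' = y'))
    (eqRel_iff : ∀ {x x' y y'}, R x x' → S y y' → (EqRel x y ↔ EqRel x' y'))
    (eval_left : ∀ {x x' y y'}, R x x' → S y y' →
      R (evalAt x y) (evalAt x' y') ∨ S (evalAt x y) (evalAt x' y'))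
    (eval_right : ∀ {x x' y y'}, R x x' → S y y' →
      R (evalAt y x) (evalAt y' x') ∨ S (evalAt y x) (evalAt y' x')) :
    IsPartIso fun x x' => R x x' ∨ S x x' where
  eq_iff := by
    rintro x x' y y' (hx | hx) (hy | hy)
    · exact hR.eq_iff hx hy
    · exact eq_iff hx hy
    · rw [eq_comm, eq_iff hy hx, eq_comm]
    · exact hS.eq_iff hx hy
  eqRel_iff := by
    rintro x x' y y' (hx | hx) (hy | hy)
    · exact hR.eqRel_iff hx hy
    · exact eqRel_iff hx hy
    · rw [hM.eqRel_comm, eqRel_iff hy hx, hN.eqRel_comm]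
    · exact hS.eqRel_iff hx hy
  eval := by
    rintro x x' y y' (hx | hx) (hy | hy)
    · exact .inl (hR.eval hx hy)
    · exact eval_left hx hy
    · exact eval_right hy hx
    · exact .inr (hS.eval hx hy)

end PartIso

section NormalTerms

/-- The terms `x` and `eval(x, y)` in the variables `J`. In a model of `T₁` every term has the same
value as one of these. -/
abbrev NormalTerm (J : Type*) := J ⊕ J × J

variable {M : Type*} [selLang.Structure M] {N : Type*} [selLang.Structure N] {J : Type*}

/-- The value of a normal term. -/
def NormalTerm.val (v : J → M) : NormalTerm J → M :=
  Sum.elim v fun p => evalAt (v p.1) (v p.2)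

/-- The variable of a normal term to which its value is `E`-equivalent if it is an object, and equal
if it is a function. -/
def NormalTerm.base : NormalTerm J → J := Sum.elim id Prod.snd

theorem isObj_val (hM : IsSelectorModel M) (v : J → M) (t : NormalTerm J) :
    IsObj (t.val v) ↔ IsObj (v t.base) := by
  rcases t with i | ⟨i, j⟩
  · rfl
  · exact hM.isObj_evalAt

theorem eqRel_val (hM : IsSelectorModel M) (v : J → M) (s t : NormalTerm J) :
    EqRel (s.val v) (t.val v) ↔ EqRel (v s.base) (v t.base) := by
  rcases s with i | ⟨i, j⟩ <;> rcases t with k | ⟨k, l⟩ <;>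
    simp [NormalTerm.base, NormalTerm.val, hM.eqRel_evalAt_left, hM.eqRel_evalAt_right]

theorem val_of_not_isObj (hM : IsSelectorModel M) (v : J → M) (t : NormalTerm J)
    (ht : ¬ IsObj (v t.base)) : t.val v = v t.base := by
  rcases t with i | ⟨i, j⟩
  · rfl
  · exact hM.evalAt_of_not_isObj ht

open Classical in
/-- The normal form of `eval(s, t)`, when `o` is the set of variables whose values are objects. -/
noncomputable def NormalTerm.eval (o : Set J) (s t : NormalTerm J) : NormalTerm J :=
  if s.base ∈ o then t else .inr (s.base, t.base)

theorem val_eval (hM : IsSelectorModel M) (v : J → M) (s t : NormalTerm J) :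
    (NormalTerm.eval {i | IsObj (v i)} s t).val v = evalAt (s.val v) (t.val v) := by
  by_cases hs : IsObj (v s.base)
  · rw [NormalTerm.eval, if_pos (show s.base ∈ {i | IsObj (v i)} from hs),
      hM.evalAt_of_isObj ((isObj_val hM v s).2 hs)]
  · rw [NormalTerm.eval, if_neg (show s.base ∉ {i | IsObj (v i)} from hs),
      val_of_not_isObj hM v s hs]
    rcases t with i | ⟨i, j⟩
    · rfl
    · exact (hM.evalAt_evalAt hs).symm

/-- The substructure generated by the family `v`, in a model of `T₁`. -/
def generated (v : J → M) : Set M := Set.range fun t : NormalTerm J => t.val v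

theorem mem_generated (v : J → M) (i : J) : v i ∈ generated v := ⟨.inl i, rfl⟩

theorem evalAt_mem_generated (hM : IsSelectorModel M) {v : J → M} {x y : M}
    (hx : x ∈ generated v) (hy : y ∈ generated v) : evalAt x y ∈ generated v := by
  obtain ⟨s, rfl⟩ := hx
  obtain ⟨t, rfl⟩ := hy
  exact ⟨_, val_eval hM v s t⟩

theorem generated_subset {v : J → M} {S : Set M} (hS : ∀ x ∈ S, ∀ y ∈ S, evalAt x y ∈ S)
    (hv : ∀ i, v i ∈ S) : generated v ⊆ S := by
  rintro _ ⟨i | ⟨i, j⟩, rfl⟩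
  · exact hv i
  · exact hS _ (hv i) _ (hv j)

theorem IsPartIso.val {R : M → N → Prop} (hR : IsPartIso R) {v : J → M} {w : J → N}
    (hvw : ∀ i, R (v i) (w i)) : ∀ t : NormalTerm J, R (t.val v) (t.val w)
  | .inl i => hvw i
  | .inr (i, j) => hR.eval (hvw i) (hvw j)

end NormalTerms

section QuantifierFree

variable {M : Type*} [selLang.Structure M] {N : Type*} [selLang.Structure N]
  {P : Type*} [selLang.Structure P] {J : Type*}

/-- The atomic formulas `E(x, y)` and `s = t` in the variables `J`. The formula `x ∈ O` is
equivalent to `E(x, x)`. -/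
abbrev Atom (J : Type*) := J × J ⊕ NormalTerm J × NormalTerm J

/-- The set of atomic formulas satisfied by a family. -/
def atoms (v : J → M) : Set (Atom J) :=
  {a | Sum.elim (fun p => EqRel (v p.1) (v p.2)) (fun p => p.1.val v = p.2.val v) a}

/-- Two families of elements satisfy the same quantifier-free formulas. -/
def SameQF (v : J → M) (w : J → N) : Prop :=
  ∃ R : M → N → Prop, IsPartIso R ∧ ∀ i, R (v i) (w i)

theorem SameQF.symm {v : J → M} {w : J → N} (h : SameQF v w) : SameQF w v :=
  let ⟨_, hR, hvw⟩ := h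
  ⟨_, hR.swap, hvw⟩

theorem SameQF.trans {v : J → M} {w : J → N} {u : J → P} (h : SameQF v w) (h' : SameQF w u) :
    SameQF v u :=
  let ⟨_, hR, hvw⟩ := h
  let ⟨_, hR', hwu⟩ := h'
  ⟨_, hR.comp hR', fun i => ⟨_, hvw i, hwu i⟩⟩

theorem SameQF.comp {K : Type*} {v : J → M} {w : J → N} (h : SameQF v w) (f : K → J) :
    SameQF (v ∘ f) (w ∘ f) :=
  let ⟨R, hR, hvw⟩ := h
  ⟨R, hR, fun i => hvw (f i)⟩

theorem sameQF_map (e : M ↪[selLang] N) (v : J → M) : SameQF v (e ∘ v) :=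
  ⟨_, isPartIso_of_embedding e, fun _ => rfl⟩

theorem SameQF.atoms_eq {v : J → M} {w : J → N} (h : SameQF v w) : atoms v = atoms w := by
  obtain ⟨R, hR, hvw⟩ := h
  ext (⟨i, j⟩ | ⟨s, t⟩)
  · exact hR.eqRel_iff (hvw i) (hvw j)
  · exact hR.eq_iff (hR.val hvw s) (hR.val hvw t)

/-- The relation which matches the values of each normal term at two families. -/
def generatedRel (v : J → M) (w : J → N) (x : M) (y : N) : Prop :=
  ∃ t : NormalTerm J, t.val v = x ∧ t.val w = y

theorem generatedRel_apply (v : J → M) (w : J → N) (i : J) : generatedRel v w (v i) (w i) :=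
  ⟨.inl i, rfl, rfl⟩

theorem isPartIso_generatedRel (hM : IsSelectorModel M) (hN : IsSelectorModel N) {v : J → M}
    {w : J → N} (h : atoms v = atoms w) : IsPartIso (generatedRel v w) := by
  have eqRel_iff (i j : J) : EqRel (v i) (v j) ↔ EqRel (w i) (w j) :=
    Set.ext_iff.1 h (.inl (i, j))
  have objects : {i | IsObj (v i)} = {i | IsObj (w i)} := by
    ext i
    exact hM.isObj_iff_eqRel_self.trans ((eqRel_iff i i).trans hN.isObj_iff_eqRel_self.symm)
  constructor
  · rintro _ _ _ _ ⟨s, rfl, rfl⟩ ⟨t, rfl, rfl⟩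
    exact Set.ext_iff.1 h (.inr (s, t))
  · rintro _ _ _ _ ⟨s, rfl, rfl⟩ ⟨t, rfl, rfl⟩
    rw [eqRel_val hM, eqRel_val hN, eqRel_iff]
  · rintro _ _ _ _ ⟨s, rfl, rfl⟩ ⟨t, rfl, rfl⟩
    refine ⟨NormalTerm.eval {i | IsObj (v i)} s t, val_eval hM v s t, ?_⟩
    rw [objects, val_eval hN]

theorem sameQF_iff_atoms_eq (hM : IsSelectorModel M) (hN : IsSelectorModel N) {v : J → M}
    {w : J → N} : SameQF v w ↔ atoms v = atoms w :=
  ⟨SameQF.atoms_eq, fun h => ⟨_, isPartIso_generatedRel hM hN h, generatedRel_apply v w⟩⟩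

end QuantifierFree

section Formulas

variable {M : Type*} [selLang.Structure M] {J : Type*}

/-- A normal term as a term of the language. -/
def NormalTerm.toTerm : NormalTerm J → selLang.Term J
  | .inl i => .var i
  | .inr (i, j) => Functions.apply₂ (L := selLang) SelFunc.eval (.var i) (.var j)

/-- An atom as a formula of the language. -/
def atomFormula : Atom J → selLang.Formula J
  | .inl (i, j) => Relations.formula₂ (L := selLang) SelRel.equiv (.var i) (.var j)
  | .inr (s, t) => Term.equal s.toTerm t.toTerm

theorem realize_toTerm (v : J → M) (t : NormalTerm J) : t.toTerm.realize v = t.val v := by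
  rcases t with i | ⟨i, j⟩
  · rfl
  · exact Term.realize_functions_apply₂ (L := selLang) (f := SelFunc.eval)

@[simp] theorem realize_atomFormula (v : J → M) (a : Atom J) :
    (atomFormula a).Realize v ↔ a ∈ atoms v := by
  rcases a with ⟨i, j⟩ | ⟨s, t⟩
  · exact Formula.realize_rel₂ (L := selLang) (R := SelRel.equiv)
  · rw [atomFormula, Formula.realize_equal, realize_toTerm, realize_toTerm]
    rfl

open Classical in
/-- The conjunction of all atoms in `S` and the negations of all others. -/
noncomputable def diagramFormula [Finite J] (S : Set (Atom J)) : selLang.Formula J :=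
  Formula.iInf fun a => if a ∈ S then atomFormula a else ∼(atomFormula a)

theorem realize_diagramFormula [Finite J] {S : Set (Atom J)} {v : J → M} :
    (diagramFormula S).Realize v ↔ atoms v = S := by
  rw [diagramFormula, Formula.realize_iInf, Set.ext_iff]
  refine forall_congr' fun a => ?_
  by_cases ha : a ∈ S <;> simp [ha]

end Formulas

section Amalgam

variable {N : Type u} [selLang.Structure N] {P : Type v} [selLang.Structure P]

/-- The `E`-classes of `p` and `n` become equal when the elements matched by `H` are identified. -/
def Linked (H : P → N → Prop) (p : P) (n : N) : Prop :=
  ∃ p' n', H p' n' ∧ EqRel p p' ∧ EqRel n' n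

/-- The embeddings `ι` and `τ` amalgamate `N` and `P` over the partial isomorphism `H`, in such a
way that the values of the functions of `P` at the classes of `N` are given by `α` and those of the
functions of `N` at the classes of `P` by `β`, as far as they are not determined by `N` and `P`. -/
structure IsAmalgam {W : Type*} [selLang.Structure W] (H : P → N → Prop) (α : P → N → N)
    (β : N → P → P) (ι : N ↪[selLang] W) (τ : P ↪[selLang] W) : Prop where
  eq_iff : ∀ {p n}, τ p = ι n ↔ H p n
  eqRel_iff : ∀ {p n}, EqRel (τ p) (ι n) ↔ Linked H p n
  eval_left : ∀ {f y}, ¬ IsObj f → IsObj y → (∀ n, ¬ H f n) → (∀ p, ¬ Linked H p y) →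
    evalAt (τ f) (ι y) = ι (α f y)
  eval_right : ∀ {g x}, ¬ IsObj g → IsObj x → (∀ p, ¬ H p g) → (∀ n, ¬ Linked H x n) →
    evalAt (ι g) (τ x) = τ (β g x)

namespace Linked

variable {H : P → N → Prop} {p p' : P} {n n' : N}

theorem congr_left (hP : IsSelectorModel P) (h : Linked H p n) (hp : EqRel p' p) :
    Linked H p' n :=
  let ⟨p₀, n₀, h₀, hp₀, hn₀⟩ := h
  ⟨p₀, n₀, h₀, hP.trans _ _ _ hp hp₀, hn₀⟩

theorem congr_right (hN : IsSelectorModel N) (h : Linked H p n) (hn : EqRel n n') :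
    Linked H p n' :=
  let ⟨p₀, n₀, h₀, hp₀, hn₀⟩ := h
  ⟨p₀, n₀, h₀, hp₀, hN.trans _ _ _ hn₀ hn⟩

theorem eqRel_left (hP : IsSelectorModel P) (hN : IsSelectorModel N) (hH : IsPartIso H)
    (h : Linked H p n) (h' : Linked H p' n) : EqRel p p' := by
  obtain ⟨p₀, n₀, h₀, hp₀, hn₀⟩ := h
  obtain ⟨p₁, n₁, h₁, hp₁, hn₁⟩ := h'
  have hp₀₁ : EqRel p₀ p₁ := (hH.eqRel_iff h₀ h₁).2 (hN.trans _ _ _ hn₀ (hN.symm _ _ hn₁))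
  exact hP.trans _ _ _ hp₀ (hP.trans _ _ _ hp₀₁ (hP.symm _ _ hp₁))

theorem eqRel_right (hP : IsSelectorModel P) (hN : IsSelectorModel N) (hH : IsPartIso H)
    (h : Linked H p n) (h' : Linked H p n') : EqRel n n' := by
  obtain ⟨p₀, n₀, h₀, hp₀, hn₀⟩ := h
  obtain ⟨p₁, n₁, h₁, hp₁, hn₁⟩ := h'
  have hn₀₁ : EqRel n₀ n₁ := (hH.eqRel_iff h₀ h₁).1 (hP.trans _ _ _ (hP.symm _ _ hp₀) hp₁)
  exact hN.trans _ _ _ (hN.symm _ _ hn₀) (hN.trans _ _ _ hn₀₁ hn₁)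

end Linked

theorem linked_iff_eqRel_right (hP : IsSelectorModel P) (hN : IsSelectorModel N)
    {H : P → N → Prop} (hH : IsPartIso H) {p : P} {n n' : N} (h : H p n) :
    Linked H p n' ↔ EqRel n n' := by
  constructor
  · rintro ⟨p₀, n₀, h₀, hp₀, hn₀⟩
    exact hN.trans _ _ _ ((hH.eqRel_iff h h₀).1 hp₀) hn₀
  · intro hn
    exact ⟨p, n, h, (hP.isObj_iff_eqRel_self).1 ((hH.isObj_iff hP hN h).2 (hN.rel_obj _ _ hn).1),
      hn⟩

end Amalgam

/-- The disjoint union of `N` and `P` with the elements matched by `H` identified: besides `N`, it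
contains the elements of `P` which are not matched with an element of `N`. -/
inductive Pushout {N : Type u} {P : Type v} (H : P → N → Prop) : Type max u v
  | left (n : N)
  | unmatched (p : P) (hp : ∀ n, ¬ H p n)

namespace Pushout

section Maps

variable {N : Type u} {P : Type v} {H : P → N → Prop}

open Classical in
/-- The canonical map of `P` into the pushout. -/
noncomputable def right (H : P → N → Prop) (p : P) : Pushout H :=
  if h : ∃ n, H p n then left h.choose else unmatched p (not_exists.1 h)

theorem right_of_forall_not {p : P} (hp : ∀ n, ¬ H p n) : right H p = unmatched p hp :=
  dif_neg (not_exists.2 hp)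

theorem exists_rep (w : Pushout H) : (∃ n, left n = w) ∨ ∃ p, right H p = w := by
  rcases w with n | ⟨p, hp⟩
  · exact .inl ⟨n, rfl⟩
  · exact .inr ⟨p, right_of_forall_not hp⟩

end Maps

variable {N : Type u} [selLang.Structure N] {P : Type v} [selLang.Structure P] {H : P → N → Prop}

theorem right_eq_left (hH : IsPartIso H) {p : P} {n : N} (h : H p n) : right H p = left n := by
  have hex : ∃ n, H p n := ⟨n, h⟩
  rw [right, dif_pos hex, (hH.eq_iff hex.choose_spec h).1 rfl]

theorem right_eq_left_iff (hH : IsPartIso H) {p : P} {n : N} : right H p = left n ↔ H p n := by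
  refine ⟨fun h => ?_, right_eq_left hH⟩
  by_cases hp : ∃ n, H p n
  · obtain ⟨n', hn'⟩ := hp
    rw [right_eq_left hH hn'] at h
    rwa [← left.inj h]
  · rw [right_of_forall_not (not_exists.1 hp)] at h
    cases h

theorem right_injective (hH : IsPartIso H) : Function.Injective (right H) := by
  have eq_of_matched {p p' : P} (h : right H p = right H p') (hp : ∃ n, H p n) : p = p' := by
    obtain ⟨n, hn⟩ := hp
    have hn' : H p' n := by rw [← right_eq_left_iff hH, ← h, right_eq_left hH hn]
    exact (hH.eq_iff hn hn').2 rfl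
  intro p p' h
  by_cases hp : ∃ n, H p n
  · exact eq_of_matched h hp
  by_cases hp' : ∃ n, H p' n
  · exact (eq_of_matched h.symm hp').symm
  rw [right_of_forall_not (not_exists.1 hp), right_of_forall_not (not_exists.1 hp')] at h
  exact unmatched.inj h

/-- The equivalence relation of the amalgam. -/
def rel : Pushout H → Pushout H → Prop
  | left n, left n' => EqRel n n'
  | left n, unmatched p _ => Linked H p n
  | unmatched p _, left n => Linked H p n
  | unmatched p _, unmatched p' _ => EqRel p p'

section Rel

variable (hP : IsSelectorModel P) (hN : IsSelectorModel N) (hH : IsPartIso H)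
include hP hN

theorem rel_symm : ∀ w w' : Pushout H, rel w w' → rel w' w
  | left _, left _ => hN.symm _ _
  | left _, unmatched _ _ => id
  | unmatched _ _, left _ => id
  | unmatched _ _, unmatched _ _ => hP.symm _ _

include hH

theorem rel_trans : ∀ w w' w'' : Pushout H, rel w w' → rel w' w'' → rel w w''
  | left _, left _, left _ => hN.trans _ _ _
  | left _, left _, unmatched _ _ => fun h h' => h'.congr_right hN (hN.symm _ _ h)
  | left _, unmatched _ _, left _ => fun h h' => h.eqRel_right hP hN hH h'
  | left _, unmatched _ _, unmatched _ _ => fun h h' => h.congr_left hP (hP.symm _ _ h')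
  | unmatched _ _, left _, left _ => fun h h' => h.congr_right hN h'
  | unmatched _ _, left _, unmatched _ _ => fun h h' => h.eqRel_left hP hN hH h'
  | unmatched _ _, unmatched _ _, left _ => fun h h' => h'.congr_left hP h
  | unmatched _ _, unmatched _ _, unmatched _ _ => hP.trans _ _ _

theorem rel_right_left {p : P} {n : N} : rel (right H p) (left n) ↔ Linked H p n := by
  by_cases hp : ∃ n, H p n
  · obtain ⟨n', hn'⟩ := hp
    rw [right_eq_left hH hn', linked_iff_eqRel_right hP hN hH hn']
    rfl
  · rw [right_of_forall_not (not_exists.1 hp)]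
    rfl

theorem rel_right_right {p p' : P} : rel (right H p) (right H p') ↔ EqRel p p' := by
  have of_matched {p p' : P} (hp' : ∃ n, H p' n) :
      rel (right H p) (right H p') ↔ EqRel p p' := by
    obtain ⟨n, hn⟩ := hp'
    rw [right_eq_left hH hn, rel_right_left hP hN hH]
    refine ⟨fun ⟨p₀, n₀, h₀, hp₀, hn₀⟩ => hP.trans _ _ _ hp₀ ((hH.eqRel_iff h₀ hn).2 hn₀),
      fun h => ⟨p', n, hn, h, ?_⟩⟩
    rw [← hN.isObj_iff_eqRel_self, ← hH.isObj_iff hP hN hn]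
    exact (hP.rel_obj _ _ h).2
  by_cases hp' : ∃ n, H p' n
  · exact of_matched hp'
  by_cases hp : ∃ n, H p n
  · rw [hP.eqRel_comm, ← of_matched hp]
    exact ⟨rel_symm hP hN _ _, rel_symm hP hN _ _⟩
  rw [right_of_forall_not (not_exists.1 hp), right_of_forall_not (not_exists.1 hp')]
  rfl

end Rel

section Eval

/-- The values of a function of the pushout at the classes of `N`. -/
def selLeft (α : P → N → N) : Pushout H → N → N
  | left g => evalAt g
  | unmatched f _ => α f

open Classical in
/-- The values of a function of the pushout at the classes of `P`. -/
noncomputable def selRight (β : N → P → P) : Pushout H → P → P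
  | left g => if h : ∃ f, H f g then evalAt h.choose else β g
  | unmatched f _ => evalAt f

/-- The values `eval(f, b) = c` in the amalgam. The side conditions express that at the classes
common to `N` and `P` only the functions of `N` may be evaluated in `N`, and only those of `P`
in `P`. -/
inductive EvalSpec (α : P → N → N) (β : N → P → P) : Pushout H → Pushout H → Pushout H → Prop
  | inLeft {f : Pushout H} {y : N} (hy : IsObj y)
      (h : (∃ g, left g = f) ∨ ∀ p, ¬ Linked H p y) :
      EvalSpec α β f (left y) (left (selLeft α f y))
  | inRight {f : Pushout H} {x : P} (hx : IsObj x)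
      (h : (∃ g, right H g = f) ∨ ∀ n, ¬ Linked H x n) :
      EvalSpec α β f (right H x) (right H (selRight β f x))

variable {α : P → N → N} {β : N → P → P}

theorem selRight_right (hH : IsPartIso H) (f : P) : selRight β (right H f) = evalAt f := by
  by_cases hf : ∃ n, H f n
  · obtain ⟨n, hn⟩ := hf
    have hex : ∃ f, H f n := ⟨f, hn⟩
    rw [right_eq_left hH hn, selRight, dif_pos hex, (hH.eq_iff hex.choose_spec hn).2 rfl]
  · rw [right_of_forall_not (not_exists.1 hf), selRight]

variable (hP : IsSelectorModel P) (hN : IsSelectorModel N) (hH : IsPartIso H)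
include hP hN

theorem isSelector_selLeft (hα : ∀ f, ¬ IsObj f → IsSelector (α f)) {f : Pushout H}
    (hf : ¬ rel f f) : IsSelector (selLeft α f) := by
  rcases f with g | ⟨f, _⟩
  · exact isSelector_evalAt hN (hN.isObj_iff_eqRel_self.not.2 hf)
  · exact hα f (hP.isObj_iff_eqRel_self.not.2 hf)

include hH

theorem isSelector_selRight (hβ : ∀ g, ¬ IsObj g → IsSelector (β g)) {f : Pushout H}
    (hf : ¬ rel f f) : IsSelector (selRight β f) := by
  by_cases hex : ∃ p, right H p = f
  · obtain ⟨p, rfl⟩ := hex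
    rw [selRight_right hH]
    rw [rel_right_right hP hN hH, ← hP.isObj_iff_eqRel_self] at hf
    exact isSelector_evalAt hP hf
  · rcases f with g | ⟨f, hunmatched⟩
    · have hg : ¬ ∃ p, H p g := fun ⟨p, hp⟩ => hex ⟨p, right_eq_left hH hp⟩
      rw [selRight, dif_neg hg]
      exact hβ g (hN.isObj_iff_eqRel_self.not.2 hf)
    · exact (hex ⟨f, right_of_forall_not hunmatched⟩).elim

variable (hα : ∀ f, ¬ IsObj f → IsSelector (α f)) (hβ : ∀ g, ¬ IsObj g → IsSelector (β g))
include hα hβ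

theorem evalSpec_rel {f b c : Pushout H} (hf : ¬ rel f f) (h : EvalSpec α β f b c) : rel c b := by
  rcases h with ⟨hy, _⟩ | ⟨hx, _⟩
  · exact (isSelector_selLeft hP hN hα hf).eqRel _ hy
  · exact (rel_right_right hP hN hH).2 ((isSelector_selRight hP hN hH hβ hf).eqRel _ hx)

/-- At a class common to both sides `f` is a matched function, and its values match since `H` is
closed under evaluation. -/
theorem selLeft_eq_selRight {f : Pushout H} {x : P} {y : N} (hf : ¬ rel f f) (hxy : Linked H x y)
    (hl : ∃ g, left g = f) (hr : ∃ g, right H g = f) :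
    left (selLeft α f y) = right H (selRight β f x) := by
  obtain ⟨g, rfl⟩ := hl
  obtain ⟨p, hp⟩ := hr
  have hpg : H p g := (right_eq_left_iff hH).1 hp
  obtain ⟨x₀, y₀, h₀, hx, hy⟩ := hxy
  have left_eq : selLeft α (left g : Pushout H) y = evalAt g y₀ :=
    (isSelector_selLeft hP hN hα hf).congr _ _ (hN.symm _ _ hy)
  have right_eq : selRight β (left g : Pushout H) x = evalAt p x₀ := by
    rw [(isSelector_selRight hP hN hH hβ hf).congr _ _ hx, ← hp, selRight_right hH]
  rw [left_eq, right_eq, right_eq_left hH (hH.eval hpg h₀)]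

theorem evalSpec_unique {f b c b' c' : Pushout H} (hf : ¬ rel f f) (h : EvalSpec α β f b c)
    (h' : EvalSpec α β f b' c') (hb : rel b b') : c = c' := by
  have left_right {x : P} {y : N} (hxy : Linked H x y)
      (hl : (∃ g, left g = f) ∨ ∀ p, ¬ Linked H p y)
      (hr : (∃ g, right H g = f) ∨ ∀ n, ¬ Linked H x n) :
      left (selLeft α f y) = right H (selRight β f x) :=
    selLeft_eq_selRight hP hN hH hα hβ hf hxy (hl.resolve_right fun h => h x hxy)
      (hr.resolve_right fun h => h y hxy)
  rcases h with ⟨_, hl⟩ | ⟨_, hr⟩ <;> rcases h' with ⟨_, hl'⟩ | ⟨_, hr'⟩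
  · exact congrArg left ((isSelector_selLeft hP hN hα hf).congr _ _ hb)
  · exact left_right ((rel_right_left hP hN hH).1 (rel_symm hP hN _ _ hb)) hl hr'
  · exact (left_right ((rel_right_left hP hN hH).1 hb) hl' hr).symm
  · exact congrArg (right H) ((isSelector_selRight hP hN hH hβ hf).congr _ _
      ((rel_right_right hP hN hH).1 hb))

end Eval

end Pushout

section Amalgam

variable {N : Type u} [selLang.Structure N] {P : Type v} [selLang.Structure P] {H : P → N → Prop}
  {α : P → N → N} {β : N → P → P}

theorem exists_isAmalgam (hP : IsSelectorModel P) (hN : IsSelectorModel N) (hH : IsPartIso H)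
    (hα : ∀ f, ¬ IsObj f → IsSelector (α f)) (hβ : ∀ g, ¬ IsObj g → IsSelector (β g)) :
    ∃ (W : Type max u v) (_ : selLang.Structure W) (ι : N ↪[selLang] W) (τ : P ↪[selLang] W),
      IsSelectorModel W ∧ (∀ w, (∃ n, ι n = w) ∨ ∃ p, τ p = w) ∧ IsAmalgam H α β ι τ := by
  obtain ⟨_, hW, eqRel_iff, eval_eq⟩ := exists_structure_extending
    (Pushout.rel_symm hP hN) (Pushout.rel_trans hP hN hH)
    (fun _ _ _ => Pushout.evalSpec_rel hP hN hH hα hβ)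
    (fun _ _ _ _ _ => Pushout.evalSpec_unique hP hN hH hα hβ)
  have not_rel_left {g : N} (hg : ¬ IsObj g) : ¬ Pushout.rel (.left g : Pushout H) (.left g) :=
    hN.isObj_iff_eqRel_self.not.1 hg
  have not_rel_right {f : P} (hf : ¬ IsObj f) : ¬ Pushout.rel (.right H f) (.right H f) := by
    rwa [Pushout.rel_right_right hP hN hH, ← hP.isObj_iff_eqRel_self]
  let ι : N ↪[selLang] Pushout H := embeddingOf hN hW .left (fun _ _ => Pushout.left.inj)
    (fun _ _ => eqRel_iff _ _) fun f b hf hb => eval_eq _ _ _ (not_rel_left hf)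
      (.inLeft hb (.inl ⟨f, rfl⟩))
  let τ : P ↪[selLang] Pushout H := embeddingOf hP hW (.right H) (Pushout.right_injective hH)
    (fun _ _ => (eqRel_iff _ _).trans (Pushout.rel_right_right hP hN hH)) fun f b hf hb => by
      rw [eval_eq _ _ _ (not_rel_right hf) (.inRight hb (.inl ⟨f, rfl⟩)),
        Pushout.selRight_right hH]
  refine ⟨Pushout H, _, ι, τ, hW, Pushout.exists_rep, Pushout.right_eq_left_iff hH,
    (eqRel_iff _ _).trans (Pushout.rel_right_left hP hN hH), fun {f y} hf hy hunm hunl => ?_,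
    fun {g x} hg hx hunm hunl => ?_⟩
  · refine (eval_eq _ _ _ (not_rel_right hf) (.inLeft hy (.inr hunl))).trans ?_
    rw [Pushout.right_of_forall_not hunm, Pushout.selLeft]
    rfl
  · refine (eval_eq _ _ _ (not_rel_left hg) (.inRight hx (.inr hunl))).trans ?_
    exact congrArg (Pushout.right H) (congrFun (dif_neg (not_exists.2 hunm)) x)

end Amalgam

end Selector

section FraisseLimit

open CategoryTheory (Bundled)

theorem exists_sequence_solving {C : Type*} {Hom : C → C → Type*} {Task : C → Type*}
    [∀ X, Countable (Task X)] [∀ X, Nonempty (Task X)]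
    (push : ∀ {X Y}, Hom X Y → Task X → Task Y) (Solves : ∀ {X Y}, Hom X Y → Task X → Prop)
    (exists_solution : ∀ X (t : Task X), ∃ (Y : C) (f : Hom X Y), Solves f t) (X₀ : C) :
    ∃ (G : ℕ → C) (f : ∀ n, Hom (G n) (G (n + 1))), ∀ n (t : Task (G n)),
      ∃ (m : ℕ) (hnm : n ≤ m), Solves (f m) (Nat.leRecOn hnm (fun {k} => push (f k)) t) := by
  choose enum enum_surjective using fun X => exists_surjective_nat (Task X)
  choose Y g hg using exists_solution
  let next (n : ℕ) (s : Σ X, ℕ → Task X) : Σ X, ℕ → Task X :=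
    ⟨Y s.1 (s.2 n), fun m => if m.unpair.1 ≤ n then push (g s.1 (s.2 n)) (s.2 m)
      else enum _ m.unpair.2⟩
  -- Dovetailing: `(state n).2 m` is the task scheduled for stage `m`, as seen from stage `n`; it is
  -- posed at stage `m.unpair.1`.
  let state (n : ℕ) : Σ X, ℕ → Task X :=
    n.rec ⟨X₀, fun m => enum X₀ m.unpair.2⟩ next
  have posed (n k : ℕ) : (state n).2 (n.pair k) = enum _ k := by
    cases n with
    | zero => exact congrArg (enum X₀) (congrArg Prod.snd (Nat.unpair_pair 0 k))
    | succ n => simp only [state, next, Nat.unpair_pair, Nat.not_succ_le_self, if_false]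
  have kept {n m : ℕ} (hnm : n ≤ m) (k : ℕ) :
      Nat.leRecOn hnm (C := fun m => Task (state m).1)
        (fun {i} => push (g (state i).1 ((state i).2 i))) ((state n).2 (n.pair k)) =
      (state m).2 (n.pair k) := by
    induction m, hnm using Nat.le_induction with
    | base => exact Nat.leRecOn_self _
    | succ m hnm ih =>
      rw [Nat.leRecOn_succ hnm, ih]
      simp only [state, next, Nat.unpair_pair, hnm, if_true]
  refine ⟨fun n => (state n).1, fun n => g (state n).1 ((state n).2 n), fun n t => ?_⟩
  obtain ⟨k, rfl⟩ := enum_surjective _ t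
  refine ⟨n.pair k, Nat.left_le_pair n k, ?_⟩
  rw [← posed, kept]
  exact hg _ _

variable {L : FirstOrder.Language.{u, v}} [Countable (Σ l, L.Functions l)]
  {K : Set (Bundled.{0} L.Structure)}

/-- The extension property of a structure for the embeddings between members of a class `K`. -/
def HasExtensionProperty (K : Set (Bundled.{0} L.Structure)) (M : Type) [L.Structure M] : Prop :=
  ∀ A ∈ K, ∀ B ∈ K, ∀ (u : A ↪[L] M) (g : A ↪[L] B), ∃ h : B ↪[L] M, h.comp g = u

theorem HasExtensionProperty.isFraisseLimit {M : Type} [L.Structure M] [Countable M]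
    (hM : HasExtensionProperty K M) (hK : L.age M = K) : IsFraisseLimit K M := by
  refine ⟨?_, hK⟩
  rw [isUltrahomogeneous_iff_IsExtensionPair Structure.cg_of_countable,
    isExtensionPair_iff_exists_embedding_closure_singleton_sup]
  intro S hS f m
  have mem_class {S : L.Substructure M} (hS : S.FG) : ⟨S, inferInstance⟩ ∈ K :=
    hK ▸ age.fg_substructure hS
  obtain ⟨h, hh⟩ := hM _ (mem_class hS) _
    (mem_class (Substructure.FG.sup (Substructure.fg_closure_singleton m) hS)) f
    (Substructure.inclusion le_sup_right)
  exact ⟨h, hh.symm⟩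

omit [Countable (Σ l, L.Functions l)] in
theorem exists_representatives [hK : IsFraisse K] :
    ∃ B : ℕ → Bundled.{0} L.Structure, (∀ k, B k ∈ K) ∧ ∀ N ∈ K, ∃ k, Nonempty (N ≃[L] B k) := by
  obtain ⟨F, hF⟩ := hK.is_essentially_countable.exists_eq_range (hK.is_nonempty.image _)
  have (k : ℕ) : ∃ N ∈ K, Quotient.mk' N = F k := by
    rw [← Set.mem_image, hF]
    exact ⟨k, rfl⟩
  choose B hB hBF using this
  refine ⟨B, hB, fun N hN => ?_⟩
  obtain ⟨k, hk⟩ : Quotient.mk' N ∈ Set.range F := hF ▸ Set.mem_image_of_mem _ hN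
  exact ⟨k, Quotient.exact (hk.symm.trans (hBF k).symm)⟩

omit [Countable (Σ l, L.Functions l)] in
theorem natLERec_self {G : ℕ → Type*} [∀ n, L.Structure (G n)] (f : ∀ n, G n ↪[L] G (n + 1))
    (n : ℕ) : DirectedSystem.natLERec f n n le_rfl = Embedding.refl L (G n) :=
  Nat.leRecOn_self _

omit [Countable (Σ l, L.Functions l)] in
theorem natLERec_succ {G : ℕ → Type*} [∀ n, L.Structure (G n)] (f : ∀ n, G n ↪[L] G (n + 1))
    {n m : ℕ} (hnm : n ≤ m) :
    DirectedSystem.natLERec f n (m + 1) (hnm.trans m.le_succ) =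
      (f m).comp (DirectedSystem.natLERec f n m hnm) :=
  Nat.leRecOn_succ hnm _

theorem exists_rich_sequence [hK : IsFraisse K] {B : ℕ → Bundled.{0} L.Structure}
    (hB : ∀ k, B k ∈ K) :
    ∃ (G : ℕ → Bundled.{0} L.Structure) (f : ∀ n, G n ↪[L] G (n + 1)), (∀ n, G n ∈ K) ∧
      ∀ n j k (u : B j ↪[L] G n) (g : B j ↪[L] B k), ∃ (m : ℕ) (hnm : n ≤ m) (h : B k ↪[L] G m),
        h.comp g = (DirectedSystem.natLERec f n m hnm).comp u := by
  let Task (X : K) : Type := Option (Σ j k, (B j ↪[L] X.1) × (B j ↪[L] B k))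
  have (X : K) : Countable (Task X) := by
    have (Y : K) : Structure.FG L Y.1 := hK.FG _ Y.2
    have : Countable X.1 := Structure.cg_iff_countable.1 (this X).cg
    have (k : ℕ) : Countable (B k) := Structure.cg_iff_countable.1 (hK.FG _ (hB k)).cg
    have (j : ℕ) : Structure.FG L (B j) := hK.FG _ (hB j)
    unfold Task
    infer_instance
  let Solves {X Y : K} (f : X.1 ↪[L] Y.1) (t : Task X) : Prop :=
    ∀ p ∈ t, ∃ h : B p.2.1 ↪[L] Y.1, h.comp p.2.2.2 = f.comp p.2.2.1
  obtain ⟨G, f, hf⟩ := exists_sequence_solving (C := K) (Hom := fun X Y => X.1 ↪[L] Y.1)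
    (fun f => Option.map fun p => ⟨p.1, p.2.1, f.comp p.2.2.1, p.2.2.2⟩) Solves
    (by
      rintro X (_ | ⟨j, k, u, g⟩)
      · exact ⟨X, Embedding.refl L X.1, fun _ hp => nomatch hp⟩
      · obtain ⟨Q, h, f, hQ, e⟩ := hK.amalgamation _ _ _ g u (hB j) (hB k) X.2
        exact ⟨⟨Q, hQ⟩, f, by rintro _ ⟨⟩; exact ⟨h, e⟩⟩)
    ⟨B 0, hB 0⟩
  refine ⟨fun n => G n, f, fun n => (G n).2, fun n j k u g => ?_⟩
  have transported {m : ℕ} (hnm : n ≤ m) :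
      Nat.leRecOn hnm (C := fun m => Task (G m))
        (fun {i} => Option.map fun p => ⟨p.1, p.2.1, (f i).comp p.2.2.1, p.2.2.2⟩)
        (some ⟨j, k, u, g⟩) =
      some ⟨j, k, (DirectedSystem.natLERec f n m hnm).comp u, g⟩ := by
    induction m, hnm using Nat.le_induction with
    | base => rw [Nat.leRecOn_self, natLERec_self, Embedding.refl_comp]
    | succ m hnm ih =>
      rw [Nat.leRecOn_succ hnm, ih, natLERec_succ f hnm, Embedding.comp_assoc]
      rfl
  obtain ⟨m, hnm, hm⟩ := hf n (some ⟨j, k, u, g⟩)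
  obtain ⟨h, hh⟩ := hm _ (transported hnm)
  refine ⟨m + 1, hnm.trans m.le_succ, h, hh.trans ?_⟩
  rw [natLERec_succ f hnm, Embedding.comp_assoc]

omit [Countable (Σ l, L.Functions l)] in
theorem exists_factorization_directLimit {ι : Type*} [Preorder ι] [IsDirectedOrder ι] [Nonempty ι]
    {G : ι → Type*} [∀ i, L.Structure (G i)] (f : ∀ i j, i ≤ j → G i ↪[L] G j)
    [DirectedSystem G fun i j h => f i j h] {A : Type*} [L.Structure A] (hA : Structure.FG L A)
    (u : A ↪[L] Language.DirectLimit G f) :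
    ∃ (i : ι) (u' : A ↪[L] G i), (Language.DirectLimit.of L ι G f i).comp u' = u := by
  obtain ⟨i, T, hT⟩ := Language.DirectLimit.exists_fg_substructure_in_Sigma _ (hA.range u.toHom)
  have range_le : u.toHom.range ≤ (Language.DirectLimit.of L ι G f i).toHom.range := by
    rw [← hT, Hom.range_eq_map]
    exact Substructure.monotone_map le_top
  refine ⟨i, (Language.DirectLimit.of L ι G f i).equivRange.symm.toEmbedding.comp
    ((Substructure.inclusion range_le).comp u.equivRange.toEmbedding), ?_⟩
  ext x
  exact congrArg Subtype.val
    ((Language.DirectLimit.of L ι G f i).equivRange.apply_symm_apply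
      (Substructure.inclusion range_le (u.equivRange x)))

theorem exists_isFraisseLimit [hK : IsFraisse K] :
    ∃ (M : Type) (_ : L.Structure M) (_ : Countable M), IsFraisseLimit K M := by
  obtain ⟨B, hB, representative⟩ := exists_representatives (K := K)
  obtain ⟨G, f, hG, extension⟩ := exists_rich_sequence hB
  let F := DirectedSystem.natLERec f
  let M := Language.DirectLimit (fun n => G n) F
  have : Countable M :=
    Structure.cg_iff_countable.1 (Language.DirectLimit.cg F fun n => (hK.FG _ (hG n)).cg)
  have hM : HasExtensionProperty K M := by
    intro A hA N hN u g
    obtain ⟨n, u, rfl⟩ := exists_factorization_directLimit F (hK.FG A hA) u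
    obtain ⟨⟨j, ⟨a⟩⟩, ⟨k, ⟨b⟩⟩⟩ := And.intro (representative A hA) (representative N hN)
    obtain ⟨m, hnm, h, hh⟩ := extension n j k (u.comp a.symm.toEmbedding)
      (b.toEmbedding.comp (g.comp a.symm.toEmbedding))
    refine ⟨(Language.DirectLimit.of L ℕ _ F m).comp (h.comp b.toEmbedding), ?_⟩
    ext x
    have key : h (b (g (a.symm (a x)))) = F n m hnm (u (a.symm (a x))) :=
      DFunLike.congr_fun hh (a x)
    rw [a.symm_apply_apply] at key
    exact (congrArg _ key).trans Language.DirectLimit.of_f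
  have age_eq : L.age M = ⋃ n, L.age (G n) := age_directLimit (fun n => G n) F
  refine ⟨M, inferInstance, this, hM.isFraisseLimit (subset_antisymm ?_ fun N hN => ?_)⟩
  · rw [age_eq]
    exact Set.iUnion_subset fun n => hK.hereditary _ (hG n)
  · obtain ⟨Q, hQ, ⟨i⟩, ⟨j⟩⟩ := hK.jointEmbedding _ (hG 0) N hN
    obtain ⟨h, -⟩ := hM _ (hG 0) Q hQ (Language.DirectLimit.of L ℕ _ F 0) i
    exact ⟨hK.FG N hN, ⟨h.comp j⟩⟩

end FraisseLimit

namespace Selector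

section Fraisse

variable {M : Type*} [selLang.Structure M] {N : Type*} [selLang.Structure N]

theorem IsPartIso.exists_embedding (hM : IsSelectorModel M) (hN : IsSelectorModel N)
    {R : M → N → Prop} (hR : IsPartIso R) (total : ∀ x, ∃ y, R x y) :
    ∃ e : M ↪[selLang] N, ∀ x, R x (e x) := by
  choose e he using total
  refine ⟨embeddingOf hM hN e (fun x y hxy => ?_) (fun x y => (hR.eqRel_iff (he x) (he y)).symm)
    fun f b _ _ => ?_, he⟩
  · exact (hR.eq_iff (he x) (he y)).2 hxy
  · exact ((hR.eq_iff (he _) (hR.eval (he f) (he b))).1 rfl).symm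

theorem closure_range_subset_generated (hM : IsSelectorModel M) {J : Type*} (v : J → M) :
    (Substructure.closure selLang (Set.range v) : Set M) ⊆ generated v := by
  let S : selLang.Substructure M :=
    { carrier := generated v
      fun_mem := by
        rintro _ ⟨⟩ w hw
        obtain ⟨x, y, rfl⟩ : ∃ x y, w = ![x, y] := ⟨w 0, w 1, List.ofFn_inj.1 rfl⟩
        exact evalAt_mem_generated hM (hw 0) (hw 1) }
  exact Substructure.closure_le (S := S) |>.2 (Set.range_subset_iff.2 (mem_generated v))

theorem finite_of_fg (hM : IsSelectorModel M) (h : Structure.FG selLang M) : Finite M := by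
  obtain ⟨s, hs⟩ := Structure.fg_def.1 h
  have generates : Set.univ ⊆ generated ((↑) : s → M) := by
    simpa [hs] using closure_range_subset_generated hM ((↑) : s → M)
  exact Set.finite_univ_iff.1 ((Set.finite_range _).subset generates)

theorem exists_finite_amalgam {P N : CategoryTheory.Bundled.{0} selLang.Structure}
    (hP : P ∈ finiteSelectorModels) (hN : N ∈ finiteSelectorModels) {H : P → N → Prop}
    (hH : IsPartIso H) :
    ∃ Q ∈ finiteSelectorModels, ∃ (ι : N ↪[selLang] Q) (τ : P ↪[selLang] Q),
      ∀ p n, H p n → ι n = τ p := by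
  obtain ⟨_, hP⟩ := hP
  obtain ⟨_, hN⟩ := hN
  obtain ⟨σ, hσ⟩ := exists_isSelector hN
  obtain ⟨σ', hσ'⟩ := exists_isSelector hP
  obtain ⟨W, _, ι, τ, hW, exists_rep, h⟩ :=
    exists_isAmalgam hP hN hH (fun _ _ => hσ) (fun _ _ => hσ')
  have : Finite W := Finite.of_surjective (Sum.elim ι τ) fun w => by
    simpa only [Sum.exists, Sum.elim_inl, Sum.elim_inr] using exists_rep w
  exact ⟨⟨W, _⟩, ⟨this, hW⟩, ι, τ, fun p n hpn => (h.eq_iff.2 hpn).symm⟩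

theorem nonempty_equiv_of_atoms_eq (hM : IsSelectorModel M) (hN : IsSelectorModel N) {J : Type*}
    {v : J → M} {w : J → N} (hv : v.Surjective) (hw : w.Surjective) (h : atoms v = atoms w) :
    Nonempty (M ≃[selLang] N) := by
  have hR := isPartIso_generatedRel hM hN h
  obtain ⟨e, he⟩ := hR.exists_embedding hM hN fun x => by
    obtain ⟨i, rfl⟩ := hv x
    exact ⟨w i, generatedRel_apply v w i⟩
  have surjective : Function.Surjective e := fun y => by
    obtain ⟨i, rfl⟩ := hw y
    exact ⟨v i, (hR.eq_iff (he _) (generatedRel_apply v w i)).1 rfl⟩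
  exact ⟨{ Equiv.ofBijective e ⟨e.injective, surjective⟩ with
    map_fun' := e.map_fun'
    map_rel' := e.map_rel' }⟩

theorem countable_isomorphism_classes :
    (Quotient.mk' '' finiteSelectorModels : Set (Quotient equivSetoid)).Countable := by
  have iso_of_eq {M N : Type} [selLang.Structure M] [selLang.Structure N] (hM : IsSelectorModel M)
      (hN : IsSelectorModel N) {m n : ℕ} {v : Fin m → M} {w : Fin n → N} (hv : v.Surjective)
      (hw : w.Surjective)
      (h : (⟨m, atoms v⟩ : Σ n, Set (Atom (Fin n))) = ⟨n, atoms w⟩) :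
      Nonempty (M ≃[selLang] N) := by
    obtain rfl : m = n := congrArg Sigma.fst h
    exact nonempty_equiv_of_atoms_eq hM hN hv hw (eq_of_heq (Sigma.mk.inj h).2)
  have (q : Quotient.mk' '' finiteSelectorModels) : ∃ (n : ℕ) (M : Type)
      (_ : selLang.Structure M) (v : Fin n → M), IsSelectorModel M ∧ v.Surjective ∧
        Quotient.mk' ⟨M, inferInstance⟩ = q.1 := by
    obtain ⟨_, M, ⟨_, hM⟩, rfl⟩ := q
    obtain ⟨n, ⟨v⟩⟩ := Finite.exists_equiv_fin M
    exact ⟨n, M, _, v.symm, hM, v.symm.surjective, rfl⟩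
  choose n M inst v hM hv hq using this
  refine Function.Injective.countable (β := Σ n, Set (Atom (Fin n)))
    (f := fun q => ⟨n q, atoms (v q)⟩) fun q q' h => Subtype.ext ?_
  rw [← hq, ← hq]
  exact Quotient.sound (iso_of_eq (hM q) (hM q') (hv q) (hv q') h)

instance : IsFraisse finiteSelectorModels where
  is_nonempty := by
    obtain ⟨_, h, -, -⟩ := exists_structure_extending (X := PEmpty) (rel := fun _ _ => True)
      (S := fun _ _ _ => False) (by simp) (by simp) (by simp) (by simp)
    exact ⟨⟨PEmpty, _⟩, inferInstance, h⟩
  FG _ := fun ⟨_, _⟩ => Structure.FG.of_finite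
  is_essentially_countable := countable_isomorphism_classes
  hereditary := by
    rintro M ⟨_, hM⟩ N ⟨-, ⟨e⟩⟩
    exact ⟨Finite.of_injective e e.injective, .of_embedding hM e⟩
  jointEmbedding M hM N hN :=
    let ⟨Q, hQ, ι, τ, _⟩ := exists_finite_amalgam hM hN isPartIso_false
    ⟨Q, hQ, ⟨τ⟩, ⟨ι⟩⟩
  amalgamation M N P eN eP _ hN hP := by
    obtain ⟨Q, hQ, ι, τ, h⟩ := exists_finite_amalgam hP hN
      ((isPartIso_of_embedding eP).swap.comp (isPartIso_of_embedding eN))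
    exact ⟨Q, ι, τ, hQ, Embedding.ext fun m => h _ _ ⟨m, rfl, rfl⟩⟩

end Fraisse

end Selector

section UniversalClosure

variable {L : Language} {M : Type*} [L.Structure M] {N : Type*} [L.Structure N]

theorem realize_iAlls_sentence {J : Type*} [Finite J] {φ : L.Formula J} :
    M ⊨ ((φ.relabel Sum.inr : L.Formula (Empty ⊕ J)).iAlls J : L.Sentence) ↔
      ∀ v : J → M, φ.Realize v :=
  Formula.realize_iAlls.trans <| forall_congr' fun v => by
    rw [Formula.realize_relabel]
    exact Iff.rfl

theorem forall_realize_iff_of_model_completeTheory [N ⊨ L.completeTheory M] {J : Type*} [Finite J]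
    (φ : L.Formula J) : (∀ v : J → N, φ.Realize v) ↔ ∀ v : J → M, φ.Realize v := by
  rw [← realize_iAlls_sentence, ← realize_iAlls_sentence]
  exact realize_iff_of_model_completeTheory M N _

theorem realize_restrictFreeVar_id {J : Type*} [DecidableEq J] {φ : L.Formula J} {v : J → M} :
    Formula.Realize (φ.restrictFreeVar id) (v ∘ ((↑) : φ.freeVarFinset → J)) ↔ φ.Realize v :=
  BoundedFormula.realize_restrictFreeVar v fun _ => rfl

end UniversalClosure

namespace Selector

section Axioms

variable {M : Type*} [selLang.Structure M]

/-- The formula with variables `x`, `y`, `z` that states the axioms of `T₁` at these elements. -/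
def axiomFormula : selLang.Formula (Fin 3) :=
  let x : selLang.Term (Fin 3) := .var 0
  let y : selLang.Term (Fin 3) := .var 1
  let z : selLang.Term (Fin 3) := .var 2
  let obj (t : selLang.Term (Fin 3)) := Relations.formula₁ (L := selLang) SelRel.obj t
  let fn (t : selLang.Term (Fin 3)) := Relations.formula₁ (L := selLang) SelRel.fn t
  let eqv (s t : selLang.Term (Fin 3)) := Relations.formula₂ (L := selLang) SelRel.equiv s t
  let eval (s t : selLang.Term (Fin 3)) := Functions.apply₂ (L := selLang) SelFunc.eval s t
  ((fn x).iff (obj x).not) ⊓ (((eqv x y).imp (obj x ⊓ obj y)) ⊓ (((obj x).imp (eqv x x)) ⊓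
    (((eqv x y).imp (eqv y x)) ⊓ (((eqv x y).imp ((eqv y z).imp (eqv x z))) ⊓
    (((fn x).imp ((obj y).imp (eqv (eval x y) y))) ⊓
    (((fn x).imp ((eqv y z).imp ((eval x y).equal (eval x z)))) ⊓
    ((fn x ⊓ obj y).not.imp ((eval x y).equal y))))))))

theorem realize_axiomFormula {v : Fin 3 → M} :
    axiomFormula.Realize v ↔ AxiomsAt (v 0) (v 1) (v 2) := by
  have realize_obj (t : selLang.Term (Fin 3)) :
      (Relations.formula₁ (L := selLang) SelRel.obj t).Realize v ↔ IsObj (t.realize v) :=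
    Formula.realize_rel₁ (L := selLang) (R := SelRel.obj)
  have realize_fn (t : selLang.Term (Fin 3)) :
      (Relations.formula₁ (L := selLang) SelRel.fn t).Realize v ↔ IsFn (t.realize v) :=
    Formula.realize_rel₁ (L := selLang) (R := SelRel.fn)
  have realize_equiv (s t : selLang.Term (Fin 3)) :
      (Relations.formula₂ (L := selLang) SelRel.equiv s t).Realize v ↔
        EqRel (s.realize v) (t.realize v) :=
    Formula.realize_rel₂ (L := selLang) (R := SelRel.equiv)
  have realize_eval (s t : selLang.Term (Fin 3)) :
      (Functions.apply₂ (L := selLang) SelFunc.eval s t).realize v =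
        evalAt (s.realize v) (t.realize v) :=
    Term.realize_functions_apply₂ (L := selLang) (f := SelFunc.eval)
  simp only [axiomFormula, AxiomsAt, Formula.realize_inf, Formula.realize_imp, Formula.realize_iff,
    Formula.realize_not, Formula.realize_equal, realize_obj, realize_fn, realize_equiv,
    realize_eval, Term.realize_var]

end Axioms

section QuantifierElimination

theorem exists_isFraisseLimit_completeTheory :
    ∃ (G : Type) (_ : selLang.Structure G) (_ : Countable G),
      IsFraisseLimit finiteSelectorModels G ∧ selectorTheory = selLang.completeTheory G := by
  obtain ⟨G, _, _, hG⟩ := exists_isFraisseLimit (K := finiteSelectorModels)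
  refine ⟨G, inferInstance, inferInstance, hG, Set.ext fun φ => ⟨fun h => h G hG, ?_⟩⟩
  intro h M _ _ hM
  obtain ⟨e⟩ := hG.nonempty_equiv hM
  exact (StrongHomClass.realize_sentence e φ).1 h

theorem exists_isSelectorModel_unit :
    ∃ _ : selLang.Structure Unit, IsSelectorModel Unit ∧ ¬ IsObj () := by
  obtain ⟨_, h, hrel, -⟩ := exists_structure_extending (X := Unit) (rel := fun _ _ => False)
    (S := fun _ _ _ => False) (by simp) (by simp) (by simp) (by simp)
  exact ⟨_, h, fun hx => (hrel _ _).1 (h.refl _ hx)⟩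

variable {G : Type} [selLang.Structure G] [Countable G]
  (hG : IsFraisseLimit finiteSelectorModels G)
include hG

theorem isSelectorModel_of_isFraisseLimit : IsSelectorModel G := by
  refine isSelectorModel_iff.2 fun x y z => ?_
  let S := Substructure.closure selLang {x, y, z}
  have hS : IsSelectorModel S := by
    have fg : S.FG := Substructure.fg_closure (Set.toFinite _)
    exact (hG.age.subset (age.fg_substructure fg)).2
  have mem (w : G) (hw : w ∈ ({x, y, z} : Set G)) : w ∈ S := Substructure.subset_closure hw
  exact (axiomsAt_map S.subtype (x := ⟨x, mem x (by simp)⟩) (y := ⟨y, mem y (by simp)⟩)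
    (z := ⟨z, mem z (by simp)⟩)).2 (isSelectorModel_iff.1 hS _ _ _)

theorem nonempty_embedding_of_isFraisseLimit {W : Type*} [selLang.Structure W] [Finite W]
    (hW : IsSelectorModel W) : Nonempty (W ↪[selLang] G) := by
  obtain ⟨n, ⟨e⟩⟩ := Finite.exists_equiv_fin W
  let _ : selLang.Structure (Fin n) := e.inducedStructure
  have copy : W ≃[selLang] Fin n := e.inducedStructureEquiv
  have mem : ⟨Fin n, inferInstance⟩ ∈ finiteSelectorModels :=
    ⟨inferInstance, hW.of_embedding copy.symm.toEmbedding⟩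
  exact (hG.age.superset mem).2.map fun f => f.comp copy.toEmbedding

theorem realize_iff_of_isFraisseLimit {J : Type*} [Finite J] {v w : J → G} (h : atoms v = atoms w)
    (φ : selLang.Formula J) : φ.Realize v ↔ φ.Realize w := by
  have hM := isSelectorModel_of_isFraisseLimit hG
  have hR := isPartIso_generatedRel hM hM h
  let S := Substructure.closure selLang (Set.range v)
  obtain ⟨e, he⟩ := ((isPartIso_of_embedding S.subtype).comp hR).exists_embedding
    (hM.of_embedding S.subtype) hM fun x => by
      obtain ⟨t, ht⟩ := closure_range_subset_generated hM v x.2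
      exact ⟨t.val w, x, rfl, t, ht, rfl⟩
  obtain ⟨g, hg⟩ := hG.ultrahomogeneous S (Substructure.fg_closure (Set.finite_range v)) e
  have map_v : g ∘ v = w := by
    funext i
    let x : S := ⟨v i, Substructure.subset_closure ⟨i, rfl⟩⟩
    obtain ⟨_, rfl, hx⟩ := he x
    have eq : e x = g (v i) := DFunLike.congr_fun hg x
    exact eq.symm.trans ((hR.eq_iff hx (generatedRel_apply v w i)).1 rfl)
  rw [← map_v]
  exact (StrongHomClass.realize_formula g φ).symm

theorem nonempty_of_isFraisseLimit : Nonempty G := by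
  obtain ⟨_, hW, -⟩ := exists_isSelectorModel_unit
  obtain ⟨e⟩ := nonempty_embedding_of_isFraisseLimit hG hW
  exact ⟨e ()⟩

theorem realize_iff_exists_atoms_eq {M : Type*} [selLang.Structure M]
    [M ⊨ selLang.completeTheory G] {J : Type*} [Finite J] (φ : selLang.Formula J) (v : J → M) :
    φ.Realize v ↔ ∃ w : J → G, atoms w = atoms v ∧ φ.Realize w := by
  let S : Set (Set (Atom J)) := {s | ∃ w : J → G, atoms w = s ∧ φ.Realize w}
  let ψ : selLang.Formula J := φ.iff (Formula.iSup fun s : S => diagramFormula s.1)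
  suffices ψ.Realize v by
    simpa [ψ, S, realize_diagramFormula] using this
  refine (forall_realize_iff_of_model_completeTheory (M := G) ψ).2 (fun w => ?_) v
  have : φ.Realize w ↔ ∃ w' : J → G, atoms w' = atoms w ∧ φ.Realize w' :=
    ⟨fun h => ⟨w, rfl, h⟩, fun ⟨_, h, h'⟩ => (realize_iff_of_isFraisseLimit hG h φ).1 h'⟩
  simpa [ψ, S, realize_diagramFormula] using this

omit hG

theorem selectorTheory_isComplete : selectorTheory.IsComplete := by
  obtain ⟨G, _, _, hG, h⟩ := exists_isFraisseLimit_completeTheory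
  have := nonempty_of_isFraisseLimit hG
  exact h ▸ completeTheory.isComplete selLang G

theorem isSelectorModel_of_model (M : Type*) [selLang.Structure M] [hM : M ⊨ selectorTheory] :
    IsSelectorModel M := by
  obtain ⟨G, _, _, hG, h⟩ := exists_isFraisseLimit_completeTheory
  have : M ⊨ selLang.completeTheory G := h ▸ hM
  have axioms_hold : ∀ v : Fin 3 → M, axiomFormula.Realize v :=
    (forall_realize_iff_of_model_completeTheory (M := G) axiomFormula).2 fun v =>
      realize_axiomFormula.2 (isSelectorModel_iff.1 (isSelectorModel_of_isFraisseLimit hG) _ _ _)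
  exact isSelectorModel_iff.2 fun x y z => realize_axiomFormula.1 (axioms_hold ![x, y, z])

variable {M : Type*} [selLang.Structure M] [hM : M ⊨ selectorTheory]
  {N : Type*} [selLang.Structure N] [hN : N ⊨ selectorTheory]

theorem SameQF.realize_iff {J : Type*} {v : J → M} {w : J → N} (h : SameQF v w)
    (φ : selLang.Formula J) : φ.Realize v ↔ φ.Realize w := by
  classical
  obtain ⟨G, _, _, hG, eq⟩ := exists_isFraisseLimit_completeTheory
  have : M ⊨ selLang.completeTheory G := eq ▸ hM
  have : N ⊨ selLang.completeTheory G := eq ▸ hN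
  rw [← realize_restrictFreeVar_id, ← realize_restrictFreeVar_id (v := w),
    realize_iff_exists_atoms_eq hG, realize_iff_exists_atoms_eq hG, (h.comp _).atoms_eq]

/-- An embedding between models of `T*₁` is elementary. -/
def toElementary (e : M ↪[selLang] N) : M ↪ₑ[selLang] N where
  toFun := e
  map_formula' _ φ v := ((sameQF_map e v).realize_iff φ).symm

end QuantifierElimination

section Ultrapower

variable {W : Type u} [selLang.Structure W]

theorem exists_map_finset {G : Type} [selLang.Structure G] [Countable G]
    (hG : IsFraisseLimit finiteSelectorModels G) (hW : IsSelectorModel W) (s : Finset W) :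
    ∃ f : W → G, ∀ {J : Type} (v : J → W), (∀ i, v i ∈ s) → SameQF v (f ∘ v) := by
  have := nonempty_of_isFraisseLimit hG
  let S := Substructure.closure selLang (s : Set W)
  have hS : IsSelectorModel S := hW.of_embedding S.subtype
  have : Finite S :=
    finite_of_fg hS (S.fg_iff_structure_fg.1 (Substructure.fg_closure s.finite_toSet))
  obtain ⟨e⟩ := nonempty_embedding_of_isFraisseLimit hG hS
  refine ⟨Function.extend S.subtype e fun _ => Classical.arbitrary G, fun v hv => ?_⟩
  obtain ⟨v, rfl⟩ : ∃ v' : _ → S, v = S.subtype ∘ v' :=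
    ⟨fun i => ⟨v i, Substructure.subset_closure (hv i)⟩, rfl⟩
  rw [← Function.comp_assoc, Function.extend_comp S.subtype.injective]
  exact (sameQF_map S.subtype v).symm.trans (sameQF_map e v)

theorem sameQF_ultraproduct {ι : Type*} (l : Ultrafilter ι) {G : Type*} [selLang.Structure G]
    [Nonempty G] (hW : IsSelectorModel W)
    (hG : IsSelectorModel ((l : Filter ι).Product fun _ => G)) {J : Type*} {v : J → W}
    {w : J → ι → G} (h : ∀ᶠ i in l, SameQF v fun j => w j i) :
    SameQF v fun j => (w j : (l : Filter ι).Product fun _ => G) := by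
  refine (sameQF_iff_atoms_eq hW hG).2 (Set.ext fun a => ?_)
  have los := Ultraproduct.realize_formula_cast (u := l) (atomFormula a) w
  simp only [realize_atomFormula] at los
  refine Iff.trans ?_ los.symm
  refine (Filter.eventually_const (f := (l : Filter ι))).symm.trans ?_
  exact Filter.eventually_congr (h.mono fun i hi => by rw [hi.atoms_eq])

theorem exists_embedding_model (hW : IsSelectorModel W) :
    ∃ (N : Type u) (_ : selLang.Structure N) (_ : N ⊨ selectorTheory),
      Nonempty (W ↪[selLang] N) := by
  obtain ⟨G, _, _, hG, eq⟩ := exists_isFraisseLimit_completeTheory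
  have := nonempty_of_isFraisseLimit hG
  let l : Ultrafilter (Finset W) := Ultrafilter.of Filter.atTop
  let N := (l : Filter (Finset W)).Product fun _ => G
  have hN : N ⊨ selectorTheory := by
    refine eq ▸ ⟨fun φ hφ => ?_⟩
    exact (Ultraproduct.sentence_realize φ).2 (.of_forall fun _ => hφ)
  choose f hf using exists_map_finset hG hW
  let e (x : W) : N := ((fun s => f s x : Finset W → G) : N)
  have sameQF (v : Fin 3 → W) : SameQF v (e ∘ v) := by
    refine sameQF_ultraproduct l hW (isSelectorModel_of_model N) ?_
    have large : ∀ᶠ s : Finset W in l, ∀ i, v i ∈ s :=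
      Filter.eventually_all.2 fun i => Ultrafilter.of_le _ <|
        (Filter.eventually_ge_atTop {v i}).mono fun _ => Finset.singleton_subset_iff.1
    exact large.mono fun s hs => hf s v hs
  refine ⟨N, inferInstance, hN, ⟨embeddingOf hW (isSelectorModel_of_model N) e ?_ ?_ ?_⟩⟩
  · intro x y hxy
    obtain ⟨R, hR, h⟩ := sameQF ![x, y, y]
    exact (hR.eq_iff (h 0) (h 1)).2 hxy
  · intro x y
    obtain ⟨R, hR, h⟩ := sameQF ![x, y, y]
    exact (hR.eqRel_iff (h 0) (h 1)).symm
  · intro x y _ _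
    obtain ⟨R, hR, h⟩ := sameQF ![x, y, evalAt x y]
    exact (hR.eq_iff (hR.eval (h 0) (h 1)) (h 2)).1 rfl

end Ultrapower

section TypeAmalgamation

variable {M : Type u} [selLang.Structure M]

theorem isPartIso_restrict {N : Type*} [selLang.Structure N] (e : M ↪[selLang] N) {X : Set M}
    (hX : ∀ x ∈ X, ∀ y ∈ X, evalAt x y ∈ X) : IsPartIso fun x y => x ∈ X ∧ e x = y where
  eq_iff := fun hx hy => (isPartIso_of_embedding e).eq_iff hx.2 hy.2
  eqRel_iff := fun hx hy => (isPartIso_of_embedding e).eqRel_iff hx.2 hy.2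
  eval := fun ⟨hx, hx'⟩ ⟨hy, hy'⟩ => ⟨hX _ hx _ hy, (isPartIso_of_embedding e).eval hx' hy'⟩

theorem linked_flip {N : Type*} [selLang.Structure N] (hN : IsSelectorModel N)
    (hM : IsSelectorModel M) {H : M → N → Prop} {x : M} {y : N} :
    Linked (flip H) y x ↔ Linked H x y :=
  ⟨fun ⟨n, p, h, hy, hx⟩ => ⟨p, n, h, hM.symm _ _ hx, hN.symm _ _ hy⟩,
    fun ⟨p, n, h, hx, hy⟩ => ⟨n, p, h, hN.symm _ _ hy, hM.symm _ _ hx⟩⟩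

theorem IsAmalgam.swap {N : Type*} [selLang.Structure N] {W : Type*} [selLang.Structure W]
    (hW : IsSelectorModel W) {H : M → N → Prop} {α : M → N → N} {β : N → M → M}
    {ι : N ↪[selLang] W} {τ : M ↪[selLang] W} (hA : IsAmalgam H α β ι τ) :
    IsAmalgam (flip H) β α τ ι :=
  have linked_flip {x : M} {y : N} : Linked (flip H) y x ↔ Linked H x y :=
    linked_flip (hW.of_embedding ι) (hW.of_embedding τ)
  { eq_iff := eq_comm.trans hA.eq_iff
    eqRel_iff := (hW.eqRel_comm).trans (hA.eqRel_iff.trans linked_flip.symm)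
    eval_left := fun hg hx hgp hxn => hA.eval_right hg hx hgp fun n hn => hxn n (linked_flip.2 hn)
    eval_right := fun hf hy hfn hyp => hA.eval_left hf hy hfn fun p hp => hyp p (linked_flip.2 hp) }

/-- The relation `H` fixes the elements of `Z` which are in its domain or in its range, or which are
`E`-related to an element of these. -/
def FixesTrace (H : M → M → Prop) (Z : Set M) : Prop :=
  ∀ z ∈ Z, ∀ p n, H p n → z = p ∨ z = n ∨ EqRel z p ∨ EqRel z n → H z z

namespace FixesTrace

variable {H : M → M → Prop} {Z : Set M}

theorem flip (h : FixesTrace H Z) : FixesTrace (flip H) Z := fun z hz p n hpn hzpn =>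
  h z hz n p hpn (by tauto)

theorem of_linked (h : FixesTrace H Z) {x y : M} (hx : x ∈ Z) : Linked H x y → H x x :=
  fun ⟨p, n, hpn, hxp, _⟩ => h x hx p n hpn (.inr (.inr (.inl hxp)))

theorem evalAt_of_linked (hM : IsSelectorModel M) (h : FixesTrace H Z) {f y p : M} (hy : y ∈ Z)
    (hfy : evalAt f y ∈ Z) :
    Linked H p y → H y y ∧ H (evalAt f y) (evalAt f y) := by
  rintro ⟨p', n, hpn, -, hny⟩
  have hyy := h y hy p' n hpn (.inr (.inr (.inr (hM.symm _ _ hny))))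
  exact ⟨hyy, h _ hfy y y hyy (.inr (.inr (.inl (hM.eqRel_evalAt_self (hM.rel_obj _ _ hny).2))))⟩

end FixesTrace

section Copies

variable {W : Type*} [selLang.Structure W] {H : M → M → Prop} {ι τ : M ↪[selLang] W} {X Y Z : Set M}

theorem IsAmalgam.evalAt_copies (hM : IsSelectorModel M) (hW : IsSelectorModel W)
    (hA : IsAmalgam H evalAt evalAt ι τ) (hH : FixesTrace H Z) {f y : M} (hf : f ∈ Z) (hy : y ∈ Z)
    (hfy : evalAt f y ∈ Z) : evalAt (τ f) (ι y) = ι (evalAt f y) := by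
  by_cases hfO : IsObj f
  · rw [hW.evalAt_of_isObj ((isObj_map τ).2 hfO), hM.evalAt_of_isObj hfO]
  by_cases hyO : IsObj y
  swap
  · rw [hW.evalAt_of_not_isObj ((isObj_map ι).not.2 hyO), hM.evalAt_of_not_isObj hyO]
  by_cases hfH : ∃ n, H f n
  · obtain ⟨n, hn⟩ := hfH
    rw [hA.eq_iff.2 (hH f hf f n hn (.inl rfl)), evalAt_map]
  by_cases hyH : ∃ p, Linked H p y
  · obtain ⟨p, hp⟩ := hyH
    obtain ⟨hyy, hff⟩ := hH.evalAt_of_linked hM hy hfy hp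
    rw [← hA.eq_iff.2 hyy, evalAt_map, hA.eq_iff.2 hff]
  · exact hA.eval_left hfO hyO (not_exists.1 hfH) (not_exists.1 hyH)

theorem IsAmalgam.isPartIso_copies (hM : IsSelectorModel M) (hW : IsSelectorModel W)
    (hA : IsAmalgam H evalAt evalAt ι τ) (hX : ∀ f ∈ X ∪ Y, ∀ x ∈ X, evalAt f x ∈ X)
    (hY : ∀ f ∈ X ∪ Y, ∀ y ∈ Y, evalAt f y ∈ Y) (hH : FixesTrace H (X ∪ Y))
    (meet : ∀ x ∈ X, ∀ y ∈ Y, x = y ∨ EqRel x y → H x x) :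
    IsPartIso fun z w => (z ∈ X ∧ τ z = w) ∨ (z ∈ Y ∧ ι z = w) := by
  have copies_eq {z : M} (h : H z z) : τ z = ι z := hA.eq_iff.2 h
  refine IsPartIso.union hM hW (isPartIso_restrict τ fun x hx => hX x (.inl hx))
    (isPartIso_restrict ι fun y hy => hY y (.inr hy)) ?_ ?_ ?_ ?_
  · rintro x _ y _ ⟨hx, rfl⟩ ⟨hy, rfl⟩
    constructor
    · rintro rfl
      exact copies_eq (meet x hx x hy (.inl rfl))
    · intro h
      have hxx := hH x (.inl hx) x y (hA.eq_iff.1 h) (.inl rfl)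
      exact ι.injective ((copies_eq hxx).symm.trans h)
  · rintro x _ y _ ⟨hx, rfl⟩ ⟨hy, rfl⟩
    constructor
    · intro h
      rw [copies_eq (meet x hx y hy (.inr h))]
      exact (eqRel_map ι).2 h
    · intro h
      rw [copies_eq (hH.of_linked (.inl hx) (hA.eqRel_iff.1 h))] at h
      exact (eqRel_map ι).1 h
  · rintro f _ y _ ⟨hf, rfl⟩ ⟨hy, rfl⟩
    have hfy := hY f (.inl hf) y hy
    exact .inr ⟨hfy, (hA.evalAt_copies hM hW hH (.inl hf) (.inr hy) (.inr hfy)).symm⟩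
  · rintro x _ g _ ⟨hx, rfl⟩ ⟨hg, rfl⟩
    have hgx := hX g (.inr hg) x hx
    exact .inl ⟨hgx, ((hA.swap hW).evalAt_copies hM hW hH.flip (.inr hg) (.inl hx)
      (.inl hgx)).symm⟩

end Copies

/-- The sets `A` and `B` meet only in `C`, and so do their images in the set of `E`-classes. -/
structure MeetsIn (A B C : Set M) : Prop where
  mem : ∀ x ∈ A, x ∈ B → x ∈ C
  eqRel : ∀ x ∈ A, ∀ y ∈ B, EqRel x y → ∃ c ∈ C, EqRel x c

theorem IsPartIso.extend_fixed (hM : IsSelectorModel M) {S : M → M → Prop} (hS : IsPartIso S)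
    {T : Set M} (hT : ∀ x ∈ T, ∃ c, S c c ∧ EqRel x c)
    (fixed : ∀ x ∈ T, ∀ p n, S p n → x = p ∨ x = n → S x x) :
    IsPartIso fun x y => S x y ∨ x ∈ T ∧ x = y := by
  have isObj_of_mem {x} (hx : x ∈ T) : IsObj x :=
    let ⟨_, _, hxc⟩ := hT x hx
    (hM.rel_obj _ _ hxc).1
  refine hS.union hM hM ⟨?_, ?_, ?_⟩ ?_ ?_ ?_ ?_
  · rintro x _ y _ ⟨-, rfl⟩ ⟨-, rfl⟩
    rfl
  · rintro x _ y _ ⟨-, rfl⟩ ⟨-, rfl⟩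
    rfl
  · rintro x _ y _ ⟨hx, rfl⟩ ⟨hy, rfl⟩
    rw [hM.evalAt_of_isObj (isObj_of_mem hx)]
    exact ⟨hy, rfl⟩
  · rintro x x' y _ hx ⟨hy, rfl⟩
    constructor
    · rintro rfl
      exact ((hS.eq_iff (fixed x hy x x' hx (.inl rfl)) hx).1 rfl).symm
    · rintro rfl
      exact (hS.eq_iff hx (fixed x' hy x x' hx (.inr rfl))).2 rfl
  · rintro x x' y _ hx ⟨hy, rfl⟩
    obtain ⟨c, hc, hyc⟩ := hT y hy
    rw [hM.eqRel_congr_right hyc, hM.eqRel_congr_right hyc, hS.eqRel_iff hx hc]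
  · rintro x x' y _ hx ⟨hy, rfl⟩
    obtain ⟨c, hc, hyc⟩ := hT y hy
    by_cases hxO : IsObj x
    · rw [hM.evalAt_of_isObj hxO, hM.evalAt_of_isObj ((hS.isObj_iff hM hM hx).1 hxO)]
      exact .inr ⟨hy, rfl⟩
    · rw [hM.evalAt_congr hxO hyc,
        hM.evalAt_congr ((hS.isObj_iff hM hM hx).not.1 hxO) hyc]
      exact .inl (hS.eval hx hc)
  · rintro x x' y _ hx ⟨hy, rfl⟩
    rw [hM.evalAt_of_isObj (isObj_of_mem hy), hM.evalAt_of_isObj (isObj_of_mem hy)]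
    exact .inl hx

/-- The elements of `G` which are in `A` or `E`-related to an element of `A`. -/
def classHull (G A : Set M) : Set M := {x | x ∈ G ∧ (x ∈ A ∨ ∃ u ∈ A, EqRel x u)}

theorem evalAt_mem_classHull (hM : IsSelectorModel M) {G A : Set M} {f x : M}
    (hfx : evalAt f x ∈ G) (hx : x ∈ classHull G A) : evalAt f x ∈ classHull G A := by
  by_cases hxO : IsObj x
  · refine ⟨hfx, .inr ?_⟩
    obtain ⟨-, hxA | ⟨u, hu, hxu⟩⟩ := hx
    · exact ⟨x, hxA, hM.eqRel_evalAt_self hxO⟩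
    · exact ⟨u, hu, hM.trans _ _ _ (hM.eqRel_evalAt_self hxO) hxu⟩
  · rwa [hM.evalAt_of_not_isObj hxO]

theorem exists_eqRel_of_mem_classHull (hM : IsSelectorModel M) {G A : Set M} {x : M}
    (hx : x ∈ classHull G A) (hxO : IsObj x) : ∃ u ∈ A, EqRel x u :=
  hx.2.elim (fun h => ⟨x, h, hM.refl x hxO⟩) id

theorem MeetsIn.mem_or_eqRel_of_classHull (hM : IsSelectorModel M) {G A B C : Set M}
    (h : MeetsIn A B C) {x y : M} (hx : x ∈ classHull G A) (hy : y ∈ classHull G B)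
    (hxy : x = y ∨ EqRel x y) : x ∈ C ∨ ∃ c ∈ C, EqRel x c := by
  by_cases hxO : IsObj x
  · have hxy : EqRel x y := hxy.elim (fun h => h ▸ hM.refl x hxO) id
    obtain ⟨u, hu, hxu⟩ := exists_eqRel_of_mem_classHull hM hx hxO
    obtain ⟨v, hv, hyv⟩ := exists_eqRel_of_mem_classHull hM hy (hM.rel_obj _ _ hxy).2
    have huv := hM.trans _ _ _ (hM.symm _ _ hxu) (hM.trans _ _ _ hxy hyv)
    obtain ⟨c, hc, huc⟩ := h.eqRel u hu v hv huv
    exact .inr ⟨c, hc, hM.trans _ _ _ hxu huc⟩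
  · have not_eqRel (z : M) : ¬ EqRel x z := fun hxz => hxO (hM.rel_obj _ _ hxz).1
    obtain rfl := hxy.resolve_right (not_eqRel y)
    exact .inl (h.mem x (hx.2.resolve_right fun ⟨u, _, hxu⟩ => not_eqRel u hxu)
      (hy.2.resolve_right fun ⟨u, _, hxu⟩ => not_eqRel u hxu))

theorem IsPartIso.exists_fixing_extension (hM : IsSelectorModel M) {S : M → M → Prop}
    (hS : IsPartIso S) {C D G : Set M} (hC : ∀ c ∈ C, S c c)
    (hD : ∀ x y, S x y → x ∈ D ∧ y ∈ D) (hG : MeetsIn G D C) :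
    ∃ H : M → M → Prop, IsPartIso H ∧ (∀ x y, S x y → H x y) ∧ FixesTrace H G ∧
      ∀ x ∈ G, (x ∈ C ∨ ∃ c ∈ C, EqRel x c) → H x x := by
  let T : Set M := {x | x ∈ G ∧ ∃ c ∈ C, EqRel x c}
  have fixed {x p n : M} (hx : x ∈ G) (hpn : S p n) (hxpn : x = p ∨ x = n) : S x x :=
    hC x (hG.mem x hx (by rcases hxpn with rfl | rfl <;> simp only [hD _ _ hpn]))
  refine ⟨fun x y => S x y ∨ x ∈ T ∧ x = y,
    hS.extend_fixed hM (fun x hx => hx.2.imp fun c hc => ⟨hC c hc.1, hc.2⟩)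
      fun x hx p n => fixed hx.1, fun x y => .inl, ?_,
    fun x hx h => h.imp (hC x) fun hc => ⟨⟨hx, hc⟩, rfl⟩⟩
  rintro z hz p n (hpn | ⟨hp, rfl⟩) (rfl | rfl | h | h)
  · exact .inl (fixed hz hpn (.inl rfl))
  · exact .inl (fixed hz hpn (.inr rfl))
  · exact .inr ⟨⟨hz, hG.eqRel z hz p (hD _ _ hpn).1 h⟩, rfl⟩
  · exact .inr ⟨⟨hz, hG.eqRel z hz n (hD _ _ hpn).2 h⟩, rfl⟩
  · exact .inr ⟨hp, rfl⟩
  · exact .inr ⟨hp, rfl⟩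
  all_goals exact .inr ⟨⟨hz, hp.2.imp fun c hc => ⟨hc.1, hM.trans _ _ _ h hc.2⟩⟩, rfl⟩

theorem sameQF_elim_map {N : Type*} [selLang.Structure N] (f : M ↪[selLang] N) {I J : Type*}
    (v : I → M) (w : J → M) : SameQF (Sum.elim v w) (Sum.elim (f ∘ v) (f ∘ w)) :=
  Sum.comp_elim f v w ▸ sameQF_map f _

theorem exists_amalgam_types [M ⊨ selectorTheory] {I J K : Type*} {S : M → M → Prop}
    (hS : IsPartIso S) {C D : Set M} (hC : ∀ c ∈ C, S c c) (hD : ∀ x y, S x y → x ∈ D ∧ y ∈ D)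
    {d : I → M} {b b' : J → M} {e : K → M} (hb : ∀ j, S (b j) (b' j))
    (hG : MeetsIn (generated (Sum.elim d e)) D C) (hde : MeetsIn (generated d) (generated e) C) :
    ∃ (N : Type u) (_ : selLang.Structure N) (_ : N ⊨ selectorTheory) (f : M ↪[selLang] N)
      (d' : I → N), SameQF (Sum.elim d b) (Sum.elim d' (f ∘ b')) ∧
        SameQF (Sum.elim d e) (Sum.elim d' (f ∘ e)) := by
  have hM := isSelectorModel_of_model M
  obtain ⟨H, hH, hSH, fixesTrace, fixed⟩ := hS.exists_fixing_extension hM hC hD hG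
  obtain ⟨W, _, ι, τ, hW, -, hA⟩ := exists_isAmalgam hM hM hH
    (fun f => isSelector_evalAt hM) (fun f => isSelector_evalAt hM)
  let G := generated (Sum.elim d e)
  have hXY : classHull G (generated d) ∪ classHull G (generated e) ⊆ G :=
    Set.union_subset (fun x hx => hx.1) fun x hx => hx.1
  have copies := hA.isPartIso_copies hM hW
    (fun f hf x hx => evalAt_mem_classHull hM (evalAt_mem_generated hM (hXY hf) hx.1) hx)
    (fun f hf y hy => evalAt_mem_classHull hM (evalAt_mem_generated hM (hXY hf) hy.1) hy)
    (fun z hz => fixesTrace z (hXY hz))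
    (fun x hx y hy hxy => fixed x hx.1 (hde.mem_or_eqRel_of_classHull hM hx hy hxy))
  have sameQF_de : SameQF (Sum.elim d e) (Sum.elim (τ ∘ d) (ι ∘ e)) := by
    refine ⟨_, copies, ?_⟩
    rintro (i | k)
    · exact .inl ⟨⟨mem_generated _ (Sum.inl i), .inl (mem_generated d i)⟩, rfl⟩
    · exact .inr ⟨⟨mem_generated _ (Sum.inr k), .inl (mem_generated e k)⟩, rfl⟩
  have sameQF_db : SameQF (Sum.elim d b) (Sum.elim (τ ∘ d) (ι ∘ b')) := by
    have hτ : τ ∘ b = ι ∘ b' := funext fun j => hA.eq_iff.2 (hSH _ _ (hb j))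
    rw [← hτ, ← Sum.comp_elim]
    exact sameQF_map τ _
  obtain ⟨N, _, hN, ⟨g⟩⟩ := exists_embedding_model hW
  refine ⟨N, _, hN, g.comp ι, g ∘ τ ∘ d,
    sameQF_db.trans (sameQF_elim_map g (τ ∘ d) (ι ∘ b')),
    sameQF_de.trans (sameQF_elim_map g (τ ∘ d) (ι ∘ e))⟩

end TypeAmalgamation

end Selector

theorem exists_realize_of_elementary {L : FirstOrder.Language} {M N : Type*} [L.Structure M]
    [L.Structure N] (e : M ↪ₑ[L] N) {α κ ι : Type*} [Finite α] [Finite ι] (φ : L.Formula (α ⊕ κ))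
    (b : ι → κ → M) (h : ∃ x : α → N, ∀ i, φ.Realize (Sum.elim x (e ∘ b i))) :
    ∃ x : α → M, ∀ i, φ.Realize (Sum.elim x (b i)) := by
  let commonSolution : L.Formula (ι × κ) := Formula.iExs α (Formula.iInf fun i : ι =>
    φ.relabel (Sum.elim Sum.inr fun a => Sum.inl (i, a)))
  have transfer := e.map_formula commonSolution fun p => b p.1 p.2
  simp only [commonSolution, Formula.realize_iExs, Formula.realize_iInf, Formula.realize_relabel,
    Sum.comp_elim] at transfer
  exact transfer.1 h

theorem exists_stable_block {Q : Type*} [Finite Q] {p : Q → ℕ → Prop} (hp : ∀ q, Monotone (p q))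
    (l : ℕ) : ∃ b ≤ Nat.card Q, ∀ q, p q ((b + 1) * l) → p q (b * l) := by
  by_contra! h
  choose g hg using fun b : Fin (Nat.card Q + 1) => h b.1 (Nat.lt_succ_iff.1 b.2)
  have g_ne {a b} (hab : a < b) : g a ≠ g b := fun he =>
    (hg b).2 (hp _ (Nat.mul_le_mul_right l (Nat.succ_le_of_lt hab)) (he ▸ (hg a).1))
  have := Nat.card_le_card_of_injective g fun a b hab => by_contra fun hne =>
    (lt_or_gt_of_ne hne).elim (g_ne · hab) (g_ne · hab.symm)
  simp at this

theorem exists_stable_pair {Q₁ Q₂ : Type*} [Finite Q₁] [Finite Q₂] {p : Q₁ → ℕ → Prop}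
    (hp : ∀ q, Monotone (p q)) {p' : ℕ → Q₂ → ℕ → Prop} (hp' : ∀ j q, Monotone (p' j q)) :
    ∃ i j, i < j ∧ j < (Nat.card Q₁ + 1) * (Nat.card Q₂ + 2) ∧
      (∀ q, p q (j + 1) → p q i) ∧ ∀ q, p' j q (i + 1) → p' j q i := by
  obtain ⟨b, hb, hpb⟩ := exists_stable_block hp (Nat.card Q₂ + 2)
  set l := Nat.card Q₂ + 2 with hl
  let j := b * l + (Nat.card Q₂ + 1)
  have hj : (b + 1) * l = j + 1 := by simp only [j, hl]; ring
  obtain ⟨s, hs, hps⟩ := exists_stable_block (p := fun q s => p' j q (b * l + s))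
    (fun q s s' h => hp' j q (Nat.add_le_add_left h _)) 1
  simp only [mul_one] at hps
  refine ⟨b * l + s, j, by omega, ?_, fun q h => ?_, hps⟩
  · have : (b + 1) * l ≤ (Nat.card Q₁ + 1) * l := Nat.mul_le_mul_right l (by omega)
    omega
  · exact hp q (Nat.le_add_right _ _) (hpb q (hj ▸ h))

theorem map_range_getD_of_prefix {α : Type*} {l l' : List α} (h : l <+: l') (a : α) :
    (List.range l.length).map (fun t => l'.getD t a) = l := by
  obtain ⟨r, rfl⟩ := h
  refine List.ext_getElem (by simp) fun t h1 h2 => ?_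
  simp [List.getD_eq_getElem?_getD, List.getElem?_append, h2]

namespace Selector

section NSOP₁

variable {M : Type u} [selLang.Structure M]

/-- The value at `v` of a normal term (left), or its `E`-class (right), meets `C`. -/
def Touches {J : Type*} (v : J → M) (C : Set M) : NormalTerm J ⊕ NormalTerm J → Prop :=
  Sum.elim (fun t => t.val v ∈ C) fun t => ∃ c ∈ C, EqRel (t.val v) c

theorem Touches.mono {J : Type*} (v : J → M) {C D : Set M} (hCD : C ⊆ D) :
    ∀ t, Touches v C t → Touches v D t
  | .inl _, h => hCD h
  | .inr _, ⟨c, hc, h⟩ => ⟨c, hCD hc, h⟩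

theorem meetsIn_generated {J : Type*} {v : J → M} {C D : Set M}
    (h : ∀ t, Touches v D t → Touches v C t) : MeetsIn (generated v) D C where
  mem := by
    rintro _ ⟨t, rfl⟩ ht
    exact h (.inl t) ht
  eqRel := by
    rintro _ ⟨t, rfl⟩ y hy hty
    exact h (.inr t) ⟨y, hy, hty⟩

/-- The length of a chain of sets which suffices for `exists_meetsIn`. -/
noncomputable def stabilityBound (J K : Type*) : ℕ :=
  (Nat.card (NormalTerm J ⊕ NormalTerm J) + 1) *
    (Nat.card (NormalTerm (J ⊕ K) ⊕ NormalTerm (J ⊕ K)) + 2)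

theorem MeetsIn.mono {A B B' C : Set M} (h : MeetsIn A B C) (hB : B' ⊆ B) : MeetsIn A B' C where
  mem := fun x hx hxB => h.mem x hx (hB hxB)
  eqRel := fun x hx y hy => h.eqRel x hx y (hB hy)

theorem exists_meetsIn {J K : Type*} [Finite J] [Finite K] {C : ℕ → Set M} (hC : Monotone C)
    (d : J → M) (c : ℕ → K → M) : ∃ i j, i < j ∧ j < stabilityBound J K ∧
      MeetsIn (generated d) (C (j + 1)) (C i) ∧
      MeetsIn (generated (Sum.elim d (c j))) (C (i + 1)) (C i) := by
  obtain ⟨i, j, hij, hj, h, h'⟩ := exists_stable_pair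
    (p := fun t i => Touches d (C i) t) (fun t _ _ hi => Touches.mono d (hC hi) t)
    (p' := fun j t i => Touches (Sum.elim d (c j)) (C i) t)
    fun j t _ _ hi => Touches.mono _ (hC hi) t
  exact ⟨i, j, hij, hj, meetsIn_generated h, meetsIn_generated h'⟩

/-- The first `i` terms of two sequences of tuples. -/
def past {K : Type*} (c₀ c₁ : ℕ → K → M) (i : ℕ) : Fin i × Bool × K → M :=
  fun p => bif p.2.1 then c₁ p.1 p.2.2 else c₀ p.1 p.2.2

theorem exists_realize_of_meetsIn [M ⊨ selectorTheory] {I J K : Type*} [Finite J] {w : I → M}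
    {d : J → M} {b b' e : K → M} {D : Set M} (hb : SameQF (Sum.elim w b) (Sum.elim w b'))
    (hD : generated (Sum.elim w b) ∪ generated (Sum.elim w b') ⊆ D)
    (hG : MeetsIn (generated (Sum.elim d e)) D (generated w))
    (hde : MeetsIn (generated d) (generated e) (generated w)) {φ : selLang.Formula (J ⊕ K)}
    (hφb : φ.Realize (Sum.elim d b)) (hφe : φ.Realize (Sum.elim d e)) :
    ∃ x : J → M, φ.Realize (Sum.elim x b') ∧ φ.Realize (Sum.elim x e) := by
  have hM := isSelectorModel_of_model M
  have fixed : ∀ c ∈ generated w, generatedRel (Sum.elim w b) (Sum.elim w b') c c := by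
    rintro _ ⟨t, rfl⟩
    exact (isPartIso_generatedRel hM hM hb.atoms_eq).val
      (fun i => generatedRel_apply _ _ (Sum.inl i)) t
  have mem_D : ∀ x y, generatedRel (Sum.elim w b) (Sum.elim w b') x y → x ∈ D ∧ y ∈ D := by
    rintro _ _ ⟨t, rfl, rfl⟩
    exact ⟨hD (.inl ⟨t, rfl⟩), hD (.inr ⟨t, rfl⟩)⟩
  obtain ⟨N, _, _, f, x, hxb, hxe⟩ := exists_amalgam_types
    (isPartIso_generatedRel hM hM hb.atoms_eq) fixed mem_D
    (fun a => generatedRel_apply _ _ (Sum.inr a)) hG hde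
  have realize_x : ∀ s, φ.Realize (Sum.elim x (f ∘ bif s then b' else e)) := fun
    | false => (hxe.realize_iff φ).1 hφe
    | true => (hxb.realize_iff φ).1 hφb
  obtain ⟨y, hy⟩ := exists_realize_of_elementary (toElementary f) φ _ ⟨x, realize_x⟩
  exact ⟨y, hy true, hy false⟩

theorem exists_common_realization [M ⊨ selectorTheory] {J K : Type*} [Finite J] [Finite K]
    {c₀ c₁ : ℕ → K → M}
    (hc : ∀ i, SameQF (Sum.elim (past c₀ c₁ i) (c₀ i)) (Sum.elim (past c₀ c₁ i) (c₁ i)))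
    {φ : selLang.Formula (J ⊕ K)} {d : J → M}
    (hd : ∀ i < stabilityBound J K, φ.Realize (Sum.elim d (c₀ i))) :
    ∃ i j, i < j ∧
      ∃ x : J → M, φ.Realize (Sum.elim x (c₁ i)) ∧ φ.Realize (Sum.elim x (c₀ j)) := by
  have hM := isSelectorModel_of_model M
  let C : ℕ → Set M := fun i => generated (past c₀ c₁ i)
  have C_closed (i) : ∀ x ∈ C i, ∀ y ∈ C i, evalAt x y ∈ C i :=
    fun x hx y hy => evalAt_mem_generated hM hx hy
  have c₀_mem {i j} (h : i < j) (a) : c₀ i a ∈ C j :=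
    mem_generated (past c₀ c₁ j) (⟨i, h⟩, false, a)
  have c₁_mem {i j} (h : i < j) (a) : c₁ i a ∈ C j :=
    mem_generated (past c₀ c₁ j) (⟨i, h⟩, true, a)
  have past_mem {i j} (hij : i ≤ j) : ∀ p, past c₀ c₁ i p ∈ C j
    | (k, false, a) => c₀_mem (k.2.trans_le hij) a
    | (k, true, a) => c₁_mem (k.2.trans_le hij) a
  have hC : Monotone C := fun i j hij => generated_subset (C_closed j) (past_mem hij)
  obtain ⟨i, j, hij, hj, hdC, hdcC⟩ := exists_meetsIn hC d c₀
  refine ⟨i, j, hij, exists_realize_of_meetsIn (hc i) (Set.union_subset ?_ ?_) hdcC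
    (hdC.mono ?_) (hd i (hij.trans hj)) (hd j hj)⟩
  · exact generated_subset (C_closed _) (Sum.rec (past_mem i.le_succ) (c₀_mem i.lt_succ_self))
  · exact generated_subset (C_closed _) (Sum.rec (past_mem i.le_succ) (c₁_mem i.lt_succ_self))
  · exact generated_subset (C_closed _) (c₀_mem j.lt_succ_self)

/-- This is the pigeonhole principle for the nodes `η0...01`. -/
theorem exists_separated_pair (hM : IsSelectorModel M) {I K : Type*} [Finite I] [Finite K]
    (a : List Bool → K → M) (w : I → M) (η : List Bool) :
    ∃ κ σ : List Bool, η <+: σ ∧ κ ++ [false] <+: σ ∧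
      SameQF (Sum.elim w (a σ)) (Sum.elim w (a (κ ++ [true]))) := by
  let node (k : ℕ) : List Bool := η ++ List.replicate k false
  have separated {k l : ℕ} (h : k < l) : node k ++ [false] <+: node l ++ [true] := by
    obtain ⟨r, rfl⟩ := Nat.exists_eq_add_of_lt h
    refine ⟨List.replicate r false ++ [true], ?_⟩
    simp only [node, add_right_comm k r 1, List.replicate_add, List.replicate_one,
      List.append_assoc]
  obtain ⟨k, l, hkl, h⟩ : ∃ k l, k < l ∧ atoms (Sum.elim w (a (node k ++ [true]))) =
      atoms (Sum.elim w (a (node l ++ [true]))) := by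
    obtain ⟨k, l, hkl, h⟩ := Finite.exists_ne_map_eq_of_infinite
      fun k => atoms (Sum.elim w (a (node k ++ [true])))
    exact hkl.lt_or_gt.elim (fun hkl => ⟨k, l, hkl, h⟩) fun hkl => ⟨l, k, hkl, h.symm⟩
  exact ⟨node k, node l ++ [true], ⟨List.replicate l false ++ [true], by simp [node]⟩,
    separated hkl, ((sameQF_iff_atoms_eq hM hM).2 h).symm⟩

theorem exists_separated_sequence (hM : IsSelectorModel M) {K : Type*} [Finite K]
    (a : List Bool → K → M) : ∃ κ σ : ℕ → List Bool, (∀ i j, i ≤ j → σ i <+: σ j) ∧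
      (∀ i, κ i ++ [false] <+: σ i) ∧
      ∀ i, SameQF (Sum.elim (past (a ∘ σ) (fun i => a (κ i ++ [true])) i) (a (σ i)))
        (Sum.elim (past (a ∘ σ) (fun i => a (κ i ++ [true])) i) (a (κ i ++ [true]))) := by
  choose κ' σ' h_prefix h_sep h_type using fun (F : Finset (List Bool)) (η : List Bool) =>
    exists_separated_pair hM a (fun p : F × K => a p.1 p.2) η
  let state : ℕ → Finset (List Bool) × List Bool := Nat.rec (∅, []) fun _ s =>
    (s.1 ∪ {σ' s.1 s.2, κ' s.1 s.2 ++ [true]}, σ' s.1 s.2)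
  let κ (i) := κ' (state i).1 (state i).2
  let σ (i) := σ' (state i).1 (state i).2
  have mem_state {k i : ℕ} (h : k < i) : {σ k, κ k ++ [true]} ⊆ (state i).1 := by
    induction h with
    | refl => exact Finset.subset_union_right
    | step _ ih => exact ih.trans Finset.subset_union_left
  refine ⟨κ, σ, fun i j hij => ?_, fun i => h_sep _ _, fun i => ?_⟩
  · induction hij with
    | refl => exact List.prefix_rfl
    | step _ ih => exact ih.trans (h_prefix _ _)
  · obtain ⟨R, hR, hRa⟩ := h_type (state i).1 (state i).2
    refine ⟨R, hR, ?_⟩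
    rintro (⟨k, _ | _, b⟩ | b)
    · exact hRa (.inl (⟨σ k, mem_state k.2 (by simp)⟩, b))
    · exact hRa (.inl (⟨κ k ++ [true], mem_state k.2 (by simp)⟩, b))
    · exact hRa (.inr b)

theorem nsop₁ : ForkDiv.NSOP₁.{u} selectorTheory := by
  rintro M _ _ _ m n φ ⟨a, consistent, inconsistent⟩
  obtain ⟨κ, σ, σ_mono, hκσ, hσ⟩ := exists_separated_sequence (isSelectorModel_of_model M) a
  let N := stabilityBound (Fin m) (Fin n)
  obtain ⟨d, hd⟩ := consistent (fun t => (σ N).getD t false)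
    ((Finset.range N).image fun i => (σ i).length)
  have hd' : ∀ i < N, φ.Realize (Sum.elim d (a (σ i))) := fun i hi => by
    rw [← map_range_getD_of_prefix (σ_mono i N hi.le) false]
    exact hd _ (Finset.mem_image_of_mem _ (Finset.mem_range.2 hi))
  obtain ⟨i, j, hij, x, hx, hx'⟩ := exists_common_realization hσ hd'
  exact inconsistent (κ i) (σ j) ((hκσ i).trans (σ_mono i j hij.le)) ⟨x, hx', hx⟩

end NSOP₁

end Selector

namespace ForkDiv

variable {L : FirstOrder.Language.{0, 0}} {T : L.Theory} {n : ℕ}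

theorem HasSOP₃.exists_chain {M : Type u} [L.Structure M] [Nonempty M] [M ⊨ T]
    {φ : L.Formula (Fin n ⊕ Fin n)} (h : HasSOP₃ M φ) (ι : Type) [LinearOrder ι] :
    ∃ (N : Type u) (_ : L.Structure N) (_ : Nonempty N), N ⊨ T ∧
      (∃ a : ι → Fin n → N, ∀ i j, i < j → φ.Realize (Sum.elim (a i) (a j))) ∧
      ¬ ∃ x y z : Fin n → N, φ.Realize (Sum.elim x y) ∧ φ.Realize (Sum.elim y z) ∧
        φ.Realize (Sum.elim z x) := by
  obtain ⟨⟨a, ha⟩, acyclic⟩ := h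
  let U : Ultrafilter (Finset ι) := Ultrafilter.of Filter.atTop
  let N := (U : Filter (Finset ι)).Product fun _ => M
  have los (x y : Fin n → Finset ι → M) :
      φ.Realize (Sum.elim (fun k => (x k : N)) fun k => (y k : N)) ↔
        ∀ᶠ I in U, φ.Realize (Sum.elim (fun k => x k I) fun k => y k I) := by
    have := Ultraproduct.realize_formula_cast (u := U) φ (Sum.elim x y)
    convert! this using 4 with k I
    · cases k <;> rfl
    · exact funext fun k => by cases k <;> rfl
  let rank (i : ι) (I : Finset ι) : ℕ := (I.filter (· < i)).card
  have rank_lt {i j : ι} (hij : i < j) {I : Finset ι} (hi : {i} ⊆ I) : rank i I < rank j I := by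
    refine Finset.card_lt_card ((Finset.ssubset_iff_of_subset ?_).2 ⟨i, ?_, ?_⟩)
    · exact Finset.monotone_filter_right I fun _ _ h => lt_trans h hij
    · exact Finset.mem_filter.2 ⟨Finset.singleton_subset_iff.1 hi, hij⟩
    · exact fun h => lt_irrefl i (Finset.mem_filter.1 h).2
  refine ⟨N, inferInstance, inferInstance, ⟨fun ψ hψ => ?_⟩,
    ⟨fun i k => ((fun I => a (rank i I) k : Finset ι → M) : N), fun i j hij => ?_⟩, ?_⟩
  · exact (Ultraproduct.sentence_realize ψ).2 <|
      .of_forall fun _ => Theory.realize_sentence_of_mem T hψ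
  · have large : ∀ᶠ I : Finset ι in U, {i} ⊆ I :=
      Ultrafilter.of_le _ (Filter.eventually_ge_atTop ({i} : Finset ι))
    exact (los _ _).2 (large.mono fun I hI => ha _ _ (rank_lt hij hI))
  · rintro ⟨x, y, z, hxy, hyz, hzx⟩
    have exists_lift (x : Fin n → N) : ∃ x' : Fin n → Finset ι → M, (fun k => (x' k : N)) = x :=
      ⟨fun k => (x k).out, funext fun k => (x k).out_eq⟩
    obtain ⟨x, rfl⟩ := exists_lift x
    obtain ⟨y, rfl⟩ := exists_lift y
    obtain ⟨z, rfl⟩ := exists_lift z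
    obtain ⟨I, hI⟩ := (((los _ _).1 hxy).and (((los _ _).1 hyz).and ((los _ _).1 hzx))).exists
    exact acyclic ⟨_, _, _, hI⟩

/-- The endpoints of the interval attached to a node of the binary tree: the two children of a node
get the outer thirds of its interval. -/
def interval (η : List Bool) : ℚ × ℚ :=
  η.foldl (fun I b => if b then ((I.1 + 2 * I.2) / 3, I.2) else (I.1, (2 * I.1 + I.2) / 3)) (0, 1)

theorem interval_append_false (η : List Bool) : interval (η ++ [false]) =
    ((interval η).1, (2 * (interval η).1 + (interval η).2) / 3) := by
  simp [interval]

theorem interval_append_true (η : List Bool) : interval (η ++ [true]) =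
    (((interval η).1 + 2 * (interval η).2) / 3, (interval η).2) := by
  simp [interval]

theorem interval_fst_lt_snd (η : List Bool) : (interval η).1 < (interval η).2 := by
  induction η using List.reverseRecOn with
  | nil => norm_num [interval]
  | append_singleton η b ih =>
    cases b
    · rw [interval_append_false]; linarith
    · rw [interval_append_true]; linarith

theorem interval_mono {η ν : List Bool} (h : η <+: ν) :
    (interval η).1 ≤ (interval ν).1 ∧ (interval ν).2 ≤ (interval η).2 := by
  obtain ⟨ρ, rfl⟩ := h
  induction ρ using List.reverseRecOn with
  | nil => simp
  | append_singleton ρ b ih =>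
    have := interval_fst_lt_snd (η ++ ρ)
    rw [← List.append_assoc]
    cases b
    · rw [interval_append_false]; constructor <;> linarith [ih.1, ih.2]
    · rw [interval_append_true]; constructor <;> linarith [ih.1, ih.2]

/-- The formula `φ(y₁; x) ∧ φ(x; y₂)` in `x; y₁y₂`. -/
noncomputable def between (φ : L.Formula (Fin n ⊕ Fin n)) : L.Formula (Fin n ⊕ Fin (n + n)) :=
  φ.relabel (Sum.elim (Sum.inr ∘ Fin.castAdd n) Sum.inl) ⊓
    φ.relabel (Sum.elim Sum.inl (Sum.inr ∘ Fin.natAdd n))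

theorem realize_between {M : Type*} [L.Structure M] {φ : L.Formula (Fin n ⊕ Fin n)}
    {x y₁ y₂ : Fin n → M} : (between φ).Realize (Sum.elim x (Fin.append y₁ y₂)) ↔
      φ.Realize (Sum.elim y₁ x) ∧ φ.Realize (Sum.elim x y₂) := by
  rw [between, Formula.realize_inf, Formula.realize_relabel, Formula.realize_relabel]
  refine and_congr (iff_of_eq (congrArg _ ?_)) (iff_of_eq (congrArg _ ?_)) <;>
    (funext i; rcases i with i | i <;> simp [-Fin.natAdd_eq_addNat])

theorem NSOP₁.nsop₃ (hT : NSOP₁.{u} T) : NSOP₃.{u} T := by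
  intro M _ _ _ n φ h
  obtain ⟨N, _, _, hN, ⟨a, ha⟩, acyclic⟩ := h.exists_chain (T := T) ℚ
  refine hT N n (n + n) (between φ)
    ⟨fun η => Fin.append (a (interval η).1) (a (interval η).2), fun η I => ?_, ?_⟩
  · let ν := (List.range (I.sup id)).map η
    obtain ⟨q, hq⟩ := exists_between (interval_fst_lt_snd ν)
    refine ⟨a q, fun k hk => realize_between.2 ?_⟩
    have range_prefix : List.range k <+: List.range (I.sup id) := by
      rw [← Nat.add_sub_cancel' (Finset.le_sup (f := id) hk), List.range_add]
      exact List.prefix_append _ _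
    have hν := interval_mono (range_prefix.map η)
    exact ⟨ha _ _ (hν.1.trans_lt hq.1), ha _ _ (hq.2.trans_le hν.2)⟩
  · rintro η ν hν ⟨x, hx, hx'⟩
    have lt : (interval ν).2 < (interval (η ++ [true])).1 := by
      have := (interval_mono hν).2
      rw [interval_append_false] at this
      rw [interval_append_true]
      linarith [interval_fst_lt_snd η]
    exact acyclic ⟨x, _, _, (realize_between.1 hx).2, ha _ _ lt, (realize_between.1 hx').1⟩

end ForkDiv

namespace Selector

section Functoriality

theorem IsPartIso.map {N N' W W' : Type*} [selLang.Structure N] [selLang.Structure N']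
    [selLang.Structure W] [selLang.Structure W'] {R : N → N' → Prop} (hR : IsPartIso R)
    (ι : N ↪[selLang] W) (ι' : N' ↪[selLang] W') : IsPartIso (Relation.Map R ι ι') where
  eq_iff := by
    rintro _ _ _ _ ⟨x, x', hx, rfl, rfl⟩ ⟨y, y', hy, rfl, rfl⟩
    rw [ι.injective.eq_iff, ι'.injective.eq_iff, hR.eq_iff hx hy]
  eqRel_iff := by
    rintro _ _ _ _ ⟨x, x', hx, rfl, rfl⟩ ⟨y, y', hy, rfl, rfl⟩
    rw [eqRel_map, eqRel_map, hR.eqRel_iff hx hy]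
  eval := by
    rintro _ _ _ _ ⟨x, x', hx, rfl, rfl⟩ ⟨y, y', hy, rfl, rfl⟩
    exact ⟨_, _, hR.eval hx hy, (evalAt_map ι x y).symm, (evalAt_map ι' x' y').symm⟩

variable {N P N' P' : Type*} {H : P → N → Prop} {H' : P' → N' → Prop} {S : P → P' → Prop}
  {R : N → N' → Prop}

/-- Each pair in `H` is matched with a pair in `H'`, componentwise along `S` and `R`. -/
def Covers (S : P → P' → Prop) (R : N → N' → Prop) (H : P → N → Prop) (H' : P' → N' → Prop) :
    Prop :=
  ∀ p n, H p n → ∃ p' n', H' p' n' ∧ S p p' ∧ R n n'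

namespace Covers

theorem swap (h : Covers S R H H') : Covers R S (flip H) (flip H') := fun n p hpn =>
  let ⟨p', n', hpn', hp, hn⟩ := h p n hpn
  ⟨n', p', hpn', hn, hp⟩

variable [selLang.Structure P] [selLang.Structure P']

theorem exists_of_left (h : Covers S R H H') (hS : IsPartIso S) {p : P} {p' : P'} {n : N}
    (hp : S p p') (hpn : H p n) : ∃ n', H' p' n' ∧ R n n' := by
  obtain ⟨q, n', hqn', hq, hn⟩ := h p n hpn
  obtain rfl := (hS.eq_iff hp hq).1 rfl
  exact ⟨n', hqn', hn⟩

variable [selLang.Structure N] [selLang.Structure N']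

theorem apply (h : Covers S R H H') (hS : IsPartIso S) (hR : IsPartIso R) {p : P} {p' : P'} {n : N}
    {n' : N'} (hp : S p p') (hn : R n n') (hpn : H p n) : H' p' n' := by
  obtain ⟨m, hpm, hm⟩ := h.exists_of_left hS hp hpn
  obtain rfl := (hR.eq_iff hn hm).1 rfl
  exact hpm

theorem linked (h : Covers S R H H') (hS : IsPartIso S) (hR : IsPartIso R) {p : P} {p' : P'} {n : N}
    {n' : N'} (hp : S p p') (hn : R n n') : Linked H p n → Linked H' p' n' := by
  rintro ⟨q, m, hqm, hpq, hmn⟩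
  obtain ⟨q', m', hqm', hq, hm⟩ := h q m hqm
  exact ⟨q', m', hqm', (hS.eqRel_iff hp hq).1 hpq, (hR.eqRel_iff hm hn).1 hmn⟩

end Covers

variable [selLang.Structure N] [selLang.Structure P] [selLang.Structure N'] [selLang.Structure P']
  {W W' : Type*} [selLang.Structure W] [selLang.Structure W'] {α : P → N → N} {β : N → P → P}
  {α' : P' → N' → N'} {β' : N' → P' → P'} {ι : N ↪[selLang] W} {τ : P ↪[selLang] W}
  {ι' : N' ↪[selLang] W'} {τ' : P' ↪[selLang] W'}

theorem IsAmalgam.comp_embedding (hA : IsAmalgam H α β ι τ) (g : W ↪[selLang] W') :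
    IsAmalgam H α β (g.comp ι) (g.comp τ) where
  eq_iff := g.injective.eq_iff.trans hA.eq_iff
  eqRel_iff := (eqRel_map g).trans hA.eqRel_iff
  eval_left := fun hf hy hfH hyH =>
    (evalAt_map g _ _).trans (congrArg g (hA.eval_left hf hy hfH hyH))
  eval_right := fun hg hx hgH hxH =>
    (evalAt_map g _ _).trans (congrArg g (hA.eval_right hg hx hgH hxH))

theorem IsAmalgam.map_evalAt (hW : IsSelectorModel W) (hW' : IsSelectorModel W')
    (hA : IsAmalgam H α β ι τ) (hA' : IsAmalgam H' α' β' ι' τ') (hS : IsPartIso S)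
    (hR : IsPartIso R) (hH : Covers S R H H') (hH' : Covers (flip S) (flip R) H' H)
    (hα : ∀ f f' y y', S f f' → R y y' → ¬ IsObj f → IsObj y → R (α f y) (α' f' y'))
    {f : P} {f' : P'} {y : N} {y' : N'} (hf : S f f') (hy : R y y') :
    Relation.Map R ι ι' (evalAt (τ f) (ι y)) (evalAt (τ' f') (ι' y')) ∨
      Relation.Map S τ τ' (evalAt (τ f) (ι y)) (evalAt (τ' f') (ι' y')) := by
  obtain ⟨hN, hP⟩ := And.intro (hW.of_embedding ι) (hW.of_embedding τ)
  obtain ⟨hN', hP'⟩ := And.intro (hW'.of_embedding ι') (hW'.of_embedding τ')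
  have hιy : Relation.Map R ι ι' (ι y) (ι' y') := ⟨y, y', hy, rfl, rfl⟩
  by_cases hfO : IsObj f
  · rw [hW.evalAt_of_isObj ((isObj_map τ).2 hfO),
      hW'.evalAt_of_isObj ((isObj_map τ').2 ((hS.isObj_iff hP hP' hf).1 hfO))]
    exact .inl hιy
  have hfO' : ¬ IsObj f' := (hS.isObj_iff hP hP' hf).not.1 hfO
  by_cases hyO : IsObj y
  swap
  · rw [hW.evalAt_of_not_isObj ((isObj_map ι).not.2 hyO),
      hW'.evalAt_of_not_isObj ((isObj_map ι').not.2 ((hR.isObj_iff hN hN' hy).not.1 hyO))]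
    exact .inl hιy
  by_cases matched : ∃ n, H f n
  · obtain ⟨n, hfn⟩ := matched
    obtain ⟨n', hfn', hn⟩ := hH.exists_of_left hS hf hfn
    rw [hA.eq_iff.2 hfn, hA'.eq_iff.2 hfn']
    exact .inl ((hR.map ι ι').eval ⟨n, n', hn, rfl, rfl⟩ hιy)
  by_cases linked : ∃ p n, H p n ∧ EqRel n y
  · obtain ⟨p, n, hpn, hny⟩ := linked
    obtain ⟨p', n', hpn', hp, hn⟩ := hH p n hpn
    have hny' : EqRel n' y' := (hR.eqRel_iff hn hy).1 hny
    rw [← hW.evalAt_congr ((isObj_map τ).not.2 hfO) ((eqRel_map ι).2 hny), ← hA.eq_iff.2 hpn,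
      ← hW'.evalAt_congr ((isObj_map τ').not.2 hfO') ((eqRel_map ι').2 hny'), ← hA'.eq_iff.2 hpn']
    exact .inr ((hS.map τ τ').eval ⟨f, f', hf, rfl, rfl⟩ ⟨p, p', hp, rfl, rfl⟩)
  have matched' : ∀ n', ¬ H' f' n' := fun n' h =>
    matched ((hH'.exists_of_left hS.swap hf h).imp fun n h => h.1)
  have linked' : ∀ p', ¬ Linked H' p' y' := fun p' ⟨q', n', hqn', _, hny'⟩ =>
    let ⟨q, n, hqn, _, hn⟩ := hH' q' n' hqn'
    linked ⟨q, n, hqn, (hR.eqRel_iff hn hy).2 hny'⟩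
  rw [hA.eval_left hfO hyO (not_exists.1 matched) fun p ⟨q, n, hqn, _, hny⟩ =>
    linked ⟨q, n, hqn, hny⟩, hA'.eval_left hfO' ((hR.isObj_iff hN hN' hy).1 hyO) matched' linked']
  exact .inl ⟨_, _, hα f f' y y' hf hy hfO hyO, rfl, rfl⟩

theorem IsAmalgam.isPartIso_map (hW : IsSelectorModel W) (hW' : IsSelectorModel W')
    (hA : IsAmalgam H α β ι τ) (hA' : IsAmalgam H' α' β' ι' τ') (hS : IsPartIso S)
    (hR : IsPartIso R) (hH : Covers S R H H') (hH' : Covers (flip S) (flip R) H' H)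
    (hα : ∀ f f' y y', S f f' → R y y' → ¬ IsObj f → IsObj y → R (α f y) (α' f' y'))
    (hβ : ∀ g g' x x', R g g' → S x x' → ¬ IsObj g → IsObj x → S (β g x) (β' g' x')) :
    IsPartIso fun w w' => Relation.Map R ι ι' w w' ∨ Relation.Map S τ τ' w w' := by
  refine (hR.map ι ι').union hW hW' (hS.map τ τ') ?_ ?_ ?_ ?_
  · rintro _ _ _ _ ⟨n, n', hn, rfl, rfl⟩ ⟨p, p', hp, rfl, rfl⟩
    rw [eq_comm, hA.eq_iff, eq_comm, hA'.eq_iff]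
    exact ⟨hH.apply hS hR hp hn, hH'.apply hS.swap hR.swap hp hn⟩
  · rintro _ _ _ _ ⟨n, n', hn, rfl, rfl⟩ ⟨p, p', hp, rfl, rfl⟩
    rw [hW.eqRel_comm, hA.eqRel_iff, hW'.eqRel_comm, hA'.eqRel_iff]
    exact ⟨hH.linked hS hR hp hn, hH'.linked hS.swap hR.swap hp hn⟩
  · rintro _ _ _ _ ⟨g, g', hg, rfl, rfl⟩ ⟨x, x', hx, rfl, rfl⟩
    exact ((hA.swap hW).map_evalAt hW hW' (hA'.swap hW') hR hS hH.swap hH'.swap hβ hg hx).symm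
  · rintro _ _ _ _ ⟨y, y', hy, rfl, rfl⟩ ⟨f, f', hf, rfl, rfl⟩
    exact hA.map_evalAt hW hW' hA' hS hR hH hH' hα hf hy

end Functoriality

end Selector

section Dividing

variable {L : FirstOrder.Language.{0, 0}} {M : Type u} [L.Structure M] {A : Set M} {n k : ℕ}
  {φ ψ : L.Formula (Fin n ⊕ Fin k)}

theorem ForkDiv.Divides.of_isIndiscernible {s : ℕ → Fin k → M}
    (hs : ForkDiv.IsIndiscernible (L := L) A s)
    (I : Finset ℕ) (hφ : ¬ ∃ x : Fin n → M, ∀ i ∈ I, φ.Realize (Sum.elim x (s i))) :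
    ForkDiv.Divides A φ (s 0) := by
  refine ⟨M, inferInstance, .refl L M, s, rfl, ?_, I, hφ⟩
  rwa [show ⇑(ElementaryEmbedding.refl L M) = id from rfl, Set.image_id]

theorem ForkDiv.Divides.forks_sup {b : Fin k → M} (hφ : ForkDiv.Divides A φ b)
    (hψ : ForkDiv.Divides A ψ b) : ForkDiv.Forks A (φ ⊔ ψ) b := by
  refine ⟨M, inferInstance, .refl L M, 2, fun _ => k, ![φ, ψ], fun _ => b, ?_, fun x hx => ?_⟩
  · rw [show ⇑(ElementaryEmbedding.refl L M) = id from rfl, Set.image_id, Fin.forall_fin_two]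
    exact ⟨hφ, hψ⟩
  · exact Fin.exists_fin_two.2 (Formula.realize_sup.1 hx)

end Dividing

namespace Selector

section TypesOverSets

variable {M : Type u} [selLang.Structure M] {A : Set M}

theorem forall_realize_iff_sameQF [M ⊨ selectorTheory] {J : Type*} {v w : J → M} :
    (∀ φ : selLang[[A]].Formula J, φ.Realize v ↔ φ.Realize w) ↔
      SameQF (Sum.elim ((↑) : A → M) v) (Sum.elim (↑) w) := by
  have hM := isSelectorModel_of_model M
  have realize_iff (u : J → M) (φ : selLang[[A]].Formula J) :
      Formula.Realize (BoundedFormula.constantsVarsEquiv φ) (Sum.elim ((↑) : A → M) u) ↔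
        φ.Realize u := by
    refine Iff.trans ?_ BoundedFormula.realize_constantsVarsEquiv
    simp only [coe_con]
    rfl
  constructor
  · refine fun h => (sameQF_iff_atoms_eq hM hM).2 (Set.ext fun a => ?_)
    have ha := h (BoundedFormula.constantsVarsEquiv.symm (atomFormula a))
    rwa [← realize_iff, ← realize_iff, Equiv.apply_symm_apply, realize_atomFormula,
      realize_atomFormula] at ha
  · intro h φ
    rw [← realize_iff, ← realize_iff]
    exact h.realize_iff _

variable {k : ℕ} {s : ℕ → Fin k → M}

theorem isIndiscernible_iff_sameQF [M ⊨ selectorTheory] :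
    ForkDiv.IsIndiscernible (L := selLang) A s ↔
      ∀ (r : ℕ) (i j : Fin r → ℕ), StrictMono i → StrictMono j →
        SameQF (Sum.elim ((↑) : A → M) fun p : Fin r × Fin k => s (i p.1) p.2)
          (Sum.elim (↑) fun p : Fin r × Fin k => s (j p.1) p.2) :=
  ⟨fun h r i j hi hj => forall_realize_iff_sameQF.1 fun φ => h r φ i j hi hj,
    fun h r φ i j hi hj => forall_realize_iff_sameQF.2 (h r i j hi hj) φ⟩

theorem isIndiscernible_range_of_sameQF [M ⊨ selectorTheory] {J : Type*} {e : J → M} {s : ℕ → M}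
    (hs : ∀ (r : ℕ) (i j : Fin r → ℕ), StrictMono i → StrictMono j →
      SameQF (Sum.elim e fun a => s (i a)) (Sum.elim e fun a => s (j a))) :
    ForkDiv.IsIndiscernible (L := selLang) (Set.range e) fun m (_ : Fin 1) => s m := by
  refine isIndiscernible_iff_sameQF.2 fun r i j hi hj => ?_
  choose g hg using fun x : Set.range e => x.2
  convert (hs r i j hi hj).comp (Sum.map g Prod.fst : _ ⊕ Fin r × Fin 1 → J ⊕ Fin r) using 1 <;>
    ext (x | p) <;> simp [hg]

variable [M ⊨ selectorTheory] (hs : ForkDiv.IsIndiscernible (L := selLang) A s)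
include hs

theorem eqRel_iff_of_isIndiscernible {i j i' j' : ℕ} (hij : i < j) (hij' : i' < j') (a : Fin k) :
    EqRel (s i a) (s j a) ↔ EqRel (s i' a) (s j' a) := by
  have strictMono {i j : ℕ} (hij : i < j) : StrictMono ![i, j] :=
    Fin.strictMono_iff_lt_succ.2 fun x => by fin_cases x; exact hij
  obtain ⟨R, hR, h⟩ := isIndiscernible_iff_sameQF.1 hs 2 _ _ (strictMono hij) (strictMono hij')
  exact hR.eqRel_iff (h (.inr (0, a))) (h (.inr (1, a)))

theorem isObj_iff_of_isIndiscernible (i j : ℕ) (a : Fin k) : IsObj (s i a) ↔ IsObj (s j a) := by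
  have hM := isSelectorModel_of_model M
  obtain ⟨R, hR, h⟩ := isIndiscernible_iff_sameQF.1 hs 1 (fun _ => i) (fun _ => j)
    (Subsingleton.strictMono _) (Subsingleton.strictMono _)
  exact hR.isObj_iff hM hM (h (.inr (0, a)))

end TypesOverSets

section NotDividing

/-- The formula `x ∈ F ∧ eval(x, z) = z`. -/
def selectsFormula : selLang.Formula (Fin 1 ⊕ Fin 1) :=
  (atomFormula (.inl (.inl 0, .inl 0))).not ⊓
    atomFormula (.inr (.inr (.inl 0, .inr 0), .inl (.inr 0)))

/-- The formula `E(x, z)`. -/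
def sameClassFormula : selLang.Formula (Fin 1 ⊕ Fin 1) :=
  atomFormula (.inl (.inl 0, .inr 0))

variable {M : Type u} [selLang.Structure M] [M ⊨ selectorTheory]

theorem realize_selectsFormula {x z : Fin 1 → M} :
    selectsFormula.Realize (Sum.elim x z) ↔ ¬ IsObj (x 0) ∧ evalAt (x 0) (z 0) = z 0 := by
  rw [selectsFormula, Formula.realize_inf, Formula.realize_not, realize_atomFormula,
    realize_atomFormula, (isSelectorModel_of_model M).isObj_iff_eqRel_self]
  rfl

omit [M ⊨ selectorTheory] in
theorem realize_sameClassFormula {x z : Fin 1 → M} :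
    sameClassFormula.Realize (Sum.elim x z) ↔ EqRel (x 0) (z 0) := by
  rw [sameClassFormula, realize_atomFormula]
  rfl

theorem exists_evalAt_eq_self {D : Set M} (hD : D.Finite)
    (hDD : ∀ x ∈ D, ∀ y ∈ D, EqRel x y → x = y) :
    ∃ f : M, ∀ x ∈ D, ¬ IsObj f ∧ evalAt f x = x := by
  have hM := isSelectorModel_of_model M
  obtain ⟨σ, hσ, hσD⟩ := exists_isSelector_fixing hM hDD
  obtain ⟨_, hU, hstar⟩ := exists_isSelectorModel_unit
  obtain ⟨W, _, ι, τ, hW, -, hA⟩ := exists_isAmalgam (α := fun (_ : Unit) => σ)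
    (β := fun (_ : M) => id) hU hM isPartIso_false (fun _ _ => hσ)
    (fun _ _ => ⟨hU.refl, fun _ _ _ => rfl⟩)
  have hτ : ¬ IsObj (τ ()) := (isObj_map τ).not.2 hstar
  have evalAt_τ (d : M) (hd : d ∈ D) : evalAt (τ ()) (ι d) = ι d := by
    by_cases hdO : IsObj d
    · rw [hA.eval_left hstar hdO (fun _ => id) fun _ ⟨_, _, h, _⟩ => h, hσD d hd hdO]
    · exact hW.evalAt_of_not_isObj ((isObj_map ι).not.2 hdO)
  obtain ⟨N, _, _, ⟨g⟩⟩ := exists_embedding_model hW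
  have : Finite D := hD
  obtain ⟨x, hx⟩ := exists_realize_of_elementary (toElementary (g.comp ι)) selectsFormula
    (fun (d : D) (_ : Fin 1) => (d : M)) ⟨fun _ => g (τ ()), fun d => realize_selectsFormula.2
      ⟨(isObj_map g).not.2 hτ, (evalAt_map g _ _).trans (congrArg g (evalAt_τ d d.2))⟩⟩
  exact ⟨x 0, fun d hd => realize_selectsFormula.1 (hx ⟨d, hd⟩)⟩

theorem not_divides_sup {A : Set M} {b : Fin 1 → M} (hb : IsObj (b 0)) :
    ¬ ForkDiv.Divides A (selectsFormula ⊔ sameClassFormula) b := by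
  rintro ⟨N, _, e, s, hs, hi, I, hI⟩
  have : N ⊨ selectorTheory := e.elementarilyEquivalent.theory_model
  have hN := isSelectorModel_of_model N
  have hobj (i : ℕ) : IsObj (s i 0) := by
    rw [isObj_iff_of_isIndiscernible hi i 0, hs]
    exact (isObj_map e).2 hb
  refine hI ?_
  by_cases hE : EqRel (s 0 0) (s 1 0)
  · refine ⟨s 0, fun i _ => Formula.realize_sup.2 (.inr (realize_sameClassFormula.2 ?_))⟩
    rcases i.eq_zero_or_pos with rfl | hpos
    · exact hN.refl _ (hobj 0)
    · exact (eqRel_iff_of_isIndiscernible hi hpos Nat.zero_lt_one 0).2 hE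
  · have ne_of_lt {i j : ℕ} (hij : i < j) : ¬ EqRel (s i 0) (s j 0) :=
      (eqRel_iff_of_isIndiscernible hi hij Nat.zero_lt_one 0).not.2 hE
    obtain ⟨f, hf⟩ := exists_evalAt_eq_self (I.finite_toSet.image fun i => s i 0) <| by
      rintro _ ⟨i, -, rfl⟩ _ ⟨j, -, rfl⟩ hij
      rcases lt_trichotomy i j with hlt | rfl | hlt
      · exact (ne_of_lt hlt hij).elim
      · rfl
      · exact (ne_of_lt hlt (hN.symm _ _ hij)).elim
    exact ⟨fun _ => f, fun i hiI => Formula.realize_sup.2 <| .inl <|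
      realize_selectsFormula.2 (hf _ ⟨i, hiI, rfl⟩)⟩

end NotDividing

section Grid

/-- The set of rows indexed by `X`, each of which consists of a base point and a copy of `Y`. It is
the model of `T₁` without functions whose `E`-classes are the rows. -/
def Grid (X Y : Type) : Type := X × Option Y

namespace Grid

variable {X Y X' Y' : Type}

instance : selLang.Structure (Grid X Y) :=
  structureOf (fun p q : X × Option Y => p.1 = q.1) fun _ q => q

theorem eqRel_iff {p q : Grid X Y} : EqRel p q ↔ p.1 = q.1 :=
  Iff.rfl

theorem isSelectorModel : IsSelectorModel (Grid X Y) :=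
  isSelectorModel_structureOf (rel := fun p q : X × Option Y => p.1 = q.1) (ev := fun _ q => q)
    (fun _ _ => Eq.symm) (fun _ _ _ => Eq.trans) (fun _ _ _ => id)
    (fun _ _ _ hf => (hf rfl).elim) fun _ _ _ => rfl

theorem isObj (p : Grid X Y) : IsObj p :=
  isSelectorModel.isObj_iff_eqRel_self.2 (eqRel_iff.2 rfl)

/-- The base point of the row of `p`. -/
def base (p : Grid X Y) : Grid X Y := (p.1, none)

theorem isSelector_base : IsSelector (base : Grid X Y → Grid X Y) where
  eqRel := fun _ _ => rfl
  congr := fun _ _ hpq => Prod.ext hpq rfl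

/-- The embedding of grids given by an injection of the rows and one of the columns. -/
def map (f : X → X') (g : Y → Y') (hf : f.Injective) (hg : g.Injective) :
    Grid X Y ↪[selLang] Grid X' Y' :=
  embeddingOf isSelectorModel isSelectorModel (Prod.map f (Option.map g))
    (hf.prodMap (Option.map_injective hg)) (fun _ _ => hf.eq_iff) fun p _ hp => (hp p.isObj).elim

end Grid

theorem exists_grid_amalgam (M : Type u) [selLang.Structure M] [M ⊨ selectorTheory] :
    ∃ (N : Type u) (_ : selLang.Structure N) (_ : N ⊨ selectorTheory) (e : M ↪[selLang] N)
      (t : Grid ℕ ℕ ↪[selLang] N),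
      IsAmalgam (fun _ _ => False) (fun _ => id) (fun _ => Grid.base) e t := by
  obtain ⟨W, _, ι, τ, hW, -, hA⟩ := exists_isAmalgam (α := fun (_ : Grid ℕ ℕ) => id)
    (β := fun (_ : M) => Grid.base) Grid.isSelectorModel (isSelectorModel_of_model M)
    isPartIso_false (fun p hp => (hp p.isObj).elim) (fun _ _ => Grid.isSelector_base)
  obtain ⟨N, _, hN, ⟨g⟩⟩ := exists_embedding_model hW
  exact ⟨N, inferInstance, hN, g.comp ι, g.comp τ, hA.comp_embedding g⟩

variable {M N : Type u} [selLang.Structure M] [selLang.Structure N] [N ⊨ selectorTheory]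
  {e : M ↪[selLang] N} {t : Grid ℕ ℕ ↪[selLang] N}
  (hA : IsAmalgam (fun _ _ => False) (fun _ => id) (fun _ => Grid.base) e t)
include hA

theorem sameQF_grid {X Y : Type} {f f' : X → ℕ} {g g' : Y → ℕ} (hf : f.Injective)
    (hf' : f'.Injective) (hg : g.Injective) (hg' : g'.Injective) :
    SameQF (Sum.elim e (t ∘ Grid.map f g hf hg)) (Sum.elim e (t ∘ Grid.map f' g' hf' hg')) := by
  have hN := isSelectorModel_of_model N
  have hS : IsPartIso fun p p' => ∃ q, Grid.map f g hf hg q = p ∧ Grid.map f' g' hf' hg' q = p' :=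
    (isPartIso_of_embedding (Grid.map f g hf hg)).swap.comp (isPartIso_of_embedding _)
  refine ⟨_, hA.isPartIso_map hN hN hA hS (isPartIso_of_embedding (.refl selLang M))
    (fun _ _ => False.elim) (fun _ _ => False.elim)
    (fun p _ _ _ _ _ hp => (hp p.isObj).elim) ?_, ?_⟩
  · rintro _ _ _ _ - ⟨q, rfl, rfl⟩ - -
    exact ⟨q.base, rfl, rfl⟩
  · rintro (m | q)
    · exact .inl ⟨m, m, rfl, rfl, rfl⟩
    · exact .inr ⟨_, _, ⟨q, rfl, rfl⟩, rfl, rfl⟩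

theorem isIndiscernible_grid_row :
    ForkDiv.IsIndiscernible (L := selLang) (Set.range e) fun m (_ : Fin 1) => t (0, some m) := by
  refine isIndiscernible_range_of_sameQF fun r i j hi hj => ?_
  let zero (_ : Unit) : ℕ := 0
  have zero_inj : zero.Injective := fun _ _ _ => rfl
  convert (sameQF_grid hA zero_inj zero_inj hi.injective hj.injective).comp
    (Sum.map id fun a => (((), some a) : Unit × Option (Fin r))) using 1 <;>
    ext (x | p) <;> rfl

theorem isIndiscernible_grid_column :
    ForkDiv.IsIndiscernible (L := selLang) (Set.range e) fun m (_ : Fin 1) => t (m, some 0) := by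
  refine isIndiscernible_range_of_sameQF fun r i j hi hj => ?_
  let zero (_ : Unit) : ℕ := 0
  have zero_inj : zero.Injective := fun _ _ _ => rfl
  convert (sameQF_grid hA hi.injective hj.injective zero_inj zero_inj).comp
    (Sum.map id fun a => ((a, some ()) : Fin r × Option Unit)) using 1 <;>
    ext (x | p) <;> rfl

theorem forks_grid :
    ForkDiv.Forks (Set.range e) (selectsFormula ⊔ sameClassFormula)
      fun _ : Fin 1 => t (0, some 0) := by
  have hN := isSelectorModel_of_model N
  refine ForkDiv.Divides.forks_sup
    (.of_isIndiscernible (isIndiscernible_grid_row hA) {0, 1} ?_)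
    (.of_isIndiscernible (isIndiscernible_grid_column hA) {0, 1} ?_)
  · rintro ⟨x, hx⟩
    obtain ⟨hf, h₀⟩ := realize_selectsFormula.1 (hx 0 (by simp))
    obtain ⟨-, h₁⟩ := realize_selectsFormula.1 (hx 1 (by simp))
    have same_row : EqRel (t (0, some 0)) (t (0, some 1)) := (eqRel_map t).2 rfl
    have h₀₁ : t (0, some 0) = t (0, some 1) :=
      h₀.symm.trans ((hN.evalAt_congr hf same_row).trans h₁)
    exact Nat.zero_ne_one (Option.some.inj (congrArg Prod.snd (t.injective h₀₁)))
  · rintro ⟨x, hx⟩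
    have h₀ := realize_sameClassFormula.1 (hx 0 (by simp))
    have h₁ := realize_sameClassFormula.1 (hx 1 (by simp))
    have same_row := (eqRel_map t).1 (hN.trans _ _ _ (hN.symm _ _ h₀) h₁)
    exact Nat.zero_ne_one (Grid.eqRel_iff.1 same_row)

omit hA in
theorem exists_forks_not_divides (M : Type u) [selLang.Structure M] [M ⊨ selectorTheory] :
    ∃ (N : Type u) (_ : selLang.Structure N) (e : M ↪ₑ[selLang] N) (b : Fin 1 → N),
      ForkDiv.Forks (Set.range e) (selectsFormula ⊔ sameClassFormula) b ∧
        ¬ ForkDiv.Divides (Set.range e) (selectsFormula ⊔ sameClassFormula) b := by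
  obtain ⟨N, _, _, e, t, hA⟩ := exists_grid_amalgam M
  exact ⟨N, inferInstance, toElementary e, fun _ => t (0, some 0), forks_grid hA,
    not_divides_sup ((isObj_map t).2 (Grid.isObj _))⟩

end Grid

end Selector

namespace ForkDiv

variable {L : FirstOrder.Language.{0, 0}} {M : Type u} [L.Structure M] {A : Set M} {n k : ℕ}

section Realizations

omit [L.Structure M] in
theorem realize_instantiate {Q : Type*} [L.Structure Q] [L[[M]].Structure Q]
    [(L.lhomWithConstants M).IsExpansionOn Q] {φ : L.Formula (Fin n ⊕ Fin k)} {b : Fin k → M}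
    {v : Fin n → Q} : (instantiate φ b).Realize v ↔
      φ.Realize (Sum.elim v fun a => ((L.con (b a) : L[[M]].Constants) : Q)) := by
  rw [instantiate, Formula.Realize, BoundedFormula.realize_subst, ← Formula.Realize,
    LHom.realize_onFormula]
  congr! with a
  rcases a with a | a
  · rfl
  · exact Term.realize_constants

theorem GlobalType.exists_realization (q : GlobalType L M n) :
    ∃ (Q : Type u) (_ : L.Structure Q) (ι : M ↪ₑ[L] Q) (a : Fin n → Q),
      ∀ {k : ℕ} (φ : L.Formula (Fin n ⊕ Fin k)) (b : Fin k → M),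
        q.Contains φ b ↔ φ.Realize (Sum.elim a (ι ∘ b)) := by
  obtain ⟨Q, a, rfl⟩ := Theory.exists_modelType_is_realized_in _ q
  let _ : L.Structure Q := (L.lhomWithConstants M).reduct Q
  have : (L.lhomWithConstants M).IsExpansionOn Q := LHom.isExpansionOn_reduct _ _
  exact ⟨Q, inferInstance, .ofModelsElementaryDiagram L M Q, a, fun φ b =>
    Theory.CompleteType.formula_mem_typeOf.trans realize_instantiate⟩

theorem TypeOver.exists_realization (p : TypeOver L M A n) :
    ∃ (P : Type u) (_ : L.Structure P) (j : A → P) (d : Fin n → P),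
      (∀ ψ : L.Formula A, ψ.Realize j ↔ ψ.Realize ((↑) : A → M)) ∧
      ∀ φ : L[[A]].Formula (Fin n), Formula.equivSentence φ ∈ p ↔
        Formula.Realize (BoundedFormula.constantsVarsEquiv φ) (Sum.elim j d) := by
  obtain ⟨P, d, rfl⟩ := Theory.exists_modelType_is_realized_in _ p
  let _ : L.Structure P := (L.lhomWithConstants A).reduct P
  have : (L.lhomWithConstants A).IsExpansionOn P := LHom.isExpansionOn_reduct _ _
  refine ⟨P, inferInstance, fun a => ((L.con a : L[[A]].Constants) : P), d, fun ψ => ?_, fun φ =>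
    Theory.CompleteType.formula_mem_typeOf.trans BoundedFormula.realize_constantsVarsEquiv.symm⟩
  exact (Formula.realize_equivSentence P ψ).symm.trans <|
    (realize_iff_of_model_completeTheory M P _).trans (Formula.realize_equivSentence M ψ)

variable {Q : Type u} [L.Structure Q] (ι : M ↪ₑ[L] Q) (a : Fin n → Q)

theorem models_elementaryDiagram :
    letI := constantsOn.structure ι
    Q ⊨ L.elementaryDiagram M :=
  letI := constantsOn.structure ι
  ⟨fun σ hσ => (Formula.realize_equivSentence_symm Q σ ι).1 <|
    (ι.map_formula (Formula.equivSentence.symm σ) id).2 <|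
      (Formula.realize_equivSentence_symm_con M σ).2 hσ⟩

/-- The global type of the tuple `a` of an elementary extension. -/
def globalTypeOf [Nonempty M] : GlobalType L M n :=
  letI := constantsOn.structure ι
  haveI := models_elementaryDiagram ι
  haveI : Nonempty Q := .map ι ‹_›
  Theory.typeOf (L.elementaryDiagram M) a

variable {ι a} [Nonempty M]

theorem contains_globalTypeOf {φ : L.Formula (Fin n ⊕ Fin k)} {b : Fin k → M} :
    (globalTypeOf ι a).Contains φ b ↔ φ.Realize (Sum.elim a (ι ∘ b)) :=
  letI := constantsOn.structure ι
  haveI := models_elementaryDiagram ι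
  haveI : Nonempty Q := .map ι ‹_›
  Theory.CompleteType.formula_mem_typeOf.trans realize_instantiate

theorem extends_globalTypeOf_iff {p : TypeOver L M A n} : Extends (globalTypeOf ι a) p ↔
    ∀ φ : L[[A]].Formula (Fin n), Formula.equivSentence φ ∈ p →
      Formula.Realize (BoundedFormula.constantsVarsEquiv φ) (Sum.elim (fun x : A => ι x) a) := by
  let _ : (constantsOn M).Structure Q := constantsOn.structure ι
  have := models_elementaryDiagram ι
  have : Nonempty Q := .map ι ‹_›
  let _ : (constantsOn A).Structure Q := constantsOn.structure fun x => ι x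
  have : (LHom.constantsOnMap ((↑) : A → M)).IsExpansionOn Q := constantsOnMap_isExpansionOn rfl
  have : (L.lhomWithConstantsMap ((↑) : A → M)).IsExpansionOn Q := LHom.sumMap_isExpansionOn _ _ _
  exact forall₂_congr fun φ _ => Theory.CompleteType.formula_mem_typeOf.trans <|
    (LHom.realize_onFormula _ _).trans BoundedFormula.realize_constantsVarsEquiv.symm

end Realizations

section InvariantSchemes

theorem IsIndiscernible.sameType {s : ℕ → Fin k → M} (hs : IsIndiscernible (L := L) A s)
    (i j : ℕ) : SameType L A (s i) (s j) := by
  intro ψ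
  have := hs 1 (ψ.relabel fun a => ((0 : Fin 1), a)) (fun _ => i) (fun _ => j)
    (Subsingleton.strictMono _) (Subsingleton.strictMono _)
  rwa [Formula.realize_relabel, Formula.realize_relabel] at this

/-- A choice `q` of global types over the elementary extensions of `M` is an `A`-invariant scheme if
its members are `A`-invariant and extend each other. It stands for an `A`-invariant type over a
monster model. -/
structure IsInvariantScheme (A : Set M)
    (q : ∀ (N : Type u) [L.Structure N], (M ↪ₑ[L] N) → GlobalType L N n) : Prop where
  invariant : ∀ (N : Type u) [L.Structure N] (e : M ↪ₑ[L] N), (q N e).Invariant (e '' A)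
  contains_comp : ∀ (N N' : Type u) [L.Structure N] [L.Structure N'] (e : M ↪ₑ[L] N)
    (f : N ↪ₑ[L] N') {k : ℕ} (φ : L.Formula (Fin n ⊕ Fin k)) (b : Fin k → N),
    (q N' (f.comp e)).Contains φ (f ∘ b) ↔ (q N e).Contains φ b

variable {q : ∀ (N : Type u) [L.Structure N], (M ↪ₑ[L] N) → GlobalType L N n}
  (hq : IsInvariantScheme A q) {N : Type u} [L.Structure N] {e : M ↪ₑ[L] N}
  {φ : L.Formula (Fin n ⊕ Fin k)} {b : Fin k → N}
include hq

namespace IsInvariantScheme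

theorem not_divides (hφ : (q N e).Contains φ b) : ¬ Divides (e '' A) φ b := by
  rintro ⟨N', _, f, s, hs, hind, I, hI⟩
  rw [Set.image_image] at hind
  have contains_zero : (q N' (f.comp e)).Contains φ (s 0) :=
    hs ▸ (hq.contains_comp N N' e f φ b).2 hφ
  have contains (m : ℕ) : (q N' (f.comp e)).Contains φ (s m) :=
    (hq.invariant N' (f.comp e) k φ _ _ (hind.sameType 0 m)).1 contains_zero
  obtain ⟨Q, _, ι, a, ha⟩ := (q N' (f.comp e)).exists_realization
  obtain ⟨x, hx⟩ := exists_realize_of_elementary ι (ι := I) φ (fun m => s m)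
    ⟨a, fun m => (ha φ _).1 (contains m)⟩
  exact hI ⟨x, fun m hm => hx ⟨m, hm⟩⟩

theorem not_forks (hφ : (q N e).Contains φ b) : ¬ Forks (e '' A) φ b := by
  rintro ⟨N', _, f, r, l, ψ, c, hdiv, himp⟩
  obtain ⟨Q, _, ι, a, ha⟩ := (q N' (f.comp e)).exists_realization
  have realize_φ : φ.Realize (Sum.elim a (ι ∘ f ∘ b)) :=
    (ha φ _).1 ((hq.contains_comp N N' e f φ b).2 hφ)
  have not_realize_ψ (m : Fin r) : ¬ (ψ m).Realize (Sum.elim a (ι ∘ c m)) := fun hm =>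
    hq.not_divides ((ha (ψ m) _).2 hm) (Set.image_image f e A ▸ hdiv m)
  let χ : L.Formula (Fin n ⊕ (Fin k ⊕ (m : Fin r) × Fin (l m))) :=
    φ.relabel (Sum.map id Sum.inl) ⊓
      Formula.iInf fun m => ((ψ m).relabel (Sum.map id fun a => .inr ⟨m, a⟩)).not
  have realize_χ {Z : Type u} [L.Structure Z] (x : Fin n → Z) (y : Fin k → Z)
      (z : ∀ m, Fin (l m) → Z) : χ.Realize (Sum.elim x (Sum.elim y fun p => z p.1 p.2)) ↔
        φ.Realize (Sum.elim x y) ∧ ∀ m, ¬ (ψ m).Realize (Sum.elim x (z m)) := by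
    rw [Formula.realize_inf, Formula.realize_relabel, Formula.realize_iInf]
    simp only [Formula.realize_not, Formula.realize_relabel, Sum.elim_comp_map, Function.comp_id,
      Sum.elim_comp_inl]
    rfl
  obtain ⟨x, hx⟩ := exists_realize_of_elementary ι (ι := Unit) χ
    (fun _ => Sum.elim (f ∘ b) fun p => c p.1 p.2) ⟨a, fun _ => by
      rw [Sum.comp_elim]
      exact (realize_χ a (ι ∘ f ∘ b) fun m => ι ∘ c m).2 ⟨realize_φ, not_realize_ψ⟩⟩
  obtain ⟨realize_φ', not_realize_ψ'⟩ := (realize_χ x (f ∘ b) c).1 (hx ())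
  obtain ⟨m, hm⟩ := himp x realize_φ'
  exact not_realize_ψ' m hm

end IsInvariantScheme

end InvariantSchemes

end ForkDiv

namespace Selector

section Doubling

variable {N N₁ : Type*} [selLang.Structure N] [selLang.Structure N₁]

/-- The selector `ν` of the extension `κ : N ↪ N₁` picks a new object from each class. -/
structure IsNewSelector (κ : N ↪[selLang] N₁) (ν : N₁ → N₁) : Prop extends IsSelector ν where
  ne : ∀ w z, ν w ≠ κ z

theorem exists_isNewSelector {N : Type u} [selLang.Structure N] (hN : IsSelectorModel N) :
    ∃ (N₁ : Type u) (_ : selLang.Structure N₁) (κ : N ↪[selLang] N₁) (ν : N₁ → N₁),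
      IsSelectorModel N₁ ∧ IsNewSelector κ ν := by
  obtain ⟨σ, hσ⟩ := exists_isSelector hN
  let π : N ⊕ N → N := Sum.elim id id
  have not_isObj {f : N} (hf : ¬ EqRel f f) : ¬ IsObj f := hN.isObj_iff_eqRel_self.not.2 hf
  obtain ⟨_, hN₁, eqRel_iff, eval_eq⟩ := exists_structure_extending
    (rel := fun w w' => EqRel (π w) (π w'))
    (S := fun f b c => IsObj (π b) ∧ c = .inl (evalAt (π f) (π b)))
    (fun _ _ => hN.symm _ _) (fun _ _ _ => hN.trans _ _ _)
    (fun f b c _ ⟨hb, hc⟩ => hc ▸ hN.eqRel_evalAt_self hb)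
    (fun f b c b' c' hf ⟨_, hc⟩ ⟨_, hc'⟩ hbb' =>
      hc.trans ((congrArg Sum.inl (hN.evalAt_congr (not_isObj hf) hbb')).trans hc'.symm))
  refine ⟨N ⊕ N, inferInstance, embeddingOf hN hN₁ Sum.inl Sum.inl_injective
    (fun x y => eqRel_iff (.inl x) (.inl y)) fun f b hf hb => ?_, fun w => .inr (σ (π w)), hN₁,
    ⟨fun w hw => ?_, fun w w' h => ?_⟩, fun w z => Sum.inr_ne_inl⟩
  · exact eval_eq (.inl f) (.inl b) _ (hN.isObj_iff_eqRel_self.not.1 hf) ⟨hb, rfl⟩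
  · refine (eqRel_iff _ w).2 (hσ.eqRel (π w) (hN.isObj_iff_eqRel_self.2 ?_))
    exact (eqRel_iff w w).1 (hN₁.refl w hw)
  · exact congrArg Sum.inr (hσ.congr _ _ ((eqRel_iff w w').1 h))

/-- The extension of a relation `R` between two models to the objects chosen by selectors of
extensions of these models. -/
def doubledRel {N' N₁' : Type*} [selLang.Structure N'] [selLang.Structure N₁'] (R : N → N' → Prop)
    (κ : N ↪[selLang] N₁) (ν : N₁ → N₁) (κ' : N' ↪[selLang] N₁') (ν' : N₁' → N₁')
    (w : N₁) (w' : N₁') : Prop :=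
  Relation.Map R κ κ' w w' ∨
    Relation.Map (fun y y' => IsObj y ∧ R y y') (ν ∘ κ) (ν' ∘ κ') w w'

variable {N' N₁' : Type*} [selLang.Structure N'] [selLang.Structure N₁'] {R : N → N' → Prop}
  {κ : N ↪[selLang] N₁} {ν : N₁ → N₁} {κ' : N' ↪[selLang] N₁'} {ν' : N₁' → N₁'}

namespace IsNewSelector

section Classes

variable (hN₁ : IsSelectorModel N₁) (hν : IsNewSelector κ ν) {x y : N}
include hN₁ hν

theorem isObj (hy : IsObj y) : IsObj (ν (κ y)) :=
  (hN₁.rel_obj _ _ (hν.eqRel _ ((isObj_map κ).2 hy))).1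

theorem eqRel_right_iff (hy : IsObj y) : EqRel (κ x) (ν (κ y)) ↔ EqRel x y :=
  (hN₁.eqRel_congr_right (hν.eqRel _ ((isObj_map κ).2 hy))).trans (eqRel_map κ)

theorem eqRel_iff (hx : IsObj x) (hy : IsObj y) : EqRel (ν (κ x)) (ν (κ y)) ↔ EqRel x y :=
  (hN₁.eqRel_congr_left (hν.eqRel _ ((isObj_map κ).2 hx))).trans (hν.eqRel_right_iff hN₁ hy)

theorem eq_iff (hx : IsObj x) (hy : IsObj y) : ν (κ x) = ν (κ y) ↔ EqRel x y := by
  refine ⟨fun h => (hν.eqRel_iff hN₁ hx hy).1 ?_, fun h => hν.congr _ _ ((eqRel_map κ).2 h)⟩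
  exact h ▸ hN₁.refl _ (hν.isObj hN₁ hx)

end Classes

variable (hN₁ : IsSelectorModel N₁) (hN₁' : IsSelectorModel N₁') (hν : IsNewSelector κ ν)
  (hν' : IsNewSelector κ' ν') (hR : IsPartIso R)
include hN₁ hN₁' hν hν' hR

theorem isPartIso_map_new :
    IsPartIso (Relation.Map (fun y y' => IsObj y ∧ R y y') (ν ∘ κ) (ν' ∘ κ')) := by
  have isObj' {y y'} (hy : IsObj y) (h : R y y') : IsObj y' :=
    (hR.isObj_iff (hN₁.of_embedding κ) (hN₁'.of_embedding κ') h).1 hy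
  constructor
  · rintro _ _ _ _ ⟨x, x', ⟨hx, hxx'⟩, rfl, rfl⟩ ⟨y, y', ⟨hy, hyy'⟩, rfl, rfl⟩
    exact (hν.eq_iff hN₁ hx hy).trans <| (hR.eqRel_iff hxx' hyy').trans
      (hν'.eq_iff hN₁' (isObj' hx hxx') (isObj' hy hyy')).symm
  · rintro _ _ _ _ ⟨x, x', ⟨hx, hxx'⟩, rfl, rfl⟩ ⟨y, y', ⟨hy, hyy'⟩, rfl, rfl⟩
    exact (hν.eqRel_iff hN₁ hx hy).trans <| (hR.eqRel_iff hxx' hyy').trans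
      (hν'.eqRel_iff hN₁' (isObj' hx hxx') (isObj' hy hyy')).symm
  · rintro _ _ _ _ ⟨x, x', ⟨hx, hxx'⟩, rfl, rfl⟩ hy
    rwa [Function.comp_apply, hN₁.evalAt_of_isObj (hν.isObj hN₁ hx), Function.comp_apply,
      hN₁'.evalAt_of_isObj (hν'.isObj hN₁' (isObj' hx hxx'))]

theorem isPartIso_doubledRel : IsPartIso (doubledRel R κ ν κ' ν') := by
  have hN := hN₁.of_embedding κ
  have hN' := hN₁'.of_embedding κ'
  refine (hR.map κ κ').union hN₁ hN₁' (hν.isPartIso_map_new hN₁ hN₁' hν' hR) ?_ ?_ ?_ ?_ <;>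
    rintro _ _ _ _ ⟨x, x', hxx', rfl, rfl⟩ ⟨y, y', ⟨hy, hyy'⟩, rfl, rfl⟩ <;>
    have hy' := (hR.isObj_iff hN hN' hyy').1 hy <;>
    simp only [Function.comp_apply]
  · exact iff_of_false (hν.ne _ _).symm (hν'.ne _ _).symm
  · rw [hν.eqRel_right_iff hN₁ hy, hν'.eqRel_right_iff hN₁' hy', hR.eqRel_iff hxx' hyy']
  · by_cases hx : IsObj x
    · have hx' := (hR.isObj_iff hN hN' hxx').1 hx
      rw [hN₁.evalAt_of_isObj ((isObj_map κ).2 hx), hN₁'.evalAt_of_isObj ((isObj_map κ').2 hx')]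
      exact .inr ⟨y, y', ⟨hy, hyy'⟩, rfl, rfl⟩
    · have hx' := (hR.isObj_iff hN hN' hxx').not.1 hx
      rw [hN₁.evalAt_congr ((isObj_map κ).not.2 hx) (hν.eqRel _ ((isObj_map κ).2 hy)),
        hN₁'.evalAt_congr ((isObj_map κ').not.2 hx') (hν'.eqRel _ ((isObj_map κ').2 hy')),
        evalAt_map, evalAt_map]
      exact .inl ⟨_, _, hR.eval hxx' hyy', rfl, rfl⟩
  · rw [hN₁.evalAt_of_isObj (hν.isObj hN₁ hy), hN₁'.evalAt_of_isObj (hν'.isObj hN₁' hy')]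
    exact .inl ⟨x, x', hxx', rfl, rfl⟩

theorem doubledRel_selector {w : N₁} {w' : N₁'} (h : doubledRel R κ ν κ' ν' w w')
    (hw : IsObj w) : doubledRel R κ ν κ' ν' (ν w) (ν' w') := by
  obtain ⟨y, y', hyy', rfl, rfl⟩ | ⟨y, y', ⟨hy, hyy'⟩, rfl, rfl⟩ := h
  · exact .inr ⟨y, y', ⟨(isObj_map κ).1 hw, hyy'⟩, rfl, rfl⟩
  · have hy' := (hR.isObj_iff (hN₁.of_embedding κ) (hN₁'.of_embedding κ') hyy').1 hy
    refine .inr ⟨y, y', ⟨hy, hyy'⟩, ?_, ?_⟩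
    · exact (hν.congr _ _ (hν.eqRel _ ((isObj_map κ).2 hy))).symm
    · exact (hν'.congr _ _ (hν'.eqRel _ ((isObj_map κ').2 hy'))).symm

end IsNewSelector

end Doubling

section FreeExtensions

variable {N N' P Q Q' : Type u} [selLang.Structure N] [selLang.Structure N'] [selLang.Structure P]
  [selLang.Structure Q] [selLang.Structure Q'] {A : Type*} {j : A → P} {i : A → N} {i' : A → N'}
  {ρ : P → P} {ι : N ↪[selLang] Q} {τ : P ↪[selLang] Q} {ι' : N' ↪[selLang] Q'}
  {τ' : P ↪[selLang] Q'}

/-- The embeddings `ι` and `τ` form a free amalgam of `N` and `P` over the substructures generated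
by `i` and `j`: outside of these substructures, a function of `P` takes new values on `N`, while a
function of `N` acts on `P` as the selector `ρ`. -/
def IsFree (j : A → P) (i : A → N) (ρ : P → P) (ι : N ↪[selLang] Q) (τ : P ↪[selLang] Q) : Prop :=
  ∃ (N₁ : Type u) (_ : selLang.Structure N₁) (κ : N ↪[selLang] N₁) (ν : N₁ → N₁)
    (ι₁ : N₁ ↪[selLang] Q), IsNewSelector κ ν ∧ ι = ι₁.comp κ ∧
      IsAmalgam (fun p w => ∃ y, generatedRel j i p y ∧ κ y = w) (fun _ => ν) (fun _ => ρ) ι₁ τ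

theorem exists_isFree (hN : IsSelectorModel N) (hP : IsSelectorModel P) (hji : SameQF j i)
    (hρ : IsSelector ρ) : ∃ (Q : Type u) (_ : selLang.Structure Q) (_ : Q ⊨ selectorTheory)
      (ι : N ↪[selLang] Q) (τ : P ↪[selLang] Q), IsFree j i ρ ι τ := by
  obtain ⟨N₁, _, κ, ν, hN₁, hν⟩ := exists_isNewSelector hN
  obtain ⟨W, _, ι, τ, hW, -, hA⟩ := exists_isAmalgam hP hN₁
    ((isPartIso_generatedRel hP hN hji.atoms_eq).comp (isPartIso_of_embedding κ))
    (α := fun _ => ν) (β := fun _ => ρ) (fun _ _ => hν.toIsSelector) (fun _ _ => hρ)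
  obtain ⟨Q, _, hQ, ⟨g⟩⟩ := exists_embedding_model hW
  exact ⟨Q, inferInstance, hQ, (g.comp ι).comp κ, g.comp τ, N₁, inferInstance, κ, ν, g.comp ι,
    hν, rfl, hA.comp_embedding g⟩

namespace IsFree

theorem apply (hF : IsFree j i ρ ι τ) (a : A) : τ (j a) = ι (i a) := by
  obtain ⟨_, _, κ, ν, ι₁, -, rfl, hA⟩ := hF
  exact hA.eq_iff.2 ⟨i a, generatedRel_apply j i a, rfl⟩

theorem sameQF (hQ : IsSelectorModel Q) (hQ' : IsSelectorModel Q') (hF : IsFree j i ρ ι τ)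
    (hF' : IsFree j i' ρ ι' τ') {K : Type*} {b : K → N} {b' : K → N'}
    (h : SameQF (Sum.elim i b) (Sum.elim i' b')) :
    SameQF (Sum.elim τ (ι ∘ b)) (Sum.elim τ' (ι' ∘ b')) := by
  obtain ⟨R, hR, hb⟩ := h
  obtain ⟨N₁, _, κ, ν, ι₁, hν, rfl, hA⟩ := hF
  obtain ⟨N₁', _, κ', ν', ι₁', hν', rfl, hA'⟩ := hF'
  have hN₁ := hQ.of_embedding ι₁
  have hN₁' := hQ'.of_embedding ι₁'
  have hR₁ := hν.isPartIso_doubledRel hN₁ hN₁' hν' hR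
  have hEq : IsPartIso (Eq : P → P → Prop) := isPartIso_of_embedding (.refl selLang P)
  have h_val (t : NormalTerm A) : R (t.val i) (t.val i') := hR.val (fun a => hb (.inl a)) t
  refine ⟨_, hA.isPartIso_map hQ hQ' hA' hEq hR₁ ?_ ?_
    (fun _ _ _ _ _ hw _ hy => hν.doubledRel_selector hN₁ hN₁' hν' hR hw hy) ?_, ?_⟩
  · rintro _ _ ⟨_, ⟨t, rfl, rfl⟩, rfl⟩
    exact ⟨_, _, ⟨_, ⟨t, rfl, rfl⟩, rfl⟩, rfl, .inl ⟨_, _, h_val t, rfl, rfl⟩⟩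
  · rintro _ _ ⟨_, ⟨t, rfl, rfl⟩, rfl⟩
    exact ⟨_, _, ⟨_, ⟨t, rfl, rfl⟩, rfl⟩, rfl, .inl ⟨_, _, h_val t, rfl, rfl⟩⟩
  · rintro _ _ x _ - rfl - -
    rfl
  · rintro (p | a)
    · exact .inr ⟨p, p, rfl, rfl, rfl⟩
    · exact .inl ⟨_, _, .inl ⟨_, _, hb (.inr a), rfl, rfl⟩, rfl, rfl⟩

theorem realize_iff [Q ⊨ selectorTheory] [Q' ⊨ selectorTheory] (hF : IsFree j i ρ ι τ)
    (hF' : IsFree j i' ρ ι' τ') {I K : Type*} {b : K → N} {b' : K → N'}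
    (h : SameQF (Sum.elim i b) (Sum.elim i' b')) (d : I → P) (φ : selLang.Formula (I ⊕ K)) :
    φ.Realize (Sum.elim (τ ∘ d) (ι ∘ b)) ↔ φ.Realize (Sum.elim (τ' ∘ d) (ι' ∘ b')) := by
  have hQ := isSelectorModel_of_model Q
  have hQ' := isSelectorModel_of_model Q'
  have := (hF.sameQF hQ hQ' hF' h).comp (Sum.map d id)
  simp only [Sum.elim_comp_map, Function.comp_id] at this
  exact this.realize_iff φ

end IsFree

end FreeExtensions

section GlobalExtensions

variable {P N N' : Type u} [selLang.Structure P] [selLang.Structure N] [selLang.Structure N']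
  [Nonempty N] [N ⊨ selectorTheory] [Nonempty N'] [N' ⊨ selectorTheory] {A : Type*} {n : ℕ}
  {j : A → P} {i : A → N} {i' : A → N'} {ρ : P → P} {d : Fin n → P}
  {q : ForkDiv.GlobalType selLang N n} {q' : ForkDiv.GlobalType selLang N' n}

/-- The global type `q` over `N` is that of the tuple `d` in a free amalgam of `N` and `P`. -/
def IsFreeType (j : A → P) (i : A → N) (ρ : P → P) (d : Fin n → P)
    (q : ForkDiv.GlobalType selLang N n) : Prop :=
  ∃ (Q : Type u) (_ : selLang.Structure Q) (_ : Q ⊨ selectorTheory) (ι : N ↪[selLang] Q)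
    (τ : P ↪[selLang] Q), IsFree j i ρ ι τ ∧ q = ForkDiv.globalTypeOf (toElementary ι) (τ ∘ d)

theorem exists_isFreeType [P ⊨ selectorTheory] (hji : SameQF j i) (hρ : IsSelector ρ)
    (d : Fin n → P) : ∃ q : ForkDiv.GlobalType selLang N n, IsFreeType j i ρ d q := by
  obtain ⟨Q, _, hQ, ι, τ, hF⟩ :=
    exists_isFree (isSelectorModel_of_model N) (isSelectorModel_of_model P) hji hρ
  exact ⟨_, Q, inferInstance, hQ, ι, τ, hF, rfl⟩

theorem IsFreeType.contains_iff (hq : IsFreeType j i ρ d q) (hq' : IsFreeType j i' ρ d q') {k : ℕ}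
    {b : Fin k → N} {b' : Fin k → N'} (h : SameQF (Sum.elim i b) (Sum.elim i' b'))
    (φ : selLang.Formula (Fin n ⊕ Fin k)) : q.Contains φ b ↔ q'.Contains φ b' := by
  obtain ⟨Q, _, _, ι, τ, hF, rfl⟩ := hq
  obtain ⟨Q', _, _, ι', τ', hF', rfl⟩ := hq'
  rw [ForkDiv.contains_globalTypeOf, ForkDiv.contains_globalTypeOf]
  exact hF.realize_iff hF' h d φ

theorem IsFreeType.extends [P ⊨ selectorTheory] {A : Set N} {j : A → P}
    (hq : IsFreeType j ((↑) : A → N) ρ d q) {p : ForkDiv.TypeOver selLang N A n}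
    (hp : ∀ φ : selLang[[A]].Formula (Fin n), Formula.equivSentence φ ∈ p →
      Formula.Realize (BoundedFormula.constantsVarsEquiv φ) (Sum.elim j d)) :
    ForkDiv.Extends q p := by
  obtain ⟨Q, _, _, ι, τ, hF, rfl⟩ := hq
  refine ForkDiv.extends_globalTypeOf_iff.2 fun φ hφ => ?_
  have h := sameQF_map τ (Sum.elim j d)
  rw [Sum.comp_elim, show τ ∘ j = fun x : A => ι x from funext hF.apply] at h
  exact (h.realize_iff _).1 (hp φ hφ)

theorem exists_isInvariantScheme [P ⊨ selectorTheory] {M : Type u} [selLang.Structure M]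
    [Nonempty M] [M ⊨ selectorTheory] {A : Set M} {j : A → P} (hj : SameQF j ((↑) : A → M))
    (hρ : IsSelector ρ) (d : Fin n → P) :
    ∃ q : ∀ (N : Type u) [selLang.Structure N], (M ↪ₑ[selLang] N) → ForkDiv.GlobalType selLang N n,
      ForkDiv.IsInvariantScheme A q ∧ IsFreeType j ((↑) : A → M) ρ d (q M (.refl selLang M)) := by
  have nonempty {N : Type u} [selLang.Structure N] (e : M ↪ₑ[selLang] N) : Nonempty N := .map e ‹_›
  have model {N : Type u} [selLang.Structure N] (e : M ↪ₑ[selLang] N) : N ⊨ selectorTheory :=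
    e.elementarilyEquivalent.theory_model_iff.1 ‹_›
  choose q hq using fun (N : Type u) (_ : selLang.Structure N) (e : M ↪ₑ[selLang] N) =>
    haveI := nonempty e
    haveI := model e
    exists_isFreeType (N := N) (hj.trans (sameQF_map e.toEmbedding _)) hρ d
  refine ⟨fun N _ e => q N _ e, ⟨fun N _ e k φ b b' hb => ?_, fun N N' _ _ e f k φ b => ?_⟩,
    hq M _ (.refl selLang M)⟩
  · have := nonempty e
    have := model e
    have h := (forall_realize_iff_sameQF.1 hb).comp
      (Sum.map (fun a : A => (⟨e a, Set.mem_image_of_mem e a.2⟩ : e '' A)) id)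
    rw [Sum.elim_comp_map, Sum.elim_comp_map] at h
    exact (hq N _ e).contains_iff (hq N _ e) h φ
  · have := nonempty e
    have := model e
    have := nonempty (f.comp e)
    have := model (f.comp e)
    have h := (sameQF_map f.toEmbedding (Sum.elim (fun a : A => e a) b)).symm
    rw [Sum.comp_elim] at h
    exact (hq N' _ (f.comp e)).contains_iff (hq N _ e) h φ

theorem exists_global_extension (M : Type u) [selLang.Structure M] [Nonempty M]
    [M ⊨ selectorTheory] (A : Set M) (p : ForkDiv.TypeOver selLang M A n) :
    ∃ q : ForkDiv.GlobalType selLang M n,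
      ForkDiv.Extends q p ∧ q.Invariant A ∧ ¬ q.ForksOver A := by
  obtain ⟨P, _, j, d, realize_j_iff, mem_p_iff⟩ := p.exists_realization
  have hMP : M ≅[selLang] P := elementarilyEquivalent_iff.2 fun σ => by
    have h := realize_j_iff (σ.relabel Empty.elim)
    rw [Formula.realize_relabel, Formula.realize_relabel, Subsingleton.elim (j ∘ _) default,
      Subsingleton.elim (_ ∘ _) default] at h
    exact h.symm
  have : P ⊨ selectorTheory := hMP.theory_model
  have hP := isSelectorModel_of_model P
  have hM := isSelectorModel_of_model M
  have hj : SameQF j ((↑) : A → M) := (sameQF_iff_atoms_eq hP hM).2 <| Set.ext fun a =>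
    (realize_atomFormula j a).symm.trans <| (realize_j_iff _).trans (realize_atomFormula _ a)
  obtain ⟨ρ, hρ⟩ := exists_isSelector hP
  obtain ⟨q, hq, hfree⟩ := exists_isInvariantScheme hj hρ d
  have h_image : ElementaryEmbedding.refl selLang M '' A = A := Set.image_id A
  refine ⟨_, hfree.extends fun φ => (mem_p_iff φ).1, h_image ▸ hq.invariant M _, ?_⟩
  rintro ⟨k, φ, b, hφ, hfork⟩
  exact hq.not_forks hφ (h_image.symm ▸ hfork)

end GlobalExtensions

end Selector

theorem corollary9p18 :
    -- `T*₁` is a complete theory, it is `NSOP₁` and `NSOP₃`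
    selectorTheory.IsComplete ∧
    ForkDiv.NSOP₁.{u} selectorTheory ∧
    ForkDiv.NSOP₃.{u} selectorTheory ∧
    -- some formula forks but does not divide, over every model
    (∃ (n k : ℕ) (φ : selLang.Formula (Fin n ⊕ Fin k)),
      ∀ (M : Type u) [selLang.Structure M] [Nonempty M] [M ⊨ selectorTheory],
        ∃ (N : Type u) (_ : selLang.Structure N) (e : M ↪ₑ[selLang] N) (b : Fin k → N),
          ForkDiv.Forks (Set.range e) φ b ∧ ¬ ForkDiv.Divides (Set.range e) φ b) ∧
    -- every complete type has a global extension that is invariant and does not fork over its domain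
    (∀ (M : Type u) [selLang.Structure M] [Nonempty M] [M ⊨ selectorTheory] (A : Set M) (n : ℕ)
      (p : ForkDiv.TypeOver selLang M A n),
        ∃ q : ForkDiv.GlobalType selLang M n,
          ForkDiv.Extends q p ∧ q.Invariant A ∧ ¬ q.ForksOver A) :=
  ⟨Selector.selectorTheory_isComplete, Selector.nsop₁, Selector.nsop₁.nsop₃,
    ⟨1, 1, _, fun M _ _ _ => Selector.exists_forks_not_divides M⟩,
    fun M _ _ _ A _ p => Selector.exists_global_extension M A p⟩
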